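/- Let $\tau>1$, $\pi(v)=\tau v-\frac{\tau-1}{v}$, and let $|0\rangle,|1\rangle,\dots$ be the standard basis of $\ell^2_+=\ell^2(\mathbb Z_{\ge 0})$ (complex scalars). Call a bounded self-adjoint operator $A$ on $\ell^2_+$ admissible if $|0\rangle$ is a cyclic vector of $A$ and the spectrum of $A$ is contained in $[-1,1]$. For admissible $A$ let $\Phi=\Phi_A$ be the bounded upper triangular operator with positive diagonal entries such that $A^2+4\tau(\tau-1)=\Phi^*\Phi$, put $A_*=\Phi A\Phi^{-1}$, and define $$\pi^*(A)=\frac1{2\tau}\,U^*\begin{bmatrix}A&\Phi^*\\ \Phi&A_*\end{bmatrix}U,$$ where $U:\ell^2_+\to\ell^2_+\oplus\ell^2_+$ is the unitary operator with $U|2k\rangle=|k\rangle\oplus0$, $U|2k+1\rangle=0\oplus|k\rangle$. For continuous $f$ on $\pi^{-1}([-1,1])\subset[-1,1]$ put $(\mathcal L f)(x)=\frac12\sum_{\pi(v)=x}f(v)$, $x\in[-1,1]$, and let $\mathcal L^*$ be the adjoint operator on measures: $\int f\,d(\mathcal L^*\nu)=\int\mathcal L f\,d\nu$. Theorem. For every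 admissible $A$ the factor $\Phi_A$ exists, is unique and is invertible, and $\pi^*(A)$ is again admissible. There is exactly one probability measure $\mu$ on $[-1,1]$ with $\mathcal L^*\mu=\mu$; it is carried by the Julia set of the rational map $\pi$ of the Riemann sphere, has no atoms and is singular with respect to Lebesgue measure. There is an admissible operator $A$ with spectral measure $\mu$ at $|0\rangle$, that is, $\int\frac{d\mu(x)}{x-z}=\langle0|(A-z)^{-1}|0\rangle$ for all non-real $z$, such that for every admissible $A_0$ the iterates $A_{n+1}=\pi^*(A_n)$ converge to $A$ in the weak operator topology. Moreover, there is a unique system of rational functions $e_k$ and coefficients $c^k_j$ ($0\le j\le k$) with $c^k_k>0$ such that $e_0=1$, $$e_{2k}(v)=e_k(\pi(v)),\qquad e_{2k+1}(v)=\Big(\tau v+\frac{\tau-1}{v}\Big)\sum_{j=0}^k c^k_j\,e_j(\pi(v)),$$ and $\langle e_{2k+1},e_l\rangle_{L^2_{d\mu}}=\delta_{2k+1,l}$ for $l\le 2k+1$. The functions $e_k$ have no poles $\mu$-almost everywhere and form an orthonormal basis of $L^2_{d\mu}$; under the unitary map $L^2_{d\mu}\to\ell^2_+$, $e_k\mapsto|k\rangle$,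 multiplication by the independent variable $v$ becomes $A$. The operators $e_k(A)$ are well defined and $e_k(A)|0\rangle=|k\rangle$. Finally, the upper triangular matrix whose entry in row $j$ and column $k$ is $c^k_j$ (and $0$ for $j>k$) is the matrix of $\Phi_A^{-1}$ for this limit operator $A$. -/

import Mathlib

open Set Filter Topology MeasureTheory
open scoped InnerProductSpace ComplexOrder ComplexConjugate

noncomputable section

namespace RationalRenorm

/-! ### Operators on the half-axis -/

/-- The Hilbert space of square summable complex sequences indexed by `0, 1, 2, …`. -/
abbrev HalfAxis : Type := lp (fun _ : ℕ => ℂ) 2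

/-- Bounded operators on the half-axis. -/
abbrev Op : Type := HalfAxis →L[ℂ] HalfAxis

/-- The standard basis vector `|k⟩`. -/
def ket (k : ℕ) : HalfAxis := lp.single 2 k (1 : ℂ)

theorem orthonormal_ket : Orthonormal ℂ ket := by
  have h := (HilbertBasis.ofRepr (LinearIsometryEquiv.refl ℂ HalfAxis)).orthonormal
  have e : (⇑(HilbertBasis.ofRepr (LinearIsometryEquiv.refl ℂ HalfAxis)) : ℕ → HalfAxis) = ket := by
    funext k
    rw [← HilbertBasis.repr_symm_single]
    rfl
  rwa [e] at h

/-- The matrix entry `⟨i|T|j⟩`. -/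
def entry (T : Op) (i j : ℕ) : ℂ := ⟪ket i, T (ket j)⟫_ℂ

/-- `|0⟩` is a cyclic vector of `A`. -/
def IsCyclicAtZero (A : Op) : Prop :=
  (Submodule.span ℂ (range fun n : ℕ => (A ^ n) (ket 0))).topologicalClosure = ⊤

/-- The operators to which the transform is applied: self-adjoint, with cyclic vector `|0⟩`,
and with spectrum on `[-1, 1]`. -/
structure Admissible (A : Op) : Prop where
  selfAdjoint : IsSelfAdjoint A
  cyclic : IsCyclicAtZero A
  spectrum_subset : spectrum ℂ A ⊆ Complex.ofReal '' Icc (-1 : ℝ) 1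

/-- `Φ` is an upper triangular matrix with positive diagonal entries and
`A² + 4τ(τ-1) = Φ* Φ`. -/
structure IsTriangularFactor (τ : ℝ) (A Φ : Op) : Prop where
  upper : ∀ i j, j < i → entry Φ i j = 0
  diag_pos : ∀ i, 0 < entry Φ i i
  factor : A ^ 2 + ((4 * τ * (τ - 1) : ℝ) : ℂ) • (1 : Op) = Φ.adjoint * Φ

/-- The upper triangular factor `Φ` of `A² + 4τ(τ-1)`. -/
def triangularFactor (τ : ℝ) (A : Op) : Op := Classical.epsilon (IsTriangularFactor τ A)

/-- The isometry `|k⟩ ↦ |2k⟩`. -/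
def evenEmb : HalfAxis →ₗᵢ[ℂ] HalfAxis :=
  (orthonormal_ket.comp (fun k : ℕ => 2 * k)
    (fun a b h => by simpa using h)).orthogonalFamily.linearIsometry

/-- The isometry `|k⟩ ↦ |2k+1⟩`. -/
def oddEmb : HalfAxis →ₗᵢ[ℂ] HalfAxis :=
  (orthonormal_ket.comp (fun k : ℕ => 2 * k + 1)
    (fun a b h => by simpa using h)).orthogonalFamily.linearIsometry

theorem evenEmb_ket (k : ℕ) : evenEmb (ket k) = ket (2 * k) := by
  simp [evenEmb, ket, OrthogonalFamily.linearIsometry_apply_single]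

theorem oddEmb_ket (k : ℕ) : oddEmb (ket k) = ket (2 * k + 1) := by
  simp [oddEmb, ket, OrthogonalFamily.linearIsometry_apply_single]

/-- `U* [[P, Q], [R, S]] U`, where `U` is the unitary operator from the half-axis space onto the
orthogonal sum of two copies of it with `U|2k⟩ = |k⟩ ⊕ 0` and `U|2k+1⟩ = 0 ⊕ |k⟩`; thus
`U*(x ⊕ y) = evenEmb x + oddEmb y` and `U z = evenEmb* z ⊕ oddEmb* z`. -/
def interlace (P Q R S : Op) : Op :=
  let V₀ : Op := evenEmb.toContinuousLinearMap
  let V₁ : Op := oddEmb.toContinuousLinearMap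
  V₀ * P * V₀.adjoint + V₀ * Q * V₁.adjoint + V₁ * R * V₀.adjoint + V₁ * S * V₁.adjoint

/-- The transform `π*(A) = (1/2τ) U* [[A, Φ*], [Φ, A_*]] U` with `A_* = Φ A Φ⁻¹`. -/
def renorm (τ : ℝ) (A : Op) : Op :=
  let Φ := triangularFactor τ A
  ((1 / (2 * τ) : ℝ) : ℂ) • interlace A Φ.adjoint Φ (Φ * A * Ring.inverse Φ)

/-- `ν` is the spectral measure of `A` at `|0⟩`:
`∫ dν(x) / (x - z) = ⟨0|(A - z)⁻¹|0⟩` for all non-real `z`. -/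
def IsSpectralMeasure (A : Op) (ν : Measure ℝ) : Prop :=
  IsFiniteMeasure ν ∧ ∀ z : ℂ, z.im ≠ 0 →
    ∫ x : ℝ, ((x : ℂ) - z)⁻¹ ∂ν = entry (Ring.inverse (A - algebraMap ℂ Op z)) 0 0

/-! ### The Ruelle operator of `π(v) = τ v - (τ - 1) / v` -/

/-- `(𝓛 f)(x) = (1/2) ∑ f(v)` over the solutions `v` of `τ v - (τ - 1) / v = x`. (For `τ > 1` and
real `x` there are exactly two, both real and non-zero.) -/
def ruelle (τ : ℝ) (f : ℝ → ℝ) (x : ℝ) : ℝ :=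
  (1 / 2) * ∑ᶠ v ∈ {v : ℝ | v ≠ 0 ∧ τ * v - (τ - 1) / v = x}, f v

/-- `μ` is a probability measure on `[-1, 1]` with `𝓛* μ = μ`, that is,
`∫ f dμ = ∫ 𝓛 f dμ` for every continuous `f`. -/
structure IsRuelleEigenMeasure (τ : ℝ) (μ : Measure ℝ) : Prop where
  prob : IsProbabilityMeasure μ
  carried : μ (Icc (-1 : ℝ) 1)ᶜ = 0
  eigen : ∀ f : C(ℝ, ℝ), ∫ x, f x ∂μ = ∫ x, ruelle τ f x ∂μ

/-! ### The Julia set -/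

/-- `π(v) = τ v - (τ - 1) / v` as a self-map of the Riemann sphere. -/
def sphereMap (τ : ℝ) : OnePoint ℂ → OnePoint ℂ
  | none => OnePoint.infty
  | some v => open Classical in
      if v = 0 then OnePoint.infty else ((τ * v - (τ - 1) / v : ℂ) : OnePoint ℂ)

/-- The Fatou set: the points with a neighbourhood on which the iterates are equicontinuous (with
respect to the unique uniform structure of the sphere), i.e. form a normal family. -/
def fatouSet (f : OnePoint ℂ → OnePoint ℂ) : Set (OnePoint ℂ) :=
  letI : UniformSpace (OnePoint ℂ) := uniformSpaceOfCompactR1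
  {z | ∃ U ∈ 𝓝 z, EquicontinuousOn (fun n : ℕ => f^[n]) U}

/-- The Julia set. -/
def juliaSet (f : OnePoint ℂ → OnePoint ℂ) : Set (OnePoint ℂ) := (fatouSet f)ᶜ

/-! ### The basis of rational functions -/

/-- The rational function `π = τ v - (τ - 1) / v`. -/
def piRat (τ : ℝ) : RatFunc ℂ :=
  RatFunc.C (τ : ℂ) * RatFunc.X - RatFunc.C ((τ - 1 : ℝ) : ℂ) / RatFunc.X

/-- The rational function `τ v + (τ - 1) / v`. -/
def oddRat (τ : ℝ) : RatFunc ℂ :=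
  RatFunc.C (τ : ℂ) * RatFunc.X + RatFunc.C ((τ - 1 : ℝ) : ℂ) / RatFunc.X

/-- The composition `r ∘ s` of rational functions (`s` non-constant). -/
def ratComp (r s : RatFunc ℂ) : RatFunc ℂ := r.eval RatFunc.C s

/-- The value of a rational function at a real point that is not a pole. -/
def ratVal (r : RatFunc ℂ) (x : ℝ) : ℂ := r.eval (RingHom.id ℂ) (x : ℂ)

/-- The operator `r(A)`, meaningful if the denominator of `r` is invertible at `A`. -/
def ratOp (r : RatFunc ℂ) (A : Op) : Op :=
  Polynomial.aeval A r.num * Ring.inverse (Polynomial.aeval A r.denom)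

/-- The recursion for the system `e` and its coefficients `c k j = c^k_j` (`0 ≤ j ≤ k`, extended
by `0` to `j > k`), with positive `c^k_k` and with the orthonormality conditions
`⟨e_{2k+1}, e_l⟩ = δ_{2k+1,l}`, `l ≤ 2k+1`, in `L²(μ)`. -/
structure IsRenormSystem (τ : ℝ) (μ : Measure ℝ) (e : ℕ → RatFunc ℂ) (c : ℕ → ℕ → ℂ) : Prop where
  zero : e 0 = 1
  even : ∀ k, e (2 * k) = ratComp (e k) (piRat τ)
  odd : ∀ k, e (2 * k + 1) =
    oddRat τ * ∑ j ∈ Finset.range (k + 1), RatFunc.C (c k j) * ratComp (e j) (piRat τ)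
  upper : ∀ k j, k < j → c k j = 0
  diag_pos : ∀ k, 0 < c k k
  orthonormal : ∀ k l, l ≤ 2 * k + 1 →
    ∫ x, conj (ratVal (e l) x) * ratVal (e (2 * k + 1)) x ∂μ = if l = 2 * k + 1 then 1 else 0

end RationalRenorm

end

noncomputable section

namespace RationalRenorm

set_option linter.unusedSectionVars false

/-! ### The inverse branches of `π` -/

/-! Both inverse branches of `π` contract `[-1, 1]` into itself with ratio `1/τ`, and they keep away
from the pole `0`. Averaging over the branches therefore stretches the modulus of continuity by `τ`
at every step, and the iterates `𝓛ⁿ f` of a continuous `f` converge uniformly to a constant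
(`exists_tendsto_ruelleC`). This constant is a positive functional of `f`, so Riesz–Markov turns it
into an eigen-measure; for any eigen-measure it has to be the integral of `f`, whence uniqueness.
The measure sits on the set `cantor` of points whose orbit stays in `[-1, 1]`. Mass at least doubles
along orbits, so there are no atoms; the derivatives of the two branches add up to `1/τ`, so the set
is Lebesgue null; pulling distant points back along contracting branches destroys equicontinuity at
each of its points.

On the operator side, `M = π*(A)` satisfies `τM² = DM + (τ-1)` with `D = A ⊕ A_*`
(`renorm_quadratic`), that is, `π(M) = D`, while `2τM - D` is off-diagonal with blocks `Φ*` and `Φ`.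
So `f(π(M))` acts on the even subspace as `f(A)`, and `2τM - D` maps the even subspace to the odd
one through `Φ`. Splitting `f` into its even and odd parts under the exchange of the branches gives
`⟨0|f(M)|0⟩ = ⟨0|(𝓛f)(A)|0⟩` (`stateOf_renorm`). The spectral functionals of the iterates hence
converge to integration against `μ`.

The passage from moments to matrix entries goes through functions that represent the basis vectors:
for the `n`-th iterate `A_n`, every `|j⟩` with `j ≤ n` equals `p_{n,j}(A_n)|0⟩` (`vecOf_iterBasis`),
where `p_{n,j}` comes from a recursion that uses the functional only through finite Gram matrices.
The columns of the inverse Cholesky factor depend continuously on a positive definite Gram matrix,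
so `p_{n,j}` converges to the solution `p_j` of the recursion for `μ`, and the entries of `A_n`
converge to those of multiplication by `v` in the family `p_j`. The bound `‖A_n‖ ≤ 1` upgrades this
to weak convergence.

The `p_j` are orthonormal because composition with `π` is isometric in `L²(μ)` and the odd factor
changes sign between the branches. They are complete (`span_toL2_fixed`) because, on the Cantor set,
`v^{m+1}` is `α · v^{m+1} ∘ π` with `0 ≤ α < 1` plus functions already known to lie in the closed
span, so that the component orthogonal to the span is at most `α` times its own size. The rational
functions `e_k` coincide with `p_k` on the Cantor set and have no poles there; orthonormality and
positivity of the diagonal force their coefficients to be the Cholesky columns. -/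

/-- The rational map on the real line. -/
def piR (τ v : ℝ) : ℝ := τ * v - (τ - 1) / v

/-- The inverse branch of `π` with sign `σ = ±1`. -/
def br (τ σ x : ℝ) : ℝ := (x + σ * √(x ^ 2 + 4 * τ * (τ - 1))) / (2 * τ)

section Branch

variable {τ σ : ℝ}

theorem const_pos (hτ : 1 < τ) : 0 < 4 * τ * (τ - 1) := by
  have : 0 < τ - 1 := by linarith
  positivity

theorem disc_pos (hτ : 1 < τ) (x : ℝ) : 0 < x ^ 2 + 4 * τ * (τ - 1) := by
  have := const_pos hτ
  positivity

theorem br_quadratic (hτ : 1 < τ) (hσ : σ * σ = 1) (x : ℝ) :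
    τ * br τ σ x ^ 2 - x * br τ σ x - (τ - 1) = 0 := by
  have h := Real.sq_sqrt (disc_pos hτ x).le
  unfold br
  set r := √(x ^ 2 + 4 * τ * (τ - 1))
  have : τ ≠ 0 := by linarith
  field_simp
  linear_combination (σ * σ) * h + (x ^ 2 + 4 * τ * (τ - 1)) * hσ

theorem br_ne_zero (hτ : 1 < τ) (hσ : σ * σ = 1) (x : ℝ) : br τ σ x ≠ 0 := by
  intro h
  have := br_quadratic hτ hσ x
  rw [h] at this
  linarith

theorem piR_br (hτ : 1 < τ) (hσ : σ * σ = 1) (x : ℝ) : piR τ (br τ σ x) = x := by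
  have h0 := br_ne_zero hτ hσ x
  have := br_quadratic hτ hσ x
  unfold piR
  field_simp
  linear_combination this

theorem two_mul_br_sub (hτ : 1 < τ) (x : ℝ) :
    2 * τ * br τ σ x - x = σ * √(x ^ 2 + 4 * τ * (τ - 1)) := by
  unfold br
  have : τ ≠ 0 := by linarith
  field_simp
  ring

/-- With `r`, `s` the two roots, `(r - s)(r + s) = (x - y)(x + y)` and `|x + y| ≤ r + s`. -/
theorem abs_sub_sqrt_le (hτ : 1 < τ) (x y : ℝ) :
    |√(x ^ 2 + 4 * τ * (τ - 1)) - √(y ^ 2 + 4 * τ * (τ - 1))| ≤ |x - y| := by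
  have hx := disc_pos hτ x
  have hy := disc_pos hτ y
  have h1 := Real.sq_sqrt hx.le
  have h2 := Real.sq_sqrt hy.le
  have h3 := Real.sqrt_pos.2 hx
  have h4 := Real.sqrt_pos.2 hy
  have h5 : |x| ≤ √(x ^ 2 + 4 * τ * (τ - 1)) :=
    Real.abs_le_sqrt (by linarith [const_pos hτ])
  have h6 : |y| ≤ √(y ^ 2 + 4 * τ * (τ - 1)) :=
    Real.abs_le_sqrt (by linarith [const_pos hτ])
  set r := √(x ^ 2 + 4 * τ * (τ - 1))
  set s := √(y ^ 2 + 4 * τ * (τ - 1))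
  have h7 : (r - s) * (r + s) = (x - y) * (x + y) := by linear_combination h1 - h2
  have h8 : |r - s| * (r + s) = |x - y| * |x + y| := by
    rw [← abs_mul, ← h7, abs_mul, abs_of_pos (show 0 < r + s by linarith)]
  have h9 : |x + y| ≤ r + s := (abs_add_le x y).trans (add_le_add h5 h6)
  have h10 : |r - s| * (r + s) ≤ |x - y| * (r + s) := by
    rw [h8]; exact mul_le_mul_of_nonneg_left h9 (abs_nonneg _)
  exact le_of_mul_le_mul_right h10 (by linarith)

theorem abs_of_mul_self_eq_one (hσ : σ * σ = 1) : |σ| = 1 := by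
  rcases mul_self_eq_one_iff.1 hσ with h | h <;> simp [h]

/-- The numerator is a sum of two 1-Lipschitz functions and the denominator is `2τ`. This
contraction drives both the convergence of `𝓛ⁿ f` and the Julia set argument. -/
theorem abs_br_sub_le (hτ : 1 < τ) (hσ : σ * σ = 1) (x y : ℝ) :
    |br τ σ x - br τ σ y| ≤ |x - y| / τ := by
  have h := abs_sub_sqrt_le hτ x y
  have e : br τ σ x - br τ σ y = ((x - y) +
      σ * (√(x ^ 2 + 4 * τ * (τ - 1)) - √(y ^ 2 + 4 * τ * (τ - 1)))) / (2 * τ) := by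
    unfold br; ring
  have hp : 0 < 2 * τ := by linarith
  rw [e, abs_div, abs_of_pos hp, div_le_div_iff₀ hp (by linarith)]
  have := abs_add_le (x - y)
    (σ * (√(x ^ 2 + 4 * τ * (τ - 1)) - √(y ^ 2 + 4 * τ * (τ - 1))))
  rw [abs_mul, abs_of_mul_self_eq_one hσ, one_mul] at this
  nlinarith

theorem continuous_br : Continuous (br τ σ) := by
  unfold br; fun_prop

theorem abs_br_le (hτ : 1 < τ) (hσ : σ * σ = 1) {x : ℝ} (hx : |x| ≤ 1) : |br τ σ x| ≤ 1 := by
  have h1 : √(x ^ 2 + 4 * τ * (τ - 1)) ≤ 2 * τ - 1 := by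
    rw [Real.sqrt_le_left (by linarith)]
    nlinarith [sq_abs x, abs_nonneg x]
  have h2 := Real.sqrt_nonneg (x ^ 2 + 4 * τ * (τ - 1))
  have hp : 0 < 2 * τ := by linarith
  unfold br
  rw [abs_div, abs_of_pos hp, div_le_one hp]
  refine (abs_add_le _ _).trans ?_
  rw [abs_mul, abs_of_mul_self_eq_one hσ, one_mul, abs_of_nonneg h2]
  linarith

theorem br_mul_br_neg (hτ : 1 < τ) (hσ : σ * σ = 1) (x : ℝ) :
    br τ σ x * br τ (-σ) x = -((τ - 1) / τ) := by
  have h := Real.sq_sqrt (disc_pos hτ x).le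
  unfold br
  set r := √(x ^ 2 + 4 * τ * (τ - 1))
  have : τ ≠ 0 := by linarith
  field_simp
  linear_combination -(σ * σ) * h - (x ^ 2 + 4 * τ * (τ - 1)) * hσ

/-- The product of the two branches is the constant `-(τ-1)/τ`, so the upper bound `1` for one is a
lower bound for the other. The resulting gap around `0` keeps the pole of `π` away. -/
theorem le_abs_br (hτ : 1 < τ) (hσ : σ * σ = 1) {x : ℝ} (hx : |x| ≤ 1) :
    (τ - 1) / τ ≤ |br τ σ x| := by
  have h1 := br_mul_br_neg hτ hσ x
  have h2 := abs_br_le hτ (show -σ * -σ = 1 by linarith) hx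
  have h3 : |br τ σ x| * |br τ (-σ) x| = (τ - 1) / τ := by
    rw [← abs_mul, h1, abs_neg, abs_of_pos (div_pos (by linarith) (by linarith))]
  rw [← h3]
  exact mul_le_of_le_one_right (abs_nonneg _) h2

theorem eq_br_of_ne_zero (hτ : 1 < τ) {v : ℝ} (hv : v ≠ 0) :
    v = br τ 1 (piR τ v) ∨ v = br τ (-1) (piR τ v) := by
  have h1 : τ * v ^ 2 - piR τ v * v - (τ - 1) = 0 := by
    unfold piR; field_simp; ring
  set x := piR τ v
  have h := Real.sq_sqrt (disc_pos hτ x).le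
  have h2 : (2 * τ * v - x - √(x ^ 2 + 4 * τ * (τ - 1))) *
      (2 * τ * v - x + √(x ^ 2 + 4 * τ * (τ - 1))) = 0 := by
    linear_combination 4 * τ * h1 - h
  have : τ ≠ 0 := by linarith
  rcases mul_eq_zero.1 h2 with h3 | h3
  · left; unfold br; field_simp; linarith
  · right; unfold br; field_simp; linarith

theorem exists_eq_br (hτ : 1 < τ) {v : ℝ} (hv : v ≠ 0) :
    ∃ σ : ℝ, σ * σ = 1 ∧ v = br τ σ (piR τ v) := by
  rcases eq_br_of_ne_zero hτ hv with h | h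
  · exact ⟨1, by norm_num, h⟩
  · exact ⟨-1, by norm_num, h⟩

theorem abs_piR_le (hτ : 1 < τ) {v : ℝ} (hv : (τ - 1) / τ ≤ |v|) (hv1 : |v| ≤ 1) :
    |piR τ v| ≤ 1 := by
  have hp : 0 < τ := by linarith
  rw [div_le_iff₀ hp] at hv
  have key : ∀ w : ℝ, 0 < w → w ≤ 1 → τ - 1 ≤ w * τ → |piR τ w| ≤ 1 := by
    intro w hw h1 h2
    have e : piR τ w = (τ * w ^ 2 - (τ - 1)) / w := by unfold piR; field_simp
    rw [e, abs_le, le_div_iff₀ hw, div_le_iff₀ hw]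
    -- The two bounds are `(w + 1)(τw - (τ-1)) ≥ 0` and `(1 - w)(τw + (τ-1)) ≥ 0`.
    constructor <;> nlinarith
  rcases lt_trichotomy v 0 with h | h | h
  · have := key (-v) (by linarith) (by rwa [abs_of_neg h] at hv1) (by rwa [abs_of_neg h] at hv)
    have e : piR τ (-v) = -piR τ v := by unfold piR; rw [div_neg]; ring
    rwa [e, abs_neg] at this
  · simp [h] at hv; linarith
  · exact key v h (by rwa [abs_of_pos h] at hv1) (by rwa [abs_of_pos h] at hv)

theorem measurable_piR : Measurable (piR τ) := by
  unfold piR; fun_prop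

end Branch

/-! ### The Ruelle operator on continuous functions on `[-1, 1]` -/

/-- The interval `[-1, 1]`. -/
abbrev II : Type := Icc (-1 : ℝ) 1

theorem neg_one_le_one : (-1 : ℝ) ≤ 1 := by norm_num

theorem abs_coe_le (x : II) : |(x : ℝ)| ≤ 1 := abs_le.2 x.2

/-- The inverse branch as a self-map of `[-1, 1]`. -/
def brI (τ σ : ℝ) : C(II, II) :=
  ⟨fun x => projIcc (-1) 1 neg_one_le_one (br τ σ x),
    continuous_projIcc.comp (continuous_br.comp continuous_subtype_val)⟩

theorem coe_brI {τ σ : ℝ} (hτ : 1 < τ) (hσ : σ * σ = 1) (x : II) :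
    (brI τ σ x : ℝ) = br τ σ x := by
  have := projIcc_of_mem neg_one_le_one (abs_le.1 (abs_br_le hτ hσ (abs_coe_le x)))
  exact congrArg Subtype.val this

section Ruelle

variable {E : Type*} [NormedAddCommGroup E] [NormedSpace ℝ E] {τ : ℝ}

/-- The Ruelle operator on `C([-1, 1])`. -/
def ruelleC (τ : ℝ) (f : C(II, E)) : C(II, E) :=
  (1 / 2 : ℝ) • (f.comp (brI τ 1) + f.comp (brI τ (-1)))

theorem ruelleC_apply (f : C(II, E)) (x : II) :
    ruelleC τ f x = (1 / 2 : ℝ) • (f (brI τ 1 x) + f (brI τ (-1) x)) := rfl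

theorem ruelleC_iterate_add (f g : C(II, E)) (n : ℕ) :
    (ruelleC τ)^[n] (f + g) = (ruelleC τ)^[n] f + (ruelleC τ)^[n] g := by
  induction n generalizing f g with
  | zero => rfl
  | succ n ih =>
    have : ruelleC τ (f + g) = ruelleC τ f + ruelleC τ g := by
      ext x; simp only [ruelleC_apply, ContinuousMap.add_apply]; rw [← smul_add]; congr 1; abel
    simp only [Function.iterate_succ_apply, this, ih]

theorem ruelleC_iterate_smul (c : ℝ) (f : C(II, E)) (n : ℕ) :
    (ruelleC τ)^[n] (c • f) = c • (ruelleC τ)^[n] f := by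
  induction n generalizing f with
  | zero => rfl
  | succ n ih =>
    have : ruelleC τ (c • f) = c • ruelleC τ f := by
      ext x; simp only [ruelleC_apply, ContinuousMap.smul_apply]; rw [← smul_add, smul_comm]
    simp only [Function.iterate_succ_apply, this, ih]

theorem ruelleC_iterate_nonneg (f : C(II, ℝ)) (hf : 0 ≤ f) (n : ℕ) :
    0 ≤ (ruelleC τ)^[n] f := by
  induction n generalizing f with
  | zero => exact hf
  | succ n ih =>
    refine ih _ fun x => ?_
    have h1 : 0 ≤ f (brI τ 1 x) := hf _
    have h2 : 0 ≤ f (brI τ (-1) x) := hf _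
    change 0 ≤ (1 / 2 : ℝ) • (f (brI τ 1 x) + f (brI τ (-1) x))
    rw [smul_eq_mul]
    linarith

theorem ruelleC_iterate_const (c : E) (n : ℕ) :
    (ruelleC τ)^[n] (ContinuousMap.const II c) = ContinuousMap.const II c := by
  have : ruelleC τ (ContinuousMap.const II c) = ContinuousMap.const II c := by
    ext x
    simp only [ruelleC_apply, ContinuousMap.const_apply]
    rw [← two_smul ℝ c, smul_smul]; norm_num
  exact Function.iterate_fixed this n

theorem norm_half_smul_add_le {u v : E} {ε : ℝ} (hu : ‖u‖ ≤ ε) (hv : ‖v‖ ≤ ε) :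
    ‖(1 / 2 : ℝ) • (u + v)‖ ≤ ε := by
  rw [norm_smul]
  have := norm_add_le u v
  norm_num
  linarith

/-- Points at distance `τδ` have preimages under a common branch at distance at most `δ`. -/
theorem ruelleC_osc (hτ : 1 < τ) {f : C(II, E)} {δ ε : ℝ}
    (h : ∀ x y : II, |(x : ℝ) - y| ≤ δ → ‖f x - f y‖ ≤ ε) (x y : II)
    (hxy : |(x : ℝ) - y| ≤ τ * δ) : ‖ruelleC τ f x - ruelleC τ f y‖ ≤ ε := by
  have key : ∀ σ : ℝ, σ * σ = 1 → ‖f (brI τ σ x) - f (brI τ σ y)‖ ≤ ε := by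
    intro σ hσ
    apply h
    rw [coe_brI hτ hσ, coe_brI hτ hσ]
    refine (abs_br_sub_le hτ hσ _ _).trans ?_
    rw [div_le_iff₀ (by linarith)]; linarith
  have := norm_half_smul_add_le (key 1 (by norm_num)) (key (-1) (by norm_num))
  rw [ruelleC_apply, ruelleC_apply, ← smul_sub]
  convert this using 3
  abel

theorem ruelleC_iterate_osc (hτ : 1 < τ) (n : ℕ) {f : C(II, E)} {δ ε : ℝ}
    (h : ∀ x y : II, |(x : ℝ) - y| ≤ δ → ‖f x - f y‖ ≤ ε) (x y : II)
    (hxy : |(x : ℝ) - y| ≤ τ ^ n * δ) :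
    ‖(ruelleC τ)^[n] f x - (ruelleC τ)^[n] f y‖ ≤ ε := by
  induction n generalizing f δ with
  | zero => exact h x y (by simpa using hxy)
  | succ n ih =>
    rw [Function.iterate_succ_apply]
    exact ih (ruelleC_osc hτ h) (by rw [pow_succ] at hxy; rwa [← mul_assoc])

theorem ruelleC_iterate_near {f : C(II, E)} {ε : ℝ} {c : E} (h : ∀ x, ‖f x - c‖ ≤ ε) (n : ℕ)
    (x : II) : ‖(ruelleC τ)^[n] f x - c‖ ≤ ε := by
  induction n generalizing f with
  | zero => exact h x
  | succ n ih =>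
    refine ih fun y => ?_
    have := norm_half_smul_add_le (h (brI τ 1 y)) (h (brI τ (-1) y))
    rw [ruelleC_apply]
    convert this using 2
    rw [show f (brI τ 1 y) - c + (f (brI τ (-1) y) - c) =
      (f (brI τ 1 y) + f (brI τ (-1) y)) - (2 : ℝ) • c by rw [two_smul]; abel, smul_sub, smul_smul]
    norm_num

/-- Once `τⁿδ` exceeds the diameter of the interval, the `n`-th iterate oscillates by at most `ε`.
Later iterates are averages of its values, so they stay within `ε` of each of them: the sequence is
Cauchy and its limit has no oscillation. -/
theorem exists_tendsto_ruelleC [CompleteSpace E] (hτ : 1 < τ) (f : C(II, E)) :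
    ∃ c : E, Tendsto (fun n => (ruelleC τ)^[n] f) atTop (𝓝 (ContinuousMap.const II c)) := by
  have hosc : ∀ ε > 0, ∃ N, ∀ n ≥ N, ∀ x y,
      ‖(ruelleC τ)^[n] f x - (ruelleC τ)^[n] f y‖ ≤ ε := by
    intro ε hε
    obtain ⟨δ, hδ, h⟩ := Metric.uniformContinuous_iff.1
      (CompactSpace.uniformContinuous_of_continuous f.continuous) ε hε
    -- The diameter is `2`; half of `δ` turns the strict inequality of uniform continuity into a
    -- non-strict one.
    obtain ⟨N, hN⟩ := ((tendsto_pow_atTop_atTop_of_one_lt hτ).eventually_ge_atTop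
      (2 / (δ / 2))).exists_forall_of_atTop
    refine ⟨N, fun n hn x y => ruelleC_iterate_osc hτ n (δ := δ / 2) ?_ x y ?_⟩
    · intro x y hxy
      rw [← dist_eq_norm]
      exact (h (by rw [Subtype.dist_eq, Real.dist_eq]; linarith)).le
    · have := (div_le_iff₀ (by positivity)).1 (hN n hn)
      refine le_trans ?_ this
      have h1 := abs_sub (x : ℝ) y
      linarith [abs_coe_le x, abs_coe_le y]
  have hdist : ∀ ε > 0, ∃ N, ∀ n ≥ N,
      ‖(ruelleC τ)^[n] f - (ruelleC τ)^[N] f‖ ≤ ε := by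
    intro ε hε
    obtain ⟨N, hN⟩ := hosc ε hε
    refine ⟨N, fun n hn => (ContinuousMap.norm_le _ hε.le).2 fun x => ?_⟩
    obtain ⟨m, rfl⟩ := Nat.exists_eq_add_of_le hn
    rw [add_comm, Function.iterate_add_apply]
    exact ruelleC_iterate_near (fun y => hN N le_rfl y x) m x
  have hC : CauchySeq (fun n => (ruelleC τ)^[n] f) := by
    refine Metric.cauchySeq_iff'.2 fun ε hε => ?_
    obtain ⟨N, hN⟩ := hdist (ε / 2) (by positivity)
    exact ⟨N, fun n hn => by rw [dist_eq_norm]; linarith [hN n hn]⟩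
  obtain ⟨g, hg⟩ := cauchySeq_tendsto_of_complete hC
  have hpt : ∀ x, Tendsto (fun n => (ruelleC τ)^[n] f x) atTop (𝓝 (g x)) := fun x =>
    ((continuous_eval_const x).tendsto g).comp hg
  refine ⟨g ⟨0, by norm_num⟩, ?_⟩
  suffices h : ContinuousMap.const II (g ⟨0, by norm_num⟩) = g by rwa [h]
  ext x
  rw [ContinuousMap.const_apply]
  refine eq_of_sub_eq_zero (norm_le_zero_iff.1 (le_of_forall_pos_le_add fun ε hε => ?_))
  obtain ⟨N, hN⟩ := hosc ε hε
  rw [zero_add]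
  exact le_of_tendsto ((hpt _).sub (hpt x)).norm (eventually_atTop.2 ⟨N, fun n hn => hN n hn _ _⟩)

end Ruelle

/-! ### The eigen-measure of the Ruelle operator -/

theorem br_one_pos {τ : ℝ} (hτ : 1 < τ) (x : ℝ) : 0 < br τ 1 x := by
  have h1 : |x| < √(x ^ 2 + 4 * τ * (τ - 1)) := by
    rw [← Real.sqrt_sq_eq_abs]
    exact Real.sqrt_lt_sqrt (sq_nonneg x) (by linarith [const_pos hτ])
  exact div_pos (by linarith [neg_abs_le x]) (by linarith)

theorem br_neg_one_neg {τ : ℝ} (hτ : 1 < τ) (x : ℝ) : br τ (-1) x < 0 := by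
  have h1 : |x| < √(x ^ 2 + 4 * τ * (τ - 1)) := by
    rw [← Real.sqrt_sq_eq_abs]
    exact Real.sqrt_lt_sqrt (sq_nonneg x) (by linarith [const_pos hτ])
  exact div_neg_of_neg_of_pos (by linarith [le_abs_self x]) (by linarith)

theorem ruelle_eq {τ : ℝ} (hτ : 1 < τ) (f : ℝ → ℝ) (x : ℝ) :
    ruelle τ f x = (1 / 2) * (f (br τ 1 x) + f (br τ (-1) x)) := by
  have hs : {v : ℝ | v ≠ 0 ∧ τ * v - (τ - 1) / v = x} = {br τ 1 x, br τ (-1) x} := by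
    ext v
    constructor
    · rintro ⟨h0, rfl⟩
      exact eq_br_of_ne_zero hτ h0
    · rintro (rfl | rfl)
      · exact ⟨br_ne_zero hτ (by norm_num) x, piR_br hτ (by norm_num) x⟩
      · exact ⟨br_ne_zero hτ (by norm_num) x, piR_br hτ (by norm_num) x⟩
  have hne : br τ 1 x ≠ br τ (-1) x := by
    have := br_one_pos hτ x
    have := br_neg_one_neg hτ x
    linarith
  rw [ruelle, hs, finsum_mem_pair hne]

section Eigen

variable {τ : ℝ} {μ : Measure ℝ}

theorem IsRuelleEigenMeasure.ae_mem (h : IsRuelleEigenMeasure τ μ) : ∀ᵐ x ∂μ, x ∈ Icc (-1 : ℝ) 1 :=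
  h.carried

theorem integrable_bounded {E : Type*} [NormedAddCommGroup E] [IsFiniteMeasure μ]
    (f : BoundedContinuousFunction ℝ E) : Integrable f μ :=
  Integrable.of_bound f.continuous.aestronglyMeasurable ‖f‖
    (Eventually.of_forall f.norm_coe_le_norm)

/-- Finite measures are determined by bounded continuous test functions. In this form the invariance
applies to Borel sets and to vector-valued integrands. -/
theorem IsRuelleEigenMeasure.eq_half (hτ : 1 < τ) (h : IsRuelleEigenMeasure τ μ) :
    (2 : ENNReal) • μ = μ.map (br τ 1) + μ.map (br τ (-1)) := by
  have := h.prob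
  have : IsFiniteMeasure ((2 : ENNReal) • μ) := Measure.smul_finite _ (by norm_num)
  have hm : ∀ σ, Measurable (br τ σ) := fun σ => continuous_br.measurable
  have i1 : IsFiniteMeasure (μ.map (br τ 1)) := inferInstance
  refine ext_of_forall_integral_eq_of_IsFiniteMeasure fun f => ?_
  have hi : ∀ (ν : Measure ℝ) [IsFiniteMeasure ν], Integrable f ν := fun ν _ => integrable_bounded f
  rw [integral_smul_measure, integral_add_measure (hi _) (hi _),
    integral_map (hm _).aemeasurable f.continuous.aestronglyMeasurable,
    integral_map (hm _).aemeasurable f.continuous.aestronglyMeasurable]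
  have e := h.eigen f.toContinuousMap
  have hc : ∀ σ, Integrable (fun x => f (br τ σ x)) μ := fun σ =>
    integrable_bounded (f.compContinuous ⟨br τ σ, continuous_br⟩)
  have e2 : ∫ x, ruelle τ f.toContinuousMap x ∂μ =
      (1 / 2) * (∫ x, f (br τ 1 x) ∂μ + ∫ x, f (br τ (-1) x) ∂μ) := by
    rw [← integral_add (hc _) (hc _), ← integral_const_mul]
    exact integral_congr_ae (Eventually.of_forall fun x => ruelle_eq hτ _ x)
  rw [e2] at e
  change ∫ x, f x ∂μ = _ at e
  rw [e]
  simp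

theorem integral_half {E : Type*} [NormedAddCommGroup E] [NormedSpace ℝ E]
    (hτ : 1 < τ) (h : IsRuelleEigenMeasure τ μ) (f : BoundedContinuousFunction ℝ E) :
    ∫ x, f x ∂μ = (1 / 2 : ℝ) • (∫ x, f (br τ 1 x) ∂μ + ∫ x, f (br τ (-1) x) ∂μ) := by
  have := h.prob
  have hm : ∀ σ, Measurable (br τ σ) := fun σ => continuous_br.measurable
  have e := congrArg (fun ν => ∫ x, f x ∂ν) (h.eq_half hτ)
  have hi : ∀ (ν : Measure ℝ) [IsFiniteMeasure ν], Integrable f ν := fun ν _ => integrable_bounded f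
  rw [integral_smul_measure, integral_add_measure (hi _) (hi _),
    integral_map (hm _).aemeasurable f.continuous.aestronglyMeasurable,
    integral_map (hm _).aemeasurable f.continuous.aestronglyMeasurable] at e
  rw [← e, smul_smul]
  simp

/-- The extension of a continuous function on `[-1, 1]` to a bounded function on the line. -/
def extC {E : Type*} [NormedAddCommGroup E] (f : C(II, E)) : BoundedContinuousFunction ℝ E :=
  (BoundedContinuousFunction.mkOfCompact f).compContinuous
    ⟨projIcc (-1) 1 neg_one_le_one, continuous_projIcc⟩

theorem extC_coe {E : Type*} [NormedAddCommGroup E] (f : C(II, E)) (x : II) :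
    extC f (x : ℝ) = f x := by
  change f (projIcc (-1) 1 neg_one_le_one x) = f x
  rw [projIcc_val]

/-- The integral of a continuous function on `[-1, 1]`. -/
def meanC {E : Type*} [NormedAddCommGroup E] [NormedSpace ℝ E] (μ : Measure ℝ) (f : C(II, E)) : E :=
  ∫ x, extC f x ∂μ

section Mean

variable {E : Type*} [NormedAddCommGroup E] [NormedSpace ℝ E]

theorem meanC_ruelleC (hτ : 1 < τ) (h : IsRuelleEigenMeasure τ μ) (f : C(II, E)) :
    meanC μ (ruelleC τ f) = meanC μ f := by
  have := h.prob
  have hc : ∀ σ, Integrable (fun x => extC f (br τ σ x)) μ := fun σ =>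
    integrable_bounded ((extC f).compContinuous ⟨br τ σ, continuous_br⟩)
  rw [meanC, meanC, integral_half hτ h (extC f), ← integral_add (hc _) (hc _), ← integral_smul]
  refine integral_congr_ae ?_
  filter_upwards [h.ae_mem] with x hx
  lift x to II using hx
  rw [extC_coe, ruelleC_apply]
  simp only [← coe_brI hτ (show (1 : ℝ) * 1 = 1 by norm_num),
    ← coe_brI hτ (show (-1 : ℝ) * -1 = 1 by norm_num), extC_coe]

theorem norm_meanC_le [IsProbabilityMeasure μ] (f : C(II, E)) : ‖meanC μ f‖ ≤ ‖f‖ := by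
  have := norm_integral_le_of_norm_le_const (μ := μ) (f := extC f) (C := ‖f‖)
    (Eventually.of_forall fun x => f.norm_coe_le_norm _)
  simpa [meanC] using this

theorem meanC_const [CompleteSpace E] [IsProbabilityMeasure μ] (c : E) :
    meanC μ (ContinuousMap.const II c) = c := by
  have : ∀ x, extC (ContinuousMap.const II c) x = c := fun x => rfl
  simp [meanC, this]

theorem meanC_sub [IsProbabilityMeasure μ] (f g : C(II, E)) :
    meanC μ (f - g) = meanC μ f - meanC μ g := by
  rw [meanC, meanC, meanC, ← integral_sub (integrable_bounded _) (integrable_bounded _)]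
  rfl

/-- The mean is constant along the iteration and continuous in the uniform norm, so it equals the
mean of the limit. -/
theorem meanC_eq_of_tendsto [CompleteSpace E] (hτ : 1 < τ) (h : IsRuelleEigenMeasure τ μ)
    {f : C(II, E)} {c : E}
    (hc : Tendsto (fun n => (ruelleC τ)^[n] f) atTop (𝓝 (ContinuousMap.const II c))) :
    meanC μ f = c := by
  have := h.prob
  have h1 : ∀ n, meanC μ ((ruelleC τ)^[n] f) = meanC μ f := by
    intro n
    induction n with
    | zero => rfl
    | succ n ih => rw [Function.iterate_succ_apply', meanC_ruelleC hτ h, ih]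
  have h2 : Tendsto (fun n => meanC μ ((ruelleC τ)^[n] f)) atTop (𝓝 c) := by
    rw [tendsto_iff_norm_sub_tendsto_zero] at hc ⊢
    refine squeeze_zero (fun _ => norm_nonneg _) (fun n => ?_) hc
    conv_lhs => rw [← meanC_const (μ := μ) c, ← meanC_sub]
    exact norm_meanC_le _
  simp only [h1] at h2
  exact tendsto_nhds_unique tendsto_const_nhds h2

end Mean

theorem IsRuelleEigenMeasure.unique (hτ : 1 < τ) (h : IsRuelleEigenMeasure τ μ) {ν : Measure ℝ}
    (h' : IsRuelleEigenMeasure τ ν) : ν = μ := by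
  have := h.prob
  have := h'.prob
  refine ext_of_forall_integral_eq_of_IsFiniteMeasure fun f => ?_
  set g : C(II, ℝ) := ⟨fun x => f x, f.continuous.comp continuous_subtype_val⟩ with hg
  have key : ∀ {ρ : Measure ℝ}, IsRuelleEigenMeasure τ ρ → ∫ x, f x ∂ρ = meanC ρ g := by
    intro ρ hρ
    refine integral_congr_ae ?_
    filter_upwards [hρ.ae_mem] with x hx
    lift x to II using hx
    rw [extC_coe]; rfl
  obtain ⟨c, hc⟩ := exists_tendsto_ruelleC hτ g
  rw [key h, key h', meanC_eq_of_tendsto hτ h hc, meanC_eq_of_tendsto hτ h' hc]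

/-- The limiting constant is linear and positive in `f`, equals `1` at `1`, and is unchanged by `𝓛`
because this only shifts the sequence. The Riesz measure on the interval is then pushed forward to
the line. -/
theorem exists_isRuelleEigenMeasure (hτ : 1 < τ) : ∃ μ, IsRuelleEigenMeasure τ μ := by
  choose Λ hΛ using fun f : C(II, ℝ) => exists_tendsto_ruelleC hτ f
  have heval : ∀ f, Tendsto (fun n => (ruelleC τ)^[n] f ⟨0, by norm_num⟩) atTop (𝓝 (Λ f)) :=
    fun f => ((continuous_eval_const (⟨0, by norm_num⟩ : II)).tendsto _).comp (hΛ f)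
  let Λ' : CompactlySupportedContinuousMap II ℝ →ₗ[ℝ] ℝ :=
    { toFun := fun f => Λ f.toContinuousMap
      map_add' := fun f g => by
        refine tendsto_nhds_unique (heval _) ?_
        have := (heval f.toContinuousMap).add (heval g.toContinuousMap)
        refine this.congr fun n => ?_
        rw [← ContinuousMap.add_apply, ← ruelleC_iterate_add]
        rfl
      map_smul' := fun c f => by
        refine tendsto_nhds_unique (heval _) ?_
        have := (heval f.toContinuousMap).const_mul c
        refine this.congr fun n => ?_
        rw [← smul_eq_mul, ← ContinuousMap.smul_apply, ← ruelleC_iterate_smul]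
        rfl }
  let Λp := PositiveLinearMap.mk₀ Λ' (fun f hf =>
    ge_of_tendsto' (heval f.toContinuousMap) fun n => ruelleC_iterate_nonneg _ hf n _)
  have hint : ∀ f : C(II, ℝ), ∫ x, f x ∂(RealRMK.rieszMeasure Λp) = Λ f := fun f =>
    RealRMK.integral_rieszMeasure Λp (CompactlySupportedContinuousMap.continuousMapEquiv f)
  have hΛL : ∀ f, Λ (ruelleC τ f) = Λ f := fun f => by
    refine tendsto_nhds_unique (heval _) ?_
    have := (tendsto_add_atTop_iff_nat 1).2 (heval f)
    exact this
  have hΛ1 : Λ (ContinuousMap.const II 1) = 1 := by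
    refine tendsto_nhds_unique (heval _) ?_
    simp only [ruelleC_iterate_const]
    exact tendsto_const_nhds
  set μ₀ := RealRMK.rieszMeasure Λp
  have hfin : IsFiniteMeasure μ₀ := inferInstance
  have hprob : IsProbabilityMeasure μ₀ := by
    have := hint (ContinuousMap.const II 1)
    rw [hΛ1] at this
    simp only [ContinuousMap.const_apply, integral_const, smul_eq_mul, mul_one] at this
    constructor
    rw [Measure.real, ENNReal.toReal_eq_one_iff] at this
    exact this
  have hval : Measurable (Subtype.val : II → ℝ) := measurable_subtype_coe
  refine ⟨μ₀.map Subtype.val, Measure.isProbabilityMeasure_map hval.aemeasurable, ?_, fun f => ?_⟩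
  · rw [Measure.map_apply hval measurableSet_Icc.compl]
    have : (Subtype.val : II → ℝ) ⁻¹' (Icc (-1) 1)ᶜ = ∅ := by
      ext x; simp
    rw [this, measure_empty]
  · have hr : Continuous (ruelle τ f) := by
      have : ruelle τ f = fun x => (1 / 2) * (f (br τ 1 x) + f (br τ (-1) x)) :=
        funext (ruelle_eq hτ f)
      rw [this]
      have h1 : Continuous (br τ 1) := continuous_br
      have h2 : Continuous (br τ (-1)) := continuous_br
      fun_prop
    rw [integral_map hval.aemeasurable f.continuous.aestronglyMeasurable,
      integral_map hval.aemeasurable hr.aestronglyMeasurable]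
    have h1 := hint (f.comp ⟨Subtype.val, continuous_subtype_val⟩)
    have h2 := hint (ruelleC τ (f.comp ⟨Subtype.val, continuous_subtype_val⟩))
    rw [hΛL] at h2
    refine h1.trans (h2.symm.trans (integral_congr_ae (Eventually.of_forall fun x => ?_)))
    simp only [ruelleC_apply, ruelle_eq hτ, ContinuousMap.comp_apply, ContinuousMap.coe_mk,
      coe_brI hτ (show (1 : ℝ) * 1 = 1 by norm_num),
      coe_brI hτ (show (-1 : ℝ) * -1 = 1 by norm_num), smul_eq_mul]

end Eigen

/-! ### The invariant Cantor set -/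

section Cantor

variable {τ : ℝ}

/-- A continuous self-map of `[-1, 1]` that agrees with `π` on `π⁻¹([-1, 1])`. -/
def piI (hτ : 1 < τ) : C(II, II) :=
  ⟨fun x => projIcc (-1) 1 neg_one_le_one
    (τ * x - (τ - 1) * (x / max ((x : ℝ) ^ 2) (((τ - 1) / τ) ^ 2))), by
    refine continuous_projIcc.comp ?_
    have h : ∀ x : II, max ((x : ℝ) ^ 2) (((τ - 1) / τ) ^ 2) ≠ 0 := fun x =>
      (lt_max_of_lt_right (by have : 0 < τ - 1 := by linarith
                              positivity)).ne'
    have := continuous_subtype_val (p := fun x : ℝ => x ∈ Icc (-1 : ℝ) 1)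
    have h2 : Continuous fun x : II => (x : ℝ) / max ((x : ℝ) ^ 2) (((τ - 1) / τ) ^ 2) :=
      Continuous.div (by fun_prop) (by fun_prop) h
    fun_prop⟩

theorem ratio_pos (hτ : 1 < τ) : 0 < (τ - 1) / τ := div_pos (by linarith) (by linarith)

/-- Outside the gap the maximum in the denominator is `x²`, and `π` already takes values in `[-1,
1]`, so neither the truncation nor the projection has any effect. -/
theorem coe_piI (hτ : 1 < τ) {x : II} (hx : (τ - 1) / τ ≤ |(x : ℝ)|) :
    (piI hτ x : ℝ) = piR τ x := by
  have h0 := ratio_pos hτ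
  have h1 : max ((x : ℝ) ^ 2) (((τ - 1) / τ) ^ 2) = (x : ℝ) ^ 2 := by
    rw [max_eq_left]
    rw [← sq_abs (x : ℝ)]
    gcongr
  have hx0 : (x : ℝ) ≠ 0 := abs_pos.1 (h0.trans_le hx)
  have h2 : τ * (x : ℝ) - (τ - 1) * (x / max ((x : ℝ) ^ 2) (((τ - 1) / τ) ^ 2)) = piR τ x := by
    rw [h1]; unfold piR; field_simp
  have h3 := projIcc_of_mem neg_one_le_one (abs_le.1 (abs_piR_le hτ hx (abs_coe_le x)))
  have h4 := congrArg Subtype.val h3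
  simp only [← h2] at h4
  exact h4.trans h2

theorem le_abs_brI (hτ : 1 < τ) {σ : ℝ} (hσ : σ * σ = 1) (x : II) :
    (τ - 1) / τ ≤ |(brI τ σ x : ℝ)| := by
  rw [coe_brI hτ hσ]
  exact le_abs_br hτ hσ (abs_coe_le x)

theorem piI_brI (hτ : 1 < τ) {σ : ℝ} (hσ : σ * σ = 1) (x : II) : piI hτ (brI τ σ x) = x := by
  apply Subtype.ext
  rw [coe_piI hτ (le_abs_brI hτ hσ x), coe_brI hτ hσ, piR_br hτ hσ]

theorem exists_eq_brI (hτ : 1 < τ) {x : II} (hx : (τ - 1) / τ ≤ |(x : ℝ)|) :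
    x = brI τ 1 (piI hτ x) ∨ x = brI τ (-1) (piI hτ x) := by
  have hx0 : (x : ℝ) ≠ 0 := abs_pos.1 ((ratio_pos hτ).trans_le hx)
  rcases eq_br_of_ne_zero hτ hx0 with h | h
  · left
    apply Subtype.ext
    rw [coe_brI hτ (by norm_num), coe_piI hτ hx, ← h]
  · right
    apply Subtype.ext
    rw [coe_brI hτ (by norm_num), coe_piI hτ hx, ← h]

/-- The set of points whose orbit under `π` stays in `[-1, 1]`. -/
def cantor (hτ : 1 < τ) : Set II := {x | ∀ n, (τ - 1) / τ ≤ |((piI hτ)^[n] x : ℝ)|}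

theorem isClosed_cantor (hτ : 1 < τ) : IsClosed (cantor hτ) := by
  have : cantor hτ = ⋂ n, {x | (τ - 1) / τ ≤ |((piI hτ)^[n] x : ℝ)|} := by
    ext; simp [cantor]
  rw [this]
  refine isClosed_iInter fun n => isClosed_le continuous_const ?_
  exact (continuous_subtype_val.comp ((piI hτ).continuous.iterate n)).abs

theorem le_abs_of_mem_cantor (hτ : 1 < τ) {x : II} (hx : x ∈ cantor hτ) :
    (τ - 1) / τ ≤ |(x : ℝ)| := hx 0

theorem piI_mem_cantor (hτ : 1 < τ) {x : II} (hx : x ∈ cantor hτ) : piI hτ x ∈ cantor hτ :=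
  fun n => hx (n + 1)

theorem ae_cantor (hτ : 1 < τ) {μ : Measure ℝ} (h : IsRuelleEigenMeasure τ μ) :
    ∀ᵐ x ∂μ, x ∈ Subtype.val '' cantor hτ := by
  have hm : ∀ σ, Measurable (br τ σ) := fun σ => continuous_br.measurable
  -- Invariance as a transfer principle: a property that holds almost everywhere at both preimages
  -- holds almost everywhere. Each use adds one more iterate to the control of the orbit.
  have hpre : ∀ s, MeasurableSet s → (∀ᵐ x ∂μ, br τ 1 x ∈ s ∧ br τ (-1) x ∈ s) →
      ∀ᵐ x ∂μ, x ∈ s := by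
    intro s hs hx
    have e := congrArg (fun ν : Measure ℝ => ν sᶜ) (h.eq_half hτ)
    simp only [Measure.smul_apply, Measure.add_apply] at e
    rw [Measure.map_apply (hm _) hs.compl, Measure.map_apply (hm _) hs.compl] at e
    have e1 : μ (br τ 1 ⁻¹' sᶜ) = 0 := hx.mono fun x hx => hx.1
    have e2 : μ (br τ (-1) ⁻¹' sᶜ) = 0 := hx.mono fun x hx => hx.2
    rw [e1, e2] at e
    change μ sᶜ = 0
    simpa using e
  have hK : ∀ᵐ x ∂μ, (τ - 1) / τ ≤ |x| ∧ |x| ≤ 1 := by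
    refine hpre {x | (τ - 1) / τ ≤ |x| ∧ |x| ≤ 1} ?_ ?_
    · exact ((isClosed_le continuous_const continuous_abs).inter
        (isClosed_le continuous_abs continuous_const)).measurableSet
    · filter_upwards [h.ae_mem] with x hx
      have hx' := abs_le.2 hx
      exact ⟨⟨le_abs_br hτ (by norm_num) hx', abs_br_le hτ (by norm_num) hx'⟩,
        ⟨le_abs_br hτ (by norm_num) hx', abs_br_le hτ (by norm_num) hx'⟩⟩
  have hn : ∀ n : ℕ, ∀ᵐ x ∂μ, (τ - 1) / τ ≤ |(piR τ)^[n] x| ∧ |(piR τ)^[n] x| ≤ 1 := by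
    intro n
    induction n with
    | zero => exact hK
    | succ n ih =>
      refine hpre {x | (τ - 1) / τ ≤ |(piR τ)^[n + 1] x| ∧ |(piR τ)^[n + 1] x| ≤ 1} ?_ ?_
      · have hmi := measurable_piR.iterate (f := piR τ) (n + 1)
        exact (measurableSet_le measurable_const hmi.abs).inter
          (measurableSet_le hmi.abs measurable_const)
      · filter_upwards [ih] with x hx
        simp only [Function.iterate_succ_apply,
          piR_br hτ (show (1 : ℝ) * 1 = 1 by norm_num),
          piR_br hτ (show (-1 : ℝ) * -1 = 1 by norm_num)]
        exact ⟨hx, hx⟩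
  filter_upwards [ae_all_iff.2 hn] with x hx
  refine ⟨⟨x, abs_le.1 (hx 0).2⟩, fun n => ?_, rfl⟩
  suffices e : (((piI hτ)^[n] ⟨x, abs_le.1 (hx 0).2⟩ : II) : ℝ) = (piR τ)^[n] x by
    rw [e]; exact (hx n).1
  induction n with
  | zero => rfl
  | succ n ih =>
    rw [Function.iterate_succ_apply', Function.iterate_succ_apply', coe_piI hτ, ih]
    rw [ih]; exact (hx n).1

/-- The sets where one or the other branch takes the value `x` are disjoint and both lie in
`{π(x)}`, so `2 μ{x} ≤ μ{π(x)}`. Iterating along the orbit gives `2ⁿ μ{x} ≤ 1`. -/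
theorem measure_singleton_eq_zero (hτ : 1 < τ) {μ : Measure ℝ} (h : IsRuelleEigenMeasure τ μ)
    (x : ℝ) : μ {x} = 0 := by
  have := h.prob
  have hm : ∀ σ, Measurable (br τ σ) := fun σ => continuous_br.measurable
  have step : ∀ x, 2 * μ {x} ≤ μ {piR τ x} := by
    intro x
    have e := congrArg (fun ν : Measure ℝ => ν {x}) (h.eq_half hτ)
    simp only [Measure.smul_apply, Measure.add_apply, smul_eq_mul] at e
    rw [Measure.map_apply (hm _) (measurableSet_singleton x),
      Measure.map_apply (hm _) (measurableSet_singleton x)] at e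
    rw [e, ← measure_union _ ((hm _) (measurableSet_singleton x))]
    · refine measure_mono ?_
      rintro y (hy | hy)
      · rw [← (hy : br τ 1 y = x), piR_br hτ (by norm_num)]; rfl
      · rw [← (hy : br τ (-1) y = x), piR_br hτ (by norm_num)]; rfl
    · refine Set.disjoint_left.2 fun y hy hy' => ?_
      have h1 := br_one_pos hτ y
      have h2 := br_neg_one_neg hτ y
      rw [(hy : br τ 1 y = x)] at h1
      rw [(hy' : br τ (-1) y = x)] at h2
      linarith
  have hpow : ∀ n : ℕ, ∀ x, 2 ^ n * μ {x} ≤ 1 := by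
    intro n
    induction n with
    | zero => intro x; rw [pow_zero, one_mul]; exact prob_le_one
    | succ n ih =>
      intro x
      rw [pow_succ, mul_assoc]
      exact (mul_le_mul_right (step x) _).trans (ih _)
  by_contra hne
  have hr : 0 < (μ {x}).toReal := ENNReal.toReal_pos hne (measure_ne_top μ _)
  obtain ⟨n, hn⟩ := pow_unbounded_of_one_lt (1 / (μ {x}).toReal) (by norm_num : (1 : ℝ) < 2)
  have h1 := ENNReal.toReal_mono ENNReal.one_ne_top (hpow n x)
  rw [ENNReal.toReal_mul] at h1
  simp only [ENNReal.toReal_pow, ENNReal.toReal_ofNat, ENNReal.toReal_one] at h1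
  rw [div_lt_iff₀ hr] at hn
  linarith

theorem hasDerivAt_br (hτ : 1 < τ) (σ x : ℝ) :
    HasDerivAt (br τ σ) ((1 + σ * (x / √(x ^ 2 + 4 * τ * (τ - 1)))) / (2 * τ)) x := by
  have h := ((hasDerivAt_pow 2 x).add_const (4 * τ * (τ - 1))).sqrt (disc_pos hτ x).ne'
  have h2 := ((hasDerivAt_id x).add (h.const_mul σ)).div_const (2 * τ)
  refine h2.congr_deriv ?_
  congr 3
  simp only [Nat.cast_ofNat, Nat.add_one_sub_one, pow_one]
  exact mul_div_mul_left _ _ two_ne_zero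

/-- The set is covered by its images under the two branches, and the derivatives of the branches sum
to exactly `1/τ`. Its finite measure is thus at most `1/τ` times itself. -/
theorem volume_cantor (hτ : 1 < τ) : volume (Subtype.val '' cantor hτ : Set ℝ) = 0 := by
  set K : Set ℝ := Subtype.val '' cantor hτ with hK
  have hKm : MeasurableSet K :=
    ((isClosed_cantor hτ).isCompact.image continuous_subtype_val).isClosed.measurableSet
  have hsub : K ⊆ br τ 1 '' K ∪ br τ (-1) '' K := by
    rintro _ ⟨x, hx, rfl⟩
    rcases exists_eq_brI hτ (le_abs_of_mem_cantor hτ hx) with h | h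
    · left
      refine ⟨_, ⟨_, piI_mem_cantor hτ hx, rfl⟩, ?_⟩
      rw [← coe_brI hτ (by norm_num), ← h]
    · right
      refine ⟨_, ⟨_, piI_mem_cantor hτ hx, rfl⟩, ?_⟩
      rw [← coe_brI hτ (by norm_num), ← h]
  have hle : volume K ≤ ENNReal.ofReal (1 / τ) * volume K := by
    have hinj : ∀ σ : ℝ, σ * σ = 1 → InjOn (br τ σ) K := fun σ hσ x _ y _ hxy => by
      rw [← piR_br hτ hσ x, hxy, piR_br hτ hσ y]
    have hvol : ∀ σ : ℝ, σ * σ = 1 → volume (br τ σ '' K) =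
        ∫⁻ x in K, ENNReal.ofReal ((1 + σ * (x / √(x ^ 2 + 4 * τ * (τ - 1)))) / (2 * τ)) := by
      intro σ hσ
      have := lintegral_image_eq_lintegral_abs_deriv_mul hKm
        (fun x _ => (hasDerivAt_br hτ σ x).hasDerivWithinAt) (hinj σ hσ) (fun _ => 1)
      simp only [lintegral_const, MeasurableSet.univ, Measure.restrict_apply, univ_inter, one_mul,
        mul_one] at this
      rw [this]
      refine lintegral_congr fun x => ?_
      rw [abs_of_nonneg]
      refine div_nonneg ?_ (by linarith)
      have h3 : |x / √(x ^ 2 + 4 * τ * (τ - 1))| ≤ 1 := by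
        rw [abs_div, abs_of_nonneg (Real.sqrt_nonneg _), div_le_one (Real.sqrt_pos.2 (disc_pos hτ x))]
        exact Real.abs_le_sqrt (by linarith [const_pos hτ])
      have := neg_abs_le (σ * (x / √(x ^ 2 + 4 * τ * (τ - 1))))
      rw [abs_mul, abs_of_mul_self_eq_one hσ, one_mul] at this
      linarith
    refine (measure_mono hsub).trans ((measure_union_le _ _).trans ?_)
    rw [hvol 1 (by norm_num), hvol (-1) (by norm_num), ← lintegral_add_left]
    · rw [← setLIntegral_const]
      refine lintegral_mono fun x => ?_
      have h3 : |x / √(x ^ 2 + 4 * τ * (τ - 1))| ≤ 1 := by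
        rw [abs_div, abs_of_nonneg (Real.sqrt_nonneg _), div_le_one (Real.sqrt_pos.2 (disc_pos hτ x))]
        exact Real.abs_le_sqrt (by linarith [const_pos hτ])
      have h4 := abs_le.1 h3
      dsimp only
      rw [← ENNReal.ofReal_add (div_nonneg (by linarith) (by linarith))
        (div_nonneg (by linarith) (by linarith))]
      refine ENNReal.ofReal_le_ofReal (le_of_eq ?_)
      have : τ ≠ 0 := by linarith
      field_simp
      ring
    · fun_prop
  have hfin : volume K ≠ ⊤ := by
    refine ((measure_mono (t := Icc (-1) 1) ?_).trans_lt ?_).ne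
    · rintro _ ⟨x, _, rfl⟩; exact x.2
    · simp
  by_contra hne
  have hr : 0 < (volume K).toReal := ENNReal.toReal_pos hne hfin
  have h1 := ENNReal.toReal_mono (ENNReal.mul_ne_top ENNReal.ofReal_ne_top hfin) hle
  rw [ENNReal.toReal_mul, ENNReal.toReal_ofReal (by positivity)] at h1
  have h2 : 1 / τ < 1 := by rw [div_lt_one (by linarith)]; exact hτ
  nlinarith

theorem mutuallySingular_volume (hτ : 1 < τ) {μ : Measure ℝ} (h : IsRuelleEigenMeasure τ μ) :
    μ ⟂ₘ volume := by
  have hKm : MeasurableSet (Subtype.val '' cantor hτ : Set ℝ) :=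
    ((isClosed_cantor hτ).isCompact.image continuous_subtype_val).isClosed.measurableSet
  refine ⟨(Subtype.val '' cantor hτ)ᶜ, hKm.compl, ae_cantor hτ h, ?_⟩
  rw [compl_compl]
  exact volume_cantor hτ

end Cantor

/-! ### Columns of the inverse Cholesky factor -/

/-- The leading `(k + 1) × (k + 1)` block of an infinite matrix. -/
def trunc (G : ℕ → ℕ → ℂ) (k : ℕ) : Matrix (Fin (k + 1)) (Fin (k + 1)) ℂ :=
  Matrix.of fun i j => G i j

/-- The entries of column `k` of the inverse of the upper triangular Cholesky factor of `G`. -/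
def cholCol (G : ℕ → ℕ → ℂ) (k j : ℕ) : ℂ :=
  if h : j < k + 1 then
    (trunc G k)⁻¹ ⟨j, h⟩ (Fin.last k) / (√((trunc G k)⁻¹ (Fin.last k) (Fin.last k)).re : ℝ)
  else 0

section Chol

variable {G : ℕ → ℕ → ℂ} {k : ℕ}

theorem cholCol_of_lt {j : ℕ} (h : k < j) : cholCol G k j = 0 := by
  rw [cholCol, dif_neg (by omega)]

theorem cholCol_congr {G' : ℕ → ℕ → ℂ} (h : ∀ i j, i ≤ k → j ≤ k → G i j = G' i j) (j : ℕ) :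
    cholCol G k j = cholCol G' k j := by
  have : trunc G k = trunc G' k := by
    ext i j
    exact h i j (Nat.lt_succ_iff.1 i.2) (Nat.lt_succ_iff.1 j.2)
  unfold cholCol
  rw [this]

theorem inv_trunc_last_pos (h : (trunc G k).PosDef) :
    0 < (trunc G k)⁻¹ (Fin.last k) (Fin.last k) := h.inv.diag_pos

theorem sqrt_inv_trunc_pos (h : (trunc G k).PosDef) :
    0 < √((trunc G k)⁻¹ (Fin.last k) (Fin.last k)).re :=
  Real.sqrt_pos.2 (Complex.pos_iff.1 (inv_trunc_last_pos h)).1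

theorem inv_trunc_last_eq (h : (trunc G k).PosDef) :
    (trunc G k)⁻¹ (Fin.last k) (Fin.last k) =
      ((√((trunc G k)⁻¹ (Fin.last k) (Fin.last k)).re : ℝ) : ℂ) ^ 2 := by
  have h1 := Complex.pos_iff.1 (inv_trunc_last_pos h)
  rw [← Complex.ofReal_pow, Real.sq_sqrt h1.1.le]
  exact Complex.ext rfl (by simpa using h1.2.symm)

theorem cholCol_self (h : (trunc G k).PosDef) :
    cholCol G k k = (√((trunc G k)⁻¹ (Fin.last k) (Fin.last k)).re : ℝ) := by
  have h0 : ((√((trunc G k)⁻¹ (Fin.last k) (Fin.last k)).re : ℝ) : ℂ) ≠ 0 :=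
    Complex.ofReal_ne_zero.2 (sqrt_inv_trunc_pos h).ne'
  rw [cholCol, dif_pos (Nat.lt_succ_self k), div_eq_iff h0, ← sq]
  exact inv_trunc_last_eq h

theorem cholCol_self_pos (h : (trunc G k).PosDef) : 0 < cholCol G k k := by
  rw [cholCol_self h]
  exact Complex.zero_lt_real.2 (sqrt_inv_trunc_pos h)

theorem conj_cholCol_self (h : (trunc G k).PosDef) : conj (cholCol G k k) = cholCol G k k := by
  rw [cholCol_self h, Complex.conj_ofReal]

/-- The column is a multiple of the last column of the inverse of the block, so the block maps it to
a multiple of the last unit vector. -/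
theorem sum_mul_cholCol (h : (trunc G k).PosDef) {i : ℕ} (hi : i ≤ k) :
    ∑ j ∈ Finset.range (k + 1), G i j * cholCol G k j =
      if i = k then (cholCol G k k)⁻¹ else 0 := by
  have hu : IsUnit (trunc G k).det := (Matrix.isUnit_iff_isUnit_det _).1 h.isUnit
  have h1 := congrFun (congrFun (Matrix.mul_nonsing_inv _ hu) ⟨i, Nat.lt_succ_of_le hi⟩)
    (Fin.last k)
  rw [Matrix.mul_apply] at h1
  rw [Finset.sum_range]
  have h2 : ∀ j : Fin (k + 1), G i j * cholCol G k j =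
      trunc G k ⟨i, Nat.lt_succ_of_le hi⟩ j * (trunc G k)⁻¹ j (Fin.last k) * (cholCol G k k)⁻¹ := by
    intro j
    rw [cholCol_self h, cholCol, dif_pos j.2, div_eq_mul_inv, ← mul_assoc]
    rfl
  rw [Finset.sum_congr rfl fun j _ => h2 j, ← Finset.sum_mul, h1, Matrix.one_apply]
  by_cases hik : i = k
  · rw [if_pos hik, if_pos (Fin.ext hik), one_mul]
  · rw [if_neg hik, if_neg (fun hh => hik (congrArg Fin.val hh)), zero_mul]

/-- Applying `G` to column `k` leaves only the coordinate `i = k`, which column `l` reaches only for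
`l = k`; positivity of the diagonal entry then gives the value `1`. -/
theorem cholCol_orthonormal (h : (trunc G k).PosDef) {l : ℕ} (hl : l ≤ k) :
    ∑ i ∈ Finset.range (l + 1), ∑ j ∈ Finset.range (k + 1),
      conj (cholCol G l i) * G i j * cholCol G k j = if l = k then 1 else 0 := by
  have h1 : ∀ i ∈ Finset.range (l + 1), ∑ j ∈ Finset.range (k + 1),
      conj (cholCol G l i) * G i j * cholCol G k j =
      if i = k then conj (cholCol G l i) * (cholCol G k k)⁻¹ else 0 := by
    intro i hi
    simp only [mul_assoc]
    rw [← Finset.mul_sum, sum_mul_cholCol h (by rw [Finset.mem_range] at hi; omega)]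
    split_ifs <;> simp
  rw [Finset.sum_congr rfl h1, Finset.sum_ite_eq']
  by_cases hlk : l = k
  · subst hlk
    rw [if_pos (by simp), if_pos rfl, conj_cholCol_self h,
      mul_inv_cancel₀ (cholCol_self_pos h).ne']
  · rw [if_neg hlk, if_neg]
    rw [Finset.mem_range]; omega

/-- The vanishing rows say that `Gx` is a multiple `λ` of the last unit vector, hence `x` is `λ`
times the last column of `G⁻¹`. Normalisation reads `λ x_k = 1`, so `x_k²` is the corner entry of
`G⁻¹`, and positivity selects the root. -/
theorem eq_cholCol (h : (trunc G k).PosDef) {x : ℕ → ℂ} (hx : 0 < x k)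
    (h0 : ∀ i < k, ∑ j ∈ Finset.range (k + 1), G i j * x j = 0)
    (h1 : ∑ i ∈ Finset.range (k + 1), ∑ j ∈ Finset.range (k + 1), conj (x i) * G i j * x j = 1)
    {j : ℕ} (hj : j ≤ k) : x j = cholCol G k j := by
  have hu : IsUnit (trunc G k).det := (Matrix.isUnit_iff_isUnit_det _).1 h.isUnit
  have hxr : conj (x k) = x k := Complex.conj_eq_iff_im.2
    (Complex.nonneg_iff.1 hx.le).2.symm
  set lam := ∑ j ∈ Finset.range (k + 1), G k j * x j with hlam
  have h2 : x k * lam = 1 := by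
    rw [← h1, Finset.sum_range_succ, Finset.sum_eq_zero, zero_add, hlam, Finset.mul_sum]
    · refine Finset.sum_congr rfl fun j _ => ?_
      rw [hxr, mul_assoc]
    · intro i hi
      simp only [mul_assoc]
      rw [← Finset.mul_sum, h0 i (Finset.mem_range.1 hi), mul_zero]
  let y : Fin (k + 1) → ℂ := fun i => x i
  have h3 : (trunc G k).mulVec y = fun i => if i = Fin.last k then lam else 0 := by
    ext i
    rw [Matrix.mulVec, dotProduct]
    have e : ∑ j : Fin (k + 1), trunc G k i j * y j =
        ∑ j ∈ Finset.range (k + 1), G i j * x j := by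
      rw [Finset.sum_range]; rfl
    rw [e]
    split_ifs with hi
    · rw [hi]; rfl
    · refine h0 i ?_
      have := i.2
      have : (i : ℕ) ≠ k := fun hh => hi (Fin.ext hh)
      omega
  have h4 : ∀ i, y i = (trunc G k)⁻¹ i (Fin.last k) * lam := by
    intro i
    have : y = (trunc G k)⁻¹.mulVec ((trunc G k).mulVec y) := by
      rw [Matrix.mulVec_mulVec, Matrix.nonsing_inv_mul _ hu, Matrix.one_mulVec]
    rw [this, h3, Matrix.mulVec, dotProduct]
    simp
  have h5 : x k = (trunc G k)⁻¹ (Fin.last k) (Fin.last k) * lam := h4 (Fin.last k)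
  have h6 : x k ^ 2 = cholCol G k k ^ 2 := by
    rw [cholCol_self h, ← inv_trunc_last_eq h, sq]
    nth_rw 1 [h5]
    rw [mul_assoc, mul_comm lam, h2, mul_one]
  have h7 : x k = cholCol G k k := by
    rcases sq_eq_sq_iff_eq_or_eq_neg.1 h6 with h' | h'
    · exact h'
    · have := cholCol_self_pos h
      rw [h'] at hx
      exact absurd (add_pos hx this) (by simp)
  have hlam2 : lam = (cholCol G k k)⁻¹ := by
    rw [← h7]; exact eq_inv_of_mul_eq_one_right h2
  have h8 := h4 ⟨j, Nat.lt_succ_of_le hj⟩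
  rw [cholCol, dif_pos (Nat.lt_succ_of_le hj), div_eq_mul_inv, ← cholCol_self h, ← hlam2]
  exact h8

/-- Only the limit has to be positive definite: this makes its determinant and the square root in
the denominator non-zero, and the rest is continuity. -/
theorem tendsto_cholCol {H : ℕ → ℕ → ℕ → ℂ} (h : (trunc G k).PosDef)
    (hH : ∀ i j, i ≤ k → j ≤ k → Tendsto (fun n => H n i j) atTop (𝓝 (G i j))) (j : ℕ) :
    Tendsto (fun n => cholCol (H n) k j) atTop (𝓝 (cholCol G k j)) := by
  by_cases hj : j < k + 1
  · have h1 : Tendsto (fun n => trunc (H n) k) atTop (𝓝 (trunc G k)) := by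
      refine tendsto_pi_nhds.2 fun i => tendsto_pi_nhds.2 fun j => ?_
      exact hH i j (Nat.lt_succ_iff.1 i.2) (Nat.lt_succ_iff.1 j.2)
    have hdet : (trunc G k).det ≠ 0 := ((Matrix.isUnit_iff_isUnit_det _).1 h.isUnit).ne_zero
    have h2 : Tendsto (fun n => (trunc (H n) k)⁻¹) atTop (𝓝 (trunc G k)⁻¹) := by
      simp only [Matrix.inv_def, Ring.inverse_eq_inv']
      refine Tendsto.smul ?_ ?_
      · exact ((continuous_id.matrix_det.tendsto _).comp h1).inv₀ hdet
      · exact (continuous_id.matrix_adjugate.tendsto _).comp h1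
    have h3 : ∀ i j, Tendsto (fun n => (trunc (H n) k)⁻¹ i j) atTop (𝓝 ((trunc G k)⁻¹ i j)) :=
      fun i j => tendsto_pi_nhds.1 (tendsto_pi_nhds.1 h2 i) j
    simp only [cholCol, dif_pos hj]
    refine (h3 _ _).div ?_ (Complex.ofReal_ne_zero.2 (sqrt_inv_trunc_pos h).ne')
    refine (Complex.continuous_ofReal.tendsto _).comp ?_
    refine (Real.continuous_sqrt.tendsto _).comp ?_
    exact (Complex.continuous_re.tendsto _).comp (h3 _ _)
  · simp only [cholCol, dif_neg hj]
    exact tendsto_const_nhds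

theorem posDef_trunc {E : Type*} [NormedAddCommGroup E] [InnerProductSpace ℂ E] {c : ℝ}
    (hc : 0 < c) (w : ℕ → E)
    (h : ∀ i j, i ≤ k → j ≤ k → G i j = ⟪w i, w j⟫_ℂ + if i = j then (c : ℂ) else 0) :
    (trunc G k).PosDef := by
  have e : trunc G k = (c : ℂ) • (1 : Matrix (Fin (k + 1)) (Fin (k + 1)) ℂ) +
      Matrix.gram ℂ fun i : Fin (k + 1) => w i := by
    ext i j
    rw [Matrix.add_apply, Matrix.gram_apply, Matrix.smul_apply, Matrix.one_apply]
    refine (h i j (Nat.lt_succ_iff.1 i.2) (Nat.lt_succ_iff.1 j.2)).trans ?_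
    rw [add_comm]
    simp [Fin.ext_iff]
  rw [e]
  exact (Matrix.PosDef.one.smul (Complex.zero_lt_real.2 hc)).add_posSemidef
    (Matrix.posSemidef_gram ℂ _)

end Chol

/-! ### Operators and matrix entries -/

/-- The standard Hilbert basis of the half-axis space. -/
def ketBasis : HilbertBasis ℕ ℂ HalfAxis :=
  HilbertBasis.ofRepr (LinearIsometryEquiv.refl ℂ HalfAxis)

theorem ketBasis_apply (k : ℕ) : ketBasis k = ket k := by
  rw [← HilbertBasis.repr_symm_single]
  rfl

theorem inner_ket_ket (i j : ℕ) : ⟪ket i, ket j⟫_ℂ = if i = j then 1 else 0 :=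
  orthonormal_iff_ite.1 orthonormal_ket i j

theorem eq_of_inner_ket {x y : HalfAxis} (h : ∀ k, ⟪ket k, x⟫_ℂ = ⟪ket k, y⟫_ℂ) : x = y := by
  have := ketBasis.repr.injective (a₁ := x) (a₂ := y)
  refine this (lp.ext (funext fun k => ?_))
  rw [HilbertBasis.repr_apply_apply, HilbertBasis.repr_apply_apply, ketBasis_apply, h k]

theorem span_ket_closure : (Submodule.span ℂ (range ket)).topologicalClosure = ⊤ := by
  have := ketBasis.dense_span
  rwa [show (ketBasis : ℕ → HalfAxis) = ket from funext ketBasis_apply] at this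

theorem op_ext {S T : Op} (h : ∀ k, S (ket k) = T (ket k)) : S = T := by
  refine ContinuousLinearMap.ext_on
    (Submodule.dense_iff_topologicalClosure_eq_top.2 span_ket_closure) ?_
  rintro _ ⟨k, rfl⟩
  exact h k

theorem op_eq_of_entry {S T : Op} (h : ∀ i j, entry S i j = entry T i j) : S = T :=
  op_ext fun j => eq_of_inner_ket fun i => h i j

theorem star_op (T : Op) : star T = T.adjoint := ContinuousLinearMap.star_eq_adjoint T

theorem inner_star_left (T : Op) (x y : HalfAxis) : ⟪star T x, y⟫_ℂ = ⟪x, T y⟫_ℂ := by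
  rw [star_op, ContinuousLinearMap.adjoint_inner_left]

theorem inner_star_right (T : Op) (x y : HalfAxis) : ⟪x, star T y⟫_ℂ = ⟪T x, y⟫_ℂ := by
  rw [star_op, ContinuousLinearMap.adjoint_inner_right]

theorem isUnit_sub_of_im_ne_zero {A : Op} (hA : IsSelfAdjoint A) {z : ℂ} (hz : z.im ≠ 0) :
    IsUnit (A - algebraMap ℂ Op z) := by
  have h : z ∉ spectrum ℂ A := fun h => hz (hA.im_eq_zero_of_mem_spectrum h)
  have := (spectrum.notMem_iff.1 h).neg
  rwa [neg_sub] at this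

theorem inverse_apply_of_apply_eq {T : Op} (hT : IsUnit T) {x y : HalfAxis} (h : T x = y) :
    Ring.inverse T y = x := by
  rw [← h]
  change (Ring.inverse T * T) x = x
  rw [Ring.inverse_mul_cancel _ hT]
  rfl

/-! ### The triangular factor -/

/-- An upper triangular operator maps `|j⟩` into the span of `|0⟩, …, |j⟩`. -/
theorem upper_apply_ket {T : Op} (h : ∀ i j, j < i → entry T i j = 0) (j : ℕ) :
    T (ket j) = ∑ i ∈ Finset.range (j + 1), entry T i j • ket i := by
  refine eq_of_inner_ket fun k => ?_
  rw [inner_sum]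
  simp only [inner_smul_right, inner_ket_ket, mul_ite, mul_one, mul_zero, Finset.sum_ite_eq,
    Finset.mem_range]
  split_ifs with hk
  · rfl
  · exact h k j (by omega)

/-- By induction the earlier basis vectors are fixed, so isometry makes `V|j⟩` orthogonal to them;
triangularity removes the later coordinates. A positive multiple of `|j⟩` of norm `1` remains. -/
theorem upper_isometry_eq_one {V : Op} (hu : ∀ i j, j < i → entry V i j = 0)
    (hd : ∀ i, 0 < entry V i i) (hV : star V * V = 1) : V = 1 := by
  refine op_ext fun j => ?_
  have hin : ∀ x y, ⟪V x, V y⟫_ℂ = ⟪x, y⟫_ℂ := fun x y => by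
    rw [← inner_star_right]
    change ⟪x, (star V * V) y⟫_ℂ = _
    rw [hV]; rfl
  induction j using Nat.strong_induction_on with
  | _ j ih =>
    have h1 : V (ket j) = entry V j j • ket j := by
      refine eq_of_inner_ket fun i => ?_
      rw [inner_smul_right, inner_ket_ket]
      rcases lt_trichotomy i j with h | h | h
      · have h2 : V (ket i) = ket i := ih i h
        rw [if_neg h.ne, mul_zero, ← h2, hin, inner_ket_ket, if_neg h.ne]
      · subst h; simp [entry]
      · rw [if_neg h.ne', mul_zero]; exact hu i j h
    have h2 := hin (ket j) (ket j)
    rw [h1, inner_smul_left, inner_smul_right, inner_ket_ket, if_pos rfl, mul_one] at h2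
    have h3 := Complex.pos_iff.1 (hd j)
    have h4 : entry V j j = ((entry V j j).re : ℂ) := Complex.ext rfl (by simpa using h3.2.symm)
    rw [h4, Complex.conj_ofReal, ← Complex.ofReal_mul, Complex.ofReal_eq_one] at h2
    have h5 : (entry V j j).re = 1 := by nlinarith
    rw [h1, h4, h5]
    simp

section Factor

variable {τ : ℝ} {A : Op}

/-- The operator `A² + 4τ(τ-1)`. -/
def shiftSq (τ : ℝ) (A : Op) : Op := A ^ 2 + ((4 * τ * (τ - 1) : ℝ) : ℂ) • (1 : Op)

theorem entry_shiftSq (hA : IsSelfAdjoint A) (i j : ℕ) :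
    entry (shiftSq τ A) i j =
      ⟪A (ket i), A (ket j)⟫_ℂ + if i = j then ((4 * τ * (τ - 1) : ℝ) : ℂ) else 0 := by
  have h : shiftSq τ A (ket j) = A (A (ket j)) + ((4 * τ * (τ - 1) : ℝ) : ℂ) • ket j := by
    rw [shiftSq, sq]; rfl
  rw [entry, h, inner_add_right, inner_smul_right, inner_ket_ket]
  congr 1
  · conv_rhs => rw [← inner_star_right, hA.star_eq]
  · simp

theorem posDef_shiftSq (hτ : 1 < τ) (hA : IsSelfAdjoint A) (k : ℕ) :
    (trunc (entry (shiftSq τ A)) k).PosDef :=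
  posDef_trunc (const_pos hτ) (fun i => A (ket i)) fun i j _ _ => entry_shiftSq hA i j

/-- Back substitution. -/
theorem mem_span_of_triangular {E : Type*} [AddCommGroup E] [Module ℂ E] {S : Submodule ℂ E}
    {c : ℕ → ℕ → ℂ} (hc : ∀ k, c k k ≠ 0) (w : ℕ → E)
    (h : ∀ k, ∑ j ∈ Finset.range (k + 1), c k j • w j ∈ S) (k : ℕ) : w k ∈ S := by
  induction k using Nat.strong_induction_on with
  | _ k ih =>
    have h1 := h k
    rw [Finset.sum_range_succ] at h1
    have h2 : ∑ j ∈ Finset.range k, c k j • w j ∈ S :=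
      Submodule.sum_mem _ fun j hj => S.smul_mem _ (ih j (Finset.mem_range.1 hj))
    have h3 := (Submodule.add_mem_iff_right _ h2).1 h1
    have := S.smul_mem (c k k)⁻¹ h3
    rwa [smul_smul, inv_mul_cancel₀ (hc k), one_smul] at this

/-- The positive operator factors as `N*N` with `N` invertible. If `u_k` is the vector given by the
`k`-th Cholesky column, then `N u_k` is an orthonormal basis; the unitary `W` that sends it to the
standard basis makes `WN` triangular. Boundedness and invertibility come for free, with no limit of
finite factorisations. -/
theorem exists_triangularFactor (hτ : 1 < τ) (hA : IsSelfAdjoint A) :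
    ∃ Φ : Op, IsTriangularFactor τ A Φ ∧ IsUnit Φ ∧
      ∀ k, Φ (∑ j ∈ Finset.range (k + 1), cholCol (entry (shiftSq τ A)) k j • ket j) = ket k := by
  set G := entry (shiftSq τ A) with hG
  set s : ℝ := √(4 * τ * (τ - 1)) with hs
  have hs0 : 0 < s := Real.sqrt_pos.2 (const_pos hτ)
  -- `N = A + is` with `s² = 4τ(τ-1)`: since `A` is self-adjoint, `N*N = A² + s²` and the non-real
  -- shift is invertible.
  set z : ℂ := -(s * Complex.I) with hz
  have hz2 : star z * z = ((4 * τ * (τ - 1) : ℝ) : ℂ) := by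
    rw [← Real.sq_sqrt (const_pos hτ).le, ← hs, hz]
    simp only [star_neg, star_mul', Complex.star_def, Complex.conj_ofReal, Complex.conj_I]
    push_cast
    linear_combination -(s : ℂ) ^ 2 * Complex.I_sq
  have hz3 : star z + z = 0 := by
    rw [hz]
    simp only [star_neg, star_mul', Complex.star_def, Complex.conj_ofReal, Complex.conj_I]
    ring
  set N : Op := A - algebraMap ℂ Op z with hN
  have hNu : IsUnit N := isUnit_sub_of_im_ne_zero hA (by simp [hz, hs0.ne'])
  have hNN : star N * N = shiftSq τ A := by
    rw [hN, star_sub, hA.star_eq, ← algebraMap_star_comm, sub_mul, mul_sub, mul_sub,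
      ← Algebra.commutes z A, ← map_mul, hz2, shiftSq, ← Algebra.algebraMap_eq_smul_one]
    have : algebraMap ℂ Op (star z) * A + algebraMap ℂ Op z * A = 0 := by
      rw [← add_mul, ← map_add, hz3, map_zero, zero_mul]
    rw [sq, eq_neg_of_add_eq_zero_left this]
    abel
  set u : ℕ → HalfAxis := fun k => ∑ j ∈ Finset.range (k + 1), cholCol G k j • ket j with hu
  have hGu : ∀ k i, i ≤ k → ⟪ket i, shiftSq τ A (u k)⟫_ℂ =
      if i = k then (cholCol G k k)⁻¹ else 0 := by
    intro k i hi
    rw [← sum_mul_cholCol (posDef_shiftSq hτ hA k) hi]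
    simp only [hu, map_sum, map_smul, inner_sum, inner_smul_right]
    refine Finset.sum_congr rfl fun j _ => ?_
    rw [mul_comm]; rfl
  have hort : ∀ l k, l ≤ k → ⟪N (u l), N (u k)⟫_ℂ = if l = k then 1 else 0 := by
    intro l k hl
    rw [← inner_star_right]
    change ⟪u l, (star N * N) (u k)⟫_ℂ = _
    rw [hNN, ← cholCol_orthonormal (posDef_shiftSq hτ hA k) hl]
    simp only [hu, map_sum, map_smul, inner_sum, sum_inner, inner_smul_right, inner_smul_left]
    rw [Finset.sum_comm]
    simp only [Finset.mul_sum]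
    refine Finset.sum_congr rfl fun i _ => Finset.sum_congr rfl fun j _ => ?_
    rw [mul_comm]; rfl
  have how : Orthonormal ℂ fun k => N (u k) := by
    refine orthonormal_iff_ite.2 fun l k => ?_
    rcases le_total l k with h | h
    · exact hort l k h
    · rw [← inner_conj_symm, hort k l h]
      by_cases hlk : l = k
      · simp [hlk]
      · rw [if_neg hlk, if_neg (Ne.symm hlk), map_zero]
  -- For `x` orthogonal to all `N u_k`, the vector `N*x` is orthogonal to all `u_k`, hence by back
  -- substitution to all basis vectors; and `N*` is injective.
  have hbot : (Submodule.span ℂ (range fun k => N (u k)))ᗮ = ⊥ := by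
    refine (Submodule.eq_bot_iff _).2 fun x hx => ?_
    have h1 : ∀ k, ket k ∈ (ℂ ∙ (star N x))ᗮ := by
      refine mem_span_of_triangular (c := cholCol G)
        (fun k => (cholCol_self_pos (posDef_shiftSq hτ hA k)).ne') ket fun k => ?_
      rw [Submodule.mem_orthogonal_singleton_iff_inner_right, inner_star_left]
      rw [← inner_conj_symm, (Submodule.mem_orthogonal _ _).1 hx _
        (Submodule.subset_span ⟨k, rfl⟩), map_zero]
    have h2 : star N x = 0 := by
      refine eq_of_inner_ket fun k => ?_
      rw [inner_zero_right]
      exact Submodule.mem_orthogonal_singleton_iff_inner_left.1 (h1 k)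
    have h3 := inverse_apply_of_apply_eq hNu.star h2
    rw [← h3, map_zero]
  let b : HilbertBasis ℕ ℂ HalfAxis := HilbertBasis.mkOfOrthogonalEqBot how hbot
  have hb : ∀ k, b.repr (N (u k)) = ket k := by
    intro k
    have : b k = N (u k) := congrFun (HilbertBasis.coe_mkOfOrthogonalEqBot how hbot) k
    rw [← this, HilbertBasis.repr_self]
    rfl
  let W : Op := b.repr.toContinuousLinearEquiv.toContinuousLinearMap
  let W' : Op := b.repr.symm.toContinuousLinearEquiv.toContinuousLinearMap
  have hWu : IsUnit W := by
    refine ⟨⟨W, W', ?_, ?_⟩, rfl⟩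
    · ext1 x; exact b.repr.apply_symm_apply x
    · ext1 x; exact b.repr.symm_apply_apply x
  have hΦu : ∀ k, (W * N) (u k) = ket k := hb
  have hfac : star (W * N) * (W * N) = shiftSq τ A := by
    rw [← hNN]
    refine op_eq_of_entry fun i j => ?_
    rw [entry, entry]
    change ⟪ket i, star (W * N) ((W * N) (ket j))⟫_ℂ = ⟪ket i, star N (N (ket j))⟫_ℂ
    rw [inner_star_right, inner_star_right]
    exact b.repr.inner_map_map _ _
  -- Row `i` is read off from `Φ*|i⟩ = Φ*Φ u_i`, whose coordinates before the `i`-th vanish by the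
  -- choice of the column.
  have hent : ∀ i j, j ≤ i → entry (W * N) i j = if j = i then (cholCol G i i)⁻¹ else 0 := by
    intro i j hij
    have h1 : star (W * N) (ket i) = shiftSq τ A (u i) := by
      rw [← hfac, ← hΦu i]; rfl
    rw [entry, ← inner_star_left, h1, ← inner_conj_symm, hGu i j hij]
    split_ifs
    · rw [map_inv₀, conj_cholCol_self (posDef_shiftSq hτ hA i)]
    · exact map_zero _
  refine ⟨W * N, ⟨fun i j h => ?_, fun i => ?_, ?_⟩, hWu.mul hNu, hΦu⟩
  · rw [hent i j h.le, if_neg h.ne]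
  · rw [hent i i le_rfl, if_pos rfl]
    exact inv_pos.2 (cholCol_self_pos (posDef_shiftSq hτ hA i))
  · rw [← star_op]; exact hfac.symm

theorem entry_upper_mul {S T : Op} (hS : ∀ i j, j < i → entry S i j = 0)
    (hT : ∀ i j, j < i → entry T i j = 0) :
    (∀ i j, j < i → entry (S * T) i j = 0) ∧ ∀ i, entry (S * T) i i = entry S i i * entry T i i := by
  have h : ∀ i j, j ≤ i → entry (S * T) i j = if j = i then entry S i i * entry T i i else 0 := by
    intro i j hij
    have : (S * T) (ket j) = ∑ l ∈ Finset.range (j + 1), entry T l j • S (ket l) := by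
      change S (T (ket j)) = _
      rw [upper_apply_ket hT j]
      simp
    rw [entry, this, inner_sum]
    simp only [inner_smul_right]
    have h1 : ∀ l ∈ Finset.range (j + 1), entry T l j * ⟪ket i, S (ket l)⟫_ℂ =
        if l = i then entry S i i * entry T i j else 0 := by
      intro l hl
      rw [Finset.mem_range] at hl
      split_ifs with hli
      · rw [hli, mul_comm]; rfl
      · have := hS i l (by omega)
        rw [entry] at this
        rw [this, mul_zero]
    rw [Finset.sum_congr rfl h1, Finset.sum_ite_eq']
    by_cases hji : j = i
    · subst hji; simp
    · rw [if_neg hji, if_neg]; rw [Finset.mem_range]; omega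
  exact ⟨fun i j hij => by rw [h i j hij.le, if_neg hij.ne], fun i => by
    rw [h i i le_rfl, if_pos rfl]⟩

/-- For two factors, `ΨΦ⁻¹` is an isometry that is upper triangular with positive diagonal, hence
the identity. -/
theorem existsUnique_triangularFactor (hτ : 1 < τ) (hA : IsSelfAdjoint A) :
    ∃! Φ : Op, IsTriangularFactor τ A Φ := by
  obtain ⟨Φ, hΦ, hu, hc⟩ := exists_triangularFactor hτ hA
  set G := entry (shiftSq τ A)
  refine ⟨Φ, hΦ, fun Ψ hΨ => ?_⟩
  have hinv : ∀ k, Ring.inverse Φ (ket k) = ∑ j ∈ Finset.range (k + 1), cholCol G k j • ket j :=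
    fun k => inverse_apply_of_apply_eq hu (hc k)
  have hie : ∀ i j, entry (Ring.inverse Φ) i j = if i ≤ j then cholCol G j i else 0 := by
    intro i j
    rw [entry, hinv, inner_sum]
    simp only [inner_smul_right, inner_ket_ket, mul_ite, mul_one, mul_zero, Finset.sum_ite_eq,
      Finset.mem_range, Nat.lt_succ_iff]
  have hup : ∀ i j, j < i → entry (Ring.inverse Φ) i j = 0 := fun i j h => by
    rw [hie, if_neg (by omega)]
  have hm := entry_upper_mul hΨ.upper hup
  have hV : Ψ * Ring.inverse Φ = 1 := by
    refine upper_isometry_eq_one hm.1 (fun i => ?_) ?_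
    · rw [hm.2, hie, if_pos le_rfl]
      exact mul_pos (hΨ.diag_pos i) (cholCol_self_pos (posDef_shiftSq hτ hA i))
    · have e1 : star Ψ * Ψ = star Φ * Φ := by
        rw [star_op, star_op, ← hΨ.factor, ← hΦ.factor]
      have e2 : star (Ring.inverse Φ) * star Φ = 1 := by
        rw [← star_mul, Ring.mul_inverse_cancel _ hu, star_one]
      rw [star_mul, mul_assoc, ← mul_assoc (star Ψ), e1, mul_assoc, Ring.mul_inverse_cancel _ hu,
        mul_one, e2]
  calc Ψ = Ψ * (Ring.inverse Φ * Φ) := by rw [Ring.inverse_mul_cancel _ hu, mul_one]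
    _ = Φ := by rw [← mul_assoc, hV, one_mul]

theorem triangularFactor_spec (hτ : 1 < τ) (hA : IsSelfAdjoint A) :
    IsTriangularFactor τ A (triangularFactor τ A) :=
  Classical.epsilon_spec (existsUnique_triangularFactor hτ hA).exists

theorem triangularFactor_eq (hτ : 1 < τ) (hA : IsSelfAdjoint A) {Φ : Op}
    (hΦ : IsTriangularFactor τ A Φ) : triangularFactor τ A = Φ :=
  (existsUnique_triangularFactor hτ hA).unique (triangularFactor_spec hτ hA) hΦ

theorem isUnit_triangularFactor (hτ : 1 < τ) (hA : IsSelfAdjoint A) :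
    IsUnit (triangularFactor τ A) := by
  obtain ⟨Φ, hΦ, hu, -⟩ := exists_triangularFactor hτ hA
  rwa [triangularFactor_eq hτ hA hΦ]

theorem triangularFactor_apply_cholCol (hτ : 1 < τ) (hA : IsSelfAdjoint A) (k : ℕ) :
    triangularFactor τ A
      (∑ j ∈ Finset.range (k + 1), cholCol (entry (shiftSq τ A)) k j • ket j) = ket k := by
  obtain ⟨Φ, hΦ, -, hc⟩ := exists_triangularFactor hτ hA
  rw [triangularFactor_eq hτ hA hΦ, hc]

theorem entry_inverse_triangularFactor (hτ : 1 < τ) (hA : IsSelfAdjoint A) (j k : ℕ) :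
    entry (Ring.inverse (triangularFactor τ A)) j k = cholCol (entry (shiftSq τ A)) k j := by
  rw [entry, inverse_apply_of_apply_eq (isUnit_triangularFactor hτ hA)
    (triangularFactor_apply_cholCol hτ hA k), inner_sum]
  simp only [inner_smul_right, inner_ket_ket, mul_ite, mul_one, mul_zero, Finset.sum_ite_eq,
    Finset.mem_range, Nat.lt_succ_iff]
  split_ifs with h
  · rfl
  · exact (cholCol_of_lt (by omega)).symm

end Factor

/-! ### Block operators -/

/-- The even embedding as a bounded operator. -/
def evenOp : Op := evenEmb.toContinuousLinearMap

/-- The odd embedding as a bounded operator. -/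
def oddOp : Op := oddEmb.toContinuousLinearMap

theorem evenOp_ket (k : ℕ) : evenOp (ket k) = ket (2 * k) := evenEmb_ket k

theorem oddOp_ket (k : ℕ) : oddOp (ket k) = ket (2 * k + 1) := oddEmb_ket k

theorem star_even_mul_even : star evenOp * evenOp = 1 :=
  (ContinuousLinearMap.norm_map_iff_adjoint_comp_self _).1 evenEmb.norm_map

theorem star_odd_mul_odd : star oddOp * oddOp = 1 :=
  (ContinuousLinearMap.norm_map_iff_adjoint_comp_self _).1 oddEmb.norm_map

theorem star_even_mul_odd : star evenOp * oddOp = 0 := by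
  refine op_eq_of_entry fun i j => ?_
  rw [entry, entry]
  change ⟪ket i, star evenOp (oddOp (ket j))⟫_ℂ = ⟪ket i, 0⟫_ℂ
  rw [inner_star_right, evenOp_ket, oddOp_ket, inner_ket_ket, if_neg (by omega), inner_zero_right]

theorem star_odd_mul_even : star oddOp * evenOp = 0 := by
  have := congrArg star star_even_mul_odd
  rwa [star_mul, star_star, star_zero] at this

theorem even_add_odd : evenOp * star evenOp + oddOp * star oddOp = 1 := by
  have h : ∀ S T : Op, ∀ x, (S * T) x = S (T x) := fun _ _ _ => rfl
  refine op_ext fun k => ?_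
  rcases Nat.even_or_odd' k with ⟨m, rfl | rfl⟩
  · rw [← evenOp_ket, ← h, add_mul, mul_assoc, mul_assoc, star_even_mul_even, star_odd_mul_even]
    simp
  · rw [← oddOp_ket, ← h, add_mul, mul_assoc, mul_assoc, star_odd_mul_odd, star_even_mul_odd]
    simp

theorem interlace_eq (P Q R S : Op) :
    interlace P Q R S = evenOp * P * star evenOp + evenOp * Q * star oddOp +
      oddOp * R * star evenOp + oddOp * S * star oddOp := rfl

theorem star_even_mul_even_mul (X : Op) : star evenOp * (evenOp * X) = X := by
  rw [← mul_assoc, star_even_mul_even, one_mul]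

theorem star_odd_mul_odd_mul (X : Op) : star oddOp * (oddOp * X) = X := by
  rw [← mul_assoc, star_odd_mul_odd, one_mul]

theorem star_even_mul_odd_mul (X : Op) : star evenOp * (oddOp * X) = 0 := by
  rw [← mul_assoc, star_even_mul_odd, zero_mul]

theorem star_odd_mul_even_mul (X : Op) : star oddOp * (evenOp * X) = 0 := by
  rw [← mul_assoc, star_odd_mul_even, zero_mul]

theorem interlace_mul (P Q R S P' Q' R' S' : Op) :
    interlace P Q R S * interlace P' Q' R' S' =
      interlace (P * P' + Q * R') (P * Q' + Q * S') (R * P' + S * R') (R * Q' + S * S') := by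
  simp only [interlace_eq, mul_add, add_mul, mul_assoc, star_even_mul_even_mul,
    star_odd_mul_odd_mul, star_even_mul_odd_mul, star_odd_mul_even_mul, mul_zero, add_zero,
    zero_add]
  abel

theorem interlace_add (P Q R S P' Q' R' S' : Op) :
    interlace P Q R S + interlace P' Q' R' S' = interlace (P + P') (Q + Q') (R + R') (S + S') := by
  simp only [interlace_eq, mul_add, add_mul]
  abel

theorem smul_interlace (c : ℂ) (P Q R S : Op) :
    c • interlace P Q R S = interlace (c • P) (c • Q) (c • R) (c • S) := by
  simp only [interlace_eq, smul_add, mul_smul_comm, smul_mul_assoc]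

theorem star_interlace (P Q R S : Op) :
    star (interlace P Q R S) = interlace (star P) (star R) (star Q) (star S) := by
  simp only [interlace_eq, star_add, star_mul, star_star, mul_assoc]
  abel

theorem interlace_one : interlace 1 0 0 1 = 1 := by
  simp only [interlace_eq, mul_one, mul_zero, zero_mul, add_zero]
  exact even_add_odd

theorem interlace_mul_even (P Q R S : Op) :
    interlace P Q R S * evenOp = evenOp * P + oddOp * R := by
  simp only [interlace_eq, add_mul, mul_assoc, star_even_mul_even, star_odd_mul_even, mul_zero,
    mul_one, add_zero]

theorem isUnit_interlace_diag {P Q : Op} (hP : IsUnit P) (hQ : IsUnit Q) :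
    IsUnit (interlace P 0 0 Q) := by
  refine ⟨⟨interlace P 0 0 Q, interlace (Ring.inverse P) 0 0 (Ring.inverse Q), ?_, ?_⟩, rfl⟩
  · simp only [interlace_mul, Ring.mul_inverse_cancel _ hP, Ring.mul_inverse_cancel _ hQ, mul_zero,
      zero_mul, add_zero, zero_add, interlace_one]
  · simp only [interlace_mul, Ring.inverse_mul_cancel _ hP, Ring.inverse_mul_cancel _ hQ, mul_zero,
      zero_mul, add_zero, zero_add, interlace_one]

/-! ### The transform -/

section Transform

variable {τ : ℝ} {A : Op}

/-- The operator `A_* = Φ A Φ⁻¹`. -/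
def conjOp (τ : ℝ) (A : Op) : Op :=
  triangularFactor τ A * A * Ring.inverse (triangularFactor τ A)

/-- The operator `π(π*(A)) = A ⊕ A_*`. -/
def diagOp (τ : ℝ) (A : Op) : Op := interlace A 0 0 (conjOp τ A)

theorem renorm_eq : renorm τ A = ((1 / (2 * τ) : ℝ) : ℂ) •
    interlace A (star (triangularFactor τ A)) (triangularFactor τ A) (conjOp τ A) := rfl

theorem conjOp_mul (hτ : 1 < τ) (hA : IsSelfAdjoint A) :
    conjOp τ A * triangularFactor τ A = triangularFactor τ A * A := by
  rw [conjOp, mul_assoc, Ring.inverse_mul_cancel _ (isUnit_triangularFactor hτ hA), mul_one]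

theorem star_mul_triangularFactor (hτ : 1 < τ) (hA : IsSelfAdjoint A) :
    star (triangularFactor τ A) * triangularFactor τ A = shiftSq τ A := by
  rw [star_op]
  exact (triangularFactor_spec hτ hA).factor.symm

/-- `Φ*Φ` is a polynomial in `A` and commutes with it. Taking adjoints, this intertwining relation
makes `A_*` self-adjoint. -/
theorem star_mul_conjOp (hτ : 1 < τ) (hA : IsSelfAdjoint A) :
    star (triangularFactor τ A) * conjOp τ A = A * star (triangularFactor τ A) := by
  have hu := isUnit_triangularFactor hτ hA
  have hc : shiftSq τ A * A = A * shiftSq τ A := by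
    simp only [shiftSq, add_mul, mul_add, smul_mul_assoc, mul_smul_comm, one_mul, mul_one, sq,
      mul_assoc]
  rw [conjOp, ← mul_assoc, ← mul_assoc, star_mul_triangularFactor hτ hA, hc,
    ← star_mul_triangularFactor hτ hA, mul_assoc, mul_assoc, Ring.mul_inverse_cancel _ hu, mul_one]

theorem isSelfAdjoint_conjOp (hτ : 1 < τ) (hA : IsSelfAdjoint A) : IsSelfAdjoint (conjOp τ A) := by
  have hu := isUnit_triangularFactor hτ hA
  have h := congrArg star (star_mul_conjOp hτ hA)
  rw [star_mul, star_mul, star_star, hA.star_eq] at h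
  calc star (conjOp τ A) = star (conjOp τ A) * (triangularFactor τ A *
        Ring.inverse (triangularFactor τ A)) := by rw [Ring.mul_inverse_cancel _ hu, mul_one]
    _ = conjOp τ A := by rw [← mul_assoc, h, conjOp]

theorem conjOp_sq (hτ : 1 < τ) (hA : IsSelfAdjoint A) :
    conjOp τ A * conjOp τ A + ((4 * τ * (τ - 1) : ℝ) : ℂ) • (1 : Op) =
      triangularFactor τ A * star (triangularFactor τ A) := by
  have hu := isUnit_triangularFactor hτ hA
  set Φ := triangularFactor τ A with hΦ
  have h1 : conjOp τ A * conjOp τ A = Φ * (A * A) * Ring.inverse Φ := by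
    nth_rw 2 [conjOp]
    rw [← mul_assoc, ← mul_assoc, conjOp_mul hτ hA, mul_assoc Φ A A]
  have h2 : A * A + ((4 * τ * (τ - 1) : ℝ) : ℂ) • (1 : Op) = star Φ * Φ := by
    rw [star_mul_triangularFactor hτ hA, shiftSq, sq]
  calc _ = Φ * (A * A + ((4 * τ * (τ - 1) : ℝ) : ℂ) • (1 : Op)) * Ring.inverse Φ := by
        rw [h1, mul_add, add_mul, mul_smul_comm, smul_mul_assoc, mul_one,
          Ring.mul_inverse_cancel _ hu]
    _ = _ := by rw [h2, mul_assoc, mul_assoc, Ring.mul_inverse_cancel _ hu, mul_one]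

theorem isSelfAdjoint_renorm (hτ : 1 < τ) (hA : IsSelfAdjoint A) :
    IsSelfAdjoint (renorm τ A) := by
  rw [IsSelfAdjoint, renorm_eq, star_smul, star_interlace, star_star, hA.star_eq,
    (isSelfAdjoint_conjOp hτ hA).star_eq, Complex.star_def, Complex.conj_ofReal]

theorem diagOp_mul_renorm (hτ : 1 < τ) (hA : IsSelfAdjoint A) :
    diagOp τ A * renorm τ A = renorm τ A * diagOp τ A := by
  rw [renorm_eq, diagOp, mul_smul_comm, smul_mul_assoc, interlace_mul, interlace_mul]
  simp only [mul_zero, zero_mul, add_zero, zero_add, conjOp_mul hτ hA, star_mul_conjOp hτ hA]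

/-- This is `π(M) = A ⊕ A_*` cleared of the inverse. The diagonal blocks use `A² + 4τ(τ-1) = Φ*Φ`
and `A_*² + 4τ(τ-1) = ΦΦ*`, the off-diagonal ones the two intertwining relations. -/
theorem renorm_quadratic (hτ : 1 < τ) (hA : IsSelfAdjoint A) :
    (τ : ℂ) • (renorm τ A * renorm τ A) =
      diagOp τ A * renorm τ A + ((τ - 1 : ℝ) : ℂ) • (1 : Op) := by
  have h0 : (τ : ℂ) ≠ 0 := Complex.ofReal_ne_zero.2 (by linarith)
  set c : ℂ := ((4 * τ * (τ - 1) : ℝ) : ℂ) with hc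
  have h2 : star (triangularFactor τ A) * triangularFactor τ A = A * A + c • (1 : Op) := by
    rw [star_mul_triangularFactor hτ hA, shiftSq, sq]
  have h3 := conjOp_sq hτ hA
  rw [← interlace_one, renorm_eq, diagOp, mul_smul_comm, mul_smul_comm, smul_mul_assoc,
    interlace_mul, interlace_mul]
  simp only [zero_mul, add_zero, zero_add, conjOp_mul hτ hA, star_mul_conjOp hτ hA]
  rw [h2, ← h3]
  simp only [smul_interlace, interlace_add, smul_zero, add_zero, smul_smul, smul_add]
  have e1 : (τ : ℂ) * (((1 / (2 * τ) : ℝ) : ℂ) * ((1 / (2 * τ) : ℝ) : ℂ)) = 1 / (4 * τ) := by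
    push_cast; field_simp; norm_num
  -- Written in multiples of `1/(4τ)`, both sides agree term by term in each block.
  have e2 : ((1 / (2 * τ) : ℝ) : ℂ) = 1 / (4 * τ) + 1 / (4 * τ) := by
    push_cast; field_simp; norm_num
  have e3 : (τ : ℂ) * ((1 / (4 * τ) + 1 / (4 * τ)) * ((1 / (4 * τ) + 1 / (4 * τ)) * c)) =
      ((τ - 1 : ℝ) : ℂ) := by
    rw [hc]; push_cast; field_simp; ring
  rw [← hc, e1, e2, e3]
  simp only [add_smul]
  congr 1 <;> abel

theorem isUnit_renorm (hτ : 1 < τ) (hA : IsSelfAdjoint A) : IsUnit (renorm τ A) := by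
  have h := renorm_quadratic hτ hA
  have hd := diagOp_mul_renorm hτ hA
  have h0 : ((τ - 1 : ℝ) : ℂ) ≠ 0 := Complex.ofReal_ne_zero.2 (by linarith)
  set M := renorm τ A
  set D := diagOp τ A
  refine ⟨⟨M, ((τ - 1 : ℝ) : ℂ)⁻¹ • ((τ : ℂ) • M - D), ?_, ?_⟩, rfl⟩
  · rw [mul_smul_comm, mul_sub, mul_smul_comm, h, ← hd, add_sub_cancel_left, smul_smul,
      inv_mul_cancel₀ h0, one_smul]
  · rw [smul_mul_assoc, sub_mul, smul_mul_assoc, h, add_sub_cancel_left, smul_smul,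
      inv_mul_cancel₀ h0, one_smul]

theorem diagOp_eq (hτ : 1 < τ) (hA : IsSelfAdjoint A) :
    diagOp τ A = (τ : ℂ) • renorm τ A - ((τ - 1 : ℝ) : ℂ) • Ring.inverse (renorm τ A) := by
  have h := renorm_quadratic hτ hA
  have hu := isUnit_renorm hτ hA
  have h1 := congrArg (· * Ring.inverse (renorm τ A)) h
  simp only [smul_mul_assoc, add_mul, mul_assoc, Ring.mul_inverse_cancel _ hu, mul_one,
    one_mul] at h1
  rw [h1, add_sub_cancel_right]

theorem diagOp_mul_even : diagOp τ A * evenOp = evenOp * A := by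
  rw [diagOp, interlace_mul_even, mul_zero, add_zero]

/-- Subtracting `A ⊕ A_*` removes the diagonal blocks of `2τM`. This is the operator form of `2τv -
π(v) = τv + (τ-1)/v` and the source of the odd basis vectors. -/
theorem two_mul_renorm_sub_mul_even (hτ : 1 < τ) :
    (((2 * τ : ℝ) : ℂ) • renorm τ A - diagOp τ A) * evenOp = oddOp * triangularFactor τ A := by
  have h0 : (τ : ℂ) ≠ 0 := Complex.ofReal_ne_zero.2 (by linarith)
  rw [sub_mul, diagOp_mul_even, renorm_eq, smul_smul, smul_mul_assoc, interlace_mul_even]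
  have : ((2 * τ : ℝ) : ℂ) * ((1 / (2 * τ) : ℝ) : ℂ) = 1 := by
    push_cast; field_simp
  rw [this, one_smul, add_sub_cancel_left]

theorem spectrum_diagOp (hτ : 1 < τ) (hA : Admissible A) :
    spectrum ℂ (diagOp τ A) ⊆ Complex.ofReal '' Icc (-1 : ℝ) 1 := by
  intro z hz
  by_contra hzn
  have h1 : IsUnit (algebraMap ℂ Op z - A) := by
    by_contra h
    exact hzn (hA.spectrum_subset h)
  have hu := isUnit_triangularFactor hτ hA.selfAdjoint
  have h2 : IsUnit (algebraMap ℂ Op z - conjOp τ A) := by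
    have e : algebraMap ℂ Op z - conjOp τ A = triangularFactor τ A * (algebraMap ℂ Op z - A) *
        Ring.inverse (triangularFactor τ A) := by
      rw [mul_sub, sub_mul, ← Algebra.commutes, mul_assoc, Ring.mul_inverse_cancel _ hu, mul_one,
        conjOp]
    rw [e]
    exact (hu.mul h1).mul hu.ringInverse
  have h3 := isUnit_interlace_diag h1 h2
  refine hz ?_
  have e : algebraMap ℂ Op z - diagOp τ A =
      interlace (algebraMap ℂ Op z - A) 0 0 (algebraMap ℂ Op z - conjOp τ A) := by
    rw [sub_eq_iff_eq_add, diagOp, interlace_add, sub_add_cancel, sub_add_cancel, add_zero,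
      Algebra.algebraMap_eq_smul_one]
    conv_lhs => rw [← interlace_one, smul_interlace, smul_zero]
  rw [← e] at h3
  exact h3

theorem spectrum_renorm (hτ : 1 < τ) (hA : Admissible A) {z : ℂ}
    (hz : z ∈ spectrum ℂ (renorm τ A)) :
    ∃ x : ℝ, z = x ∧ (τ - 1) / τ ≤ |x| ∧ |x| ≤ 1 := by
  have hsa := isSelfAdjoint_renorm hτ hA.selfAdjoint
  have hre := hsa.mem_spectrum_eq_re hz
  set x := z.re with hx
  have hx0 : x ≠ 0 := by
    intro h
    rw [hre, h, Complex.ofReal_zero] at hz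
    exact spectrum.zero_notMem ℂ (isUnit_renorm hτ hA.selfAdjoint) hz
  have hxc : (x : ℂ) ≠ 0 := Complex.ofReal_ne_zero.2 hx0
  have hmem : ((piR τ x : ℝ) : ℂ) ∈ spectrum ℂ (diagOp τ A) := by
    by_contra hn
    have h1 : IsUnit (algebraMap ℂ Op ((piR τ x : ℝ) : ℂ) - diagOp τ A) := spectrum.notMem_iff.1 hn
    have hq := renorm_quadratic hτ hA.selfAdjoint
    have hu := isUnit_renorm hτ hA.selfAdjoint
    set M := renorm τ A
    set D := diagOp τ A
    set w : ℂ := ((τ - 1 : ℝ) : ℂ) / x with hw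
    -- The identity `(x - v)(τv + (τ-1)/x) = (π(x) - π(v))v` evaluated at `M`. The factors commute,
    -- so invertibility of the right side gives that of `x - M`.
    have e : (algebraMap ℂ Op x - M) * ((τ : ℂ) • M + algebraMap ℂ Op w) =
        (algebraMap ℂ Op ((piR τ x : ℝ) : ℂ) - D) * M := by
      have e1 : ((piR τ x : ℝ) : ℂ) = τ * x - w := by
        rw [hw]; unfold piR; push_cast; ring
      have e2 : (x : ℂ) * w = ((τ - 1 : ℝ) : ℂ) := mul_div_cancel₀ _ hxc
      rw [e1]
      simp only [Algebra.algebraMap_eq_smul_one, sub_mul, mul_add, smul_mul_assoc, one_mul,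
        mul_smul_comm, mul_one, sub_smul]
      linear_combination (norm := module) (-1 : ℂ) • hq + e2 • (1 : Op)
    have hc : Commute (algebraMap ℂ Op x - M) ((τ : ℂ) • M + algebraMap ℂ Op w) := by
      refine Commute.sub_left (Algebra.commutes _ _) ?_
      exact ((Commute.refl M).smul_right _).add_right (Algebra.commute_algebraMap_right _ _)
    have h2 : IsUnit (algebraMap ℂ Op x - M) :=
      (hc.isUnit_mul_iff.1 (by rw [e]; exact h1.mul hu)).1
    exact hz (by rwa [← hre] at h2)
  obtain ⟨y, hy, hyx⟩ := spectrum_diagOp hτ hA hmem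
  have hy' : |piR τ x| ≤ 1 := by
    rw [← Complex.ofReal_injective hyx]; exact abs_le.2 hy
  obtain ⟨σ, hσ, hxσ⟩ := exists_eq_br hτ hx0
  refine ⟨x, hre, ?_, ?_⟩
  · rw [hxσ]; exact le_abs_br hτ hσ hy'
  · rw [hxσ]; exact abs_br_le hτ hσ hy'

/-- Self-adjointness makes the orthogonal complement invariant too. If `t` is the orthogonal
component of `M⁻¹x`, then `Mt` lies in both spaces, so it vanishes. -/
theorem inverse_mem_of_invariant {M : Op} (hM : IsSelfAdjoint M) (hu : IsUnit M)
    {S : Submodule ℂ HalfAxis} (hS : IsClosed (S : Set HalfAxis)) (h : ∀ x ∈ S, M x ∈ S)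
    {x : HalfAxis} (hx : x ∈ S) : Ring.inverse M x ∈ S := by
  have : CompleteSpace S := hS.completeSpace_coe
  obtain ⟨s, hs, t, ht, hst⟩ := S.exists_add_mem_mem_orthogonal (Ring.inverse M x)
  have hMx : M (Ring.inverse M x) = x := by
    change (M * Ring.inverse M) x = x
    rw [Ring.mul_inverse_cancel _ hu]; rfl
  have h1 : M t ∈ Sᗮ := by
    rw [Submodule.mem_orthogonal]
    intro u hu'
    rw [← inner_star_left, hM.star_eq]
    exact (Submodule.mem_orthogonal _ _).1 ht _ (h u hu')
  have h2 : M t ∈ S := by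
    have : M t = x - M s := by
      rw [← hMx, hst, map_add, add_sub_cancel_left]
    rw [this]
    exact S.sub_mem hx (h s hs)
  have h3 : M t = 0 := by
    have := (Submodule.mem_orthogonal _ _).1 h1 _ h2
    exact inner_self_eq_zero.1 this
  have h4 : t = 0 := by
    rw [← inverse_apply_of_apply_eq hu h3, map_zero]
  rw [hst, h4, add_zero]
  exact hs

/-- The closed cyclic subspace is invariant under `M` and `M⁻¹`, hence under `D`. On even vectors
`D` acts as `A`, which is cyclic, so the whole even subspace is reached; `2τM - D` then reaches
every odd vector because `Φ` is onto. -/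
theorem isCyclic_renorm (hτ : 1 < τ) (hA : Admissible A) : IsCyclicAtZero (renorm τ A) := by
  have hsa := isSelfAdjoint_renorm hτ hA.selfAdjoint
  have hu := isUnit_renorm hτ hA.selfAdjoint
  have hD := diagOp_eq hτ hA.selfAdjoint
  set M := renorm τ A with hMdef
  rw [IsCyclicAtZero]
  set S := (Submodule.span ℂ (range fun n : ℕ => (M ^ n) (ket 0))).topologicalClosure with hSdef
  have hS : IsClosed (S : Set HalfAxis) := Submodule.isClosed_topologicalClosure _
  have hmem : ∀ n : ℕ, (M ^ n) (ket 0) ∈ S := fun n =>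
    Submodule.le_topologicalClosure _ (Submodule.subset_span ⟨n, rfl⟩)
  have hM : ∀ x ∈ S, M x ∈ S := by
    have : S ≤ S.comap M.toLinearMap := by
      refine Submodule.topologicalClosure_minimal _ (Submodule.span_le.2 ?_) ?_
      · rintro _ ⟨n, rfl⟩
        have := hmem (n + 1)
        rw [pow_succ'] at this
        exact this
      · exact hS.preimage M.continuous
    exact this
  have hDS : ∀ x ∈ S, diagOp τ A x ∈ S := by
    intro x hx
    rw [hD]
    exact S.sub_mem (S.smul_mem _ (hM x hx))
      (S.smul_mem _ (inverse_mem_of_invariant hsa hu hS hM hx))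
  have hpow : ∀ n : ℕ, evenOp ((A ^ n) (ket 0)) ∈ S := by
    intro n
    induction n with
    | zero =>
      have := hmem 0
      rw [pow_zero] at this ⊢
      change evenOp (ket 0) ∈ S
      rw [evenOp_ket]
      exact this
    | succ n ih =>
      have := hDS _ ih
      change (diagOp τ A * evenOp) ((A ^ n) (ket 0)) ∈ S at this
      rw [diagOp_mul_even] at this
      rw [pow_succ']
      exact this
  have heven : ∀ x, evenOp x ∈ S := by
    have : (⊤ : Submodule ℂ HalfAxis) ≤ S.comap evenOp.toLinearMap := by
      rw [← hA.cyclic]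
      refine Submodule.topologicalClosure_minimal _ (Submodule.span_le.2 ?_) ?_
      · rintro _ ⟨n, rfl⟩; exact hpow n
      · exact hS.preimage evenOp.continuous
    exact fun x => this trivial
  have hodd : ∀ x, oddOp x ∈ S := by
    intro x
    have hΦ := isUnit_triangularFactor hτ hA.selfAdjoint
    have e : oddOp x = (((2 * τ : ℝ) : ℂ) • M - diagOp τ A)
        (evenOp (Ring.inverse (triangularFactor τ A) x)) := by
      change _ = ((((2 * τ : ℝ) : ℂ) • M - diagOp τ A) * evenOp) _
      rw [two_mul_renorm_sub_mul_even hτ]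
      change _ = (oddOp * triangularFactor τ A * Ring.inverse (triangularFactor τ A)) x
      rw [mul_assoc, Ring.mul_inverse_cancel _ hΦ, mul_one]
    rw [e]
    exact S.sub_mem (S.smul_mem _ (hM _ (heven _))) (hDS _ (heven _))
  refine eq_top_iff.2 fun x _ => ?_
  have e : x = evenOp (star evenOp x) + oddOp (star oddOp x) := by
    have := congrArg (fun T : Op => T x) even_add_odd
    exact this.symm
  rw [e]
  exact S.add_mem (heven _) (hodd _)

theorem admissible_renorm (hτ : 1 < τ) (hA : Admissible A) : Admissible (renorm τ A) where
  selfAdjoint := isSelfAdjoint_renorm hτ hA.selfAdjoint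
  cyclic := isCyclic_renorm hτ hA
  spectrum_subset := fun z hz => by
    obtain ⟨x, hx, -, h⟩ := spectrum_renorm hτ hA hz
    exact ⟨x, abs_le.1 h, hx.symm⟩

theorem admissible_iterate (hτ : 1 < τ) (hA : Admissible A) (n : ℕ) :
    Admissible ((renorm τ)^[n] A) := by
  induction n with
  | zero => exact hA
  | succ n ih => rw [Function.iterate_succ_apply']; exact admissible_renorm hτ ih

end Transform

/-! ### Continuous functions on `[-1, 1]` and the functional calculus -/

/-- The independent variable. -/
def Xc : C(II, ℂ) := ⟨fun x => ((x : ℝ) : ℂ), Complex.continuous_ofReal.comp continuous_subtype_val⟩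

theorem Xc_apply (x : II) : Xc x = ((x : ℝ) : ℂ) := rfl

theorem star_Xc : star Xc = Xc := by
  ext x
  exact Complex.conj_ofReal _

theorem span_pow_Xc_closure :
    (Submodule.span ℂ (range fun n : ℕ => Xc ^ n)).topologicalClosure = ⊤ := by
  have h1 := ContinuousMap.starSubalgebra_topologicalClosure_eq_top_of_separatesPoints
    (StarAlgebra.adjoin ℂ ({Xc} : Set C(II, ℂ))) (by
      intro x y hxy
      refine ⟨Xc, ⟨Xc, StarAlgebra.subset_adjoin ℂ _ rfl, rfl⟩, fun h => hxy ?_⟩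
      exact Subtype.ext (Complex.ofReal_injective h))
  refine eq_top_iff.2 fun f _ => ?_
  have h2 : f ∈ (StarAlgebra.adjoin ℂ ({Xc} : Set C(II, ℂ))).topologicalClosure := by
    rw [h1]; trivial
  rw [← SetLike.mem_coe, StarSubalgebra.topologicalClosure_coe] at h2
  rw [← SetLike.mem_coe, Submodule.topologicalClosure_coe]
  refine closure_mono ?_ h2
  intro g hg
  have h3 : g ∈ (StarAlgebra.adjoin ℂ ({Xc} : Set C(II, ℂ))).toSubalgebra := hg
  rw [StarAlgebra.adjoin_toSubalgebra, Set.star_singleton, star_Xc, Set.union_self] at h3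
  have h4 : g ∈ Subalgebra.toSubmodule (Algebra.adjoin ℂ ({Xc} : Set C(II, ℂ))) := h3
  rw [Algebra.adjoin_eq_span] at h4
  have e : (Submonoid.closure ({Xc} : Set C(II, ℂ)) : Set C(II, ℂ)) = range fun n : ℕ => Xc ^ n := by
    ext y
    simp [Submonoid.mem_closure_singleton]
  rw [e] at h4
  exact h4

/-- Two continuous linear maps that agree on the powers of the variable are equal. -/
theorem eq_of_pow_Xc {E : Type*} [AddCommMonoid E] [Module ℂ E] [TopologicalSpace E] [T2Space E]
    {S T : C(II, ℂ) →L[ℂ] E} (h : ∀ n : ℕ, S (Xc ^ n) = T (Xc ^ n)) (f : C(II, ℂ)) :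
    S f = T f := by
  have : S = T := by
    refine ContinuousLinearMap.ext_on
      (Submodule.dense_iff_topologicalClosure_eq_top.2 span_pow_Xc_closure) ?_
    rintro _ ⟨n, rfl⟩
    exact h n
  rw [this]

/-- The continuous functional calculus of an operator with spectrum on `[-1, 1]`. -/
def fcalc {A : Op} (hA : Admissible A) : C(II, ℂ) →⋆ₐ[ℂ] Op :=
  (cfcHom (R := ℂ) (a := A) hA.selfAdjoint.isStarNormal).comp
    (ContinuousMap.compStarAlgHom' ℂ ℂ
      ⟨fun z : spectrum ℂ A => projIcc (-1) 1 neg_one_le_one (z : ℂ).re,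
        continuous_projIcc.comp (Complex.continuous_re.comp continuous_subtype_val)⟩)

section FunctionalCalculus

variable {A : Op}

/-- Only the values on the spectrum matter; this lets `piI`, which has no pole, stand in for `π`. -/
theorem fcalc_congr (hA : Admissible A) {f g : C(II, ℂ)}
    (h : ∀ x : II, ((x : ℝ) : ℂ) ∈ spectrum ℂ A → f x = g x) : fcalc hA f = fcalc hA g := by
  have : ContinuousMap.compStarAlgHom' ℂ ℂ
      (⟨fun z : spectrum ℂ A => projIcc (-1) 1 neg_one_le_one (z : ℂ).re,
        continuous_projIcc.comp (Complex.continuous_re.comp continuous_subtype_val)⟩ :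
        C(spectrum ℂ A, II)) f = ContinuousMap.compStarAlgHom' ℂ ℂ
      (⟨fun z : spectrum ℂ A => projIcc (-1) 1 neg_one_le_one (z : ℂ).re,
        continuous_projIcc.comp (Complex.continuous_re.comp continuous_subtype_val)⟩ :
        C(spectrum ℂ A, II)) g := by
    ext z
    refine h _ ?_
    obtain ⟨y, hy, hyz⟩ := hA.spectrum_subset z.2
    change ((projIcc (-1) 1 neg_one_le_one (z : ℂ).re : ℝ) : ℂ) ∈ spectrum ℂ A
    rw [show (z : ℂ).re = y by rw [← hyz]; rfl, projIcc_of_mem _ hy]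
    change (y : ℂ) ∈ spectrum ℂ A
    rw [hyz]; exact z.2
  exact congrArg (cfcHom (R := ℂ) (a := A) hA.selfAdjoint.isStarNormal) this

theorem fcalc_Xc (hA : Admissible A) : fcalc hA Xc = A := by
  have : ContinuousMap.compStarAlgHom' ℂ ℂ
      (⟨fun z : spectrum ℂ A => projIcc (-1) 1 neg_one_le_one (z : ℂ).re,
        continuous_projIcc.comp (Complex.continuous_re.comp continuous_subtype_val)⟩ :
        C(spectrum ℂ A, II)) Xc = ContinuousMap.restrict (spectrum ℂ A) (.id ℂ) := by
    ext z
    obtain ⟨y, hy, hyz⟩ := hA.spectrum_subset z.2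
    change ((projIcc (-1) 1 neg_one_le_one (z : ℂ).re : ℝ) : ℂ) = z
    rw [show (z : ℂ).re = y by rw [← hyz]; rfl, projIcc_of_mem _ hy]
    exact hyz
  have h2 := cfcHom_id (R := ℂ) (a := A) hA.selfAdjoint.isStarNormal
  rw [← this] at h2
  exact h2

theorem norm_fcalc_le (hA : Admissible A) (f : C(II, ℂ)) : ‖fcalc hA f‖ ≤ ‖f‖ :=
  NonUnitalStarAlgHom.norm_apply_le (fcalc hA) f

theorem norm_Xc_le : ‖Xc‖ ≤ 1 := by
  refine (ContinuousMap.norm_le _ zero_le_one).2 fun x => ?_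
  rw [Xc_apply, Complex.norm_real]
  exact abs_coe_le x

theorem Admissible.norm_le (hA : Admissible A) : ‖A‖ ≤ 1 := by
  have := norm_fcalc_le hA Xc
  rw [fcalc_Xc] at this
  exact this.trans norm_Xc_le

/-- The vector `f(A)|0⟩`. -/
def vecOf (hA : Admissible A) : C(II, ℂ) →L[ℂ] HalfAxis :=
  LinearMap.mkContinuous
    { toFun := fun f => fcalc hA f (ket 0)
      map_add' := fun f g => by rw [map_add]; rfl
      map_smul' := fun c f => by rw [map_smul]; rfl } 1 fun f => by
    have h1 : ‖ket 0‖ = 1 := orthonormal_ket.1 0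
    have := (fcalc hA f).le_opNorm (ket 0)
    rw [h1, mul_one] at this
    rw [one_mul]
    exact this.trans (norm_fcalc_le hA f)

theorem vecOf_apply (hA : Admissible A) (f : C(II, ℂ)) : vecOf hA f = fcalc hA f (ket 0) := rfl

theorem vecOf_congr_op {B : Op} (hA : Admissible A) (hB : Admissible B) (h : A = B) (f : C(II, ℂ)) :
    vecOf hA f = vecOf hB f := by
  subst h; rfl

theorem vecOf_mul (hA : Admissible A) (f g : C(II, ℂ)) :
    vecOf hA (f * g) = fcalc hA f (vecOf hA g) := by
  rw [vecOf_apply, map_mul]; rfl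

theorem vecOf_one (hA : Admissible A) : vecOf hA 1 = ket 0 := by
  rw [vecOf_apply, map_one]; rfl

/-- The spectral functional `f ↦ ⟨0|f(A)|0⟩`. -/
def stateOf (hA : Admissible A) (f : C(II, ℂ)) : ℂ := ⟪ket 0, vecOf hA f⟫_ℂ

theorem stateOf_sub (hA : Admissible A) (f g : C(II, ℂ)) :
    stateOf hA (f - g) = stateOf hA f - stateOf hA g := by
  rw [stateOf, map_sub, inner_sub_right]; rfl

theorem norm_stateOf_le (hA : Admissible A) (f : C(II, ℂ)) : ‖stateOf hA f‖ ≤ ‖f‖ := by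
  have h1 : ‖ket 0‖ = 1 := orthonormal_ket.1 0
  have h2 := norm_inner_le_norm (𝕜 := ℂ) (ket 0) (vecOf hA f)
  have h3 := (vecOf hA).le_of_opNorm_le (LinearMap.mkContinuous_norm_le _ zero_le_one _) f
  rw [h1, one_mul] at h2
  rw [one_mul] at h3
  exact h2.trans h3

theorem stateOf_const (hA : Admissible A) (c : ℂ) : stateOf hA (ContinuousMap.const II c) = c := by
  have : ContinuousMap.const II c = c • (1 : C(II, ℂ)) := by ext x; simp
  rw [stateOf, this, map_smul, vecOf_one, inner_smul_right, inner_ket_ket]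
  simp

theorem inner_vecOf (hA : Admissible A) (f g : C(II, ℂ)) :
    ⟪vecOf hA f, vecOf hA g⟫_ℂ = stateOf hA (star f * g) := by
  rw [stateOf, vecOf_mul, map_star, inner_star_right]; rfl

end FunctionalCalculus

/-! ### The functional calculus of the transform -/

section Step

variable {τ : ℝ} {A : Op}

/-- The function `2τ v - π(v)`, which is `τ v + (τ - 1) / v` on `π⁻¹([-1, 1])`. -/
def oddC (hτ : 1 < τ) : C(II, ℂ) := ((2 * τ : ℝ) : ℂ) • Xc - Xc.comp (piI hτ)

theorem star_comp (f : C(II, ℂ)) (g : C(II, II)) : star (f.comp g) = (star f).comp g := rfl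

theorem star_oddC (hτ : 1 < τ) : star (oddC hτ) = oddC hτ := by
  ext x
  simp only [oddC, ContinuousMap.star_apply, ContinuousMap.sub_apply, ContinuousMap.smul_apply,
    ContinuousMap.comp_apply, Xc_apply, smul_eq_mul, Complex.star_def, map_sub, map_mul,
    Complex.conj_ofReal]

theorem oddC_brI (hτ : 1 < τ) {σ : ℝ} (hσ : σ * σ = 1) (x : II) :
    oddC hτ (brI τ σ x) = ((σ * √((x : ℝ) ^ 2 + 4 * τ * (τ - 1)) : ℝ) : ℂ) := by
  rw [← two_mul_br_sub hτ]
  simp only [oddC, ContinuousMap.sub_apply, ContinuousMap.smul_apply,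
    ContinuousMap.comp_apply, Xc_apply, smul_eq_mul, piI_brI hτ hσ, coe_brI hτ hσ]
  push_cast
  ring

theorem mem_spectrum_renorm_le (hτ : 1 < τ) (hA : Admissible A) {x : II}
    (hx : ((x : ℝ) : ℂ) ∈ spectrum ℂ (renorm τ A)) : (τ - 1) / τ ≤ |(x : ℝ)| := by
  obtain ⟨y, hy, h, -⟩ := spectrum_renorm hτ hA hx
  rwa [Complex.ofReal_injective hy]

/-- Multiplied by the variable, `π` becomes the polynomial `τv² - (τ-1)` on the spectrum; the
quadratic relation evaluates it and the invertible `M` is cancelled. -/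
theorem fcalc_renorm_Xc_comp (hτ : 1 < τ) (hA : Admissible A) :
    fcalc (admissible_renorm hτ hA) (Xc.comp (piI hτ)) = diagOp τ A := by
  set hM := admissible_renorm hτ hA
  have hu := isUnit_renorm hτ hA.selfAdjoint
  have h1 : fcalc hM (Xc * Xc.comp (piI hτ)) =
      fcalc hM ((τ : ℂ) • (Xc * Xc) - ((τ - 1 : ℝ) : ℂ) • 1) := by
    refine fcalc_congr hM fun x hx => ?_
    have h := mem_spectrum_renorm_le hτ hA hx
    have h0 : (x : ℝ) ≠ 0 := abs_pos.1 ((ratio_pos hτ).trans_le h)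
    simp only [ContinuousMap.mul_apply, ContinuousMap.comp_apply, Xc_apply, coe_piI hτ h,
      ContinuousMap.sub_apply, ContinuousMap.smul_apply, ContinuousMap.one_apply, smul_eq_mul, piR]
    have h0' : ((x : ℝ) : ℂ) ≠ 0 := Complex.ofReal_ne_zero.2 h0
    push_cast
    field_simp
  rw [map_mul, map_sub, map_smul, map_smul, map_mul, map_one, fcalc_Xc,
    renorm_quadratic hτ hA.selfAdjoint, add_sub_cancel_right, diagOp_mul_renorm hτ hA.selfAdjoint]
    at h1
  have h2 := congrArg (Ring.inverse (renorm τ A) * ·) h1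
  simpa only [← mul_assoc, Ring.inverse_mul_cancel _ hu, one_mul] using h2

theorem fcalc_renorm_comp_even (hτ : 1 < τ) (hA : Admissible A) (f : C(II, ℂ)) (x : HalfAxis) :
    fcalc (admissible_renorm hτ hA) (f.comp (piI hτ)) (evenOp x) = evenOp (fcalc hA f x) := by
  set hM := admissible_renorm hτ hA
  let S : C(II, ℂ) →L[ℂ] HalfAxis := LinearMap.mkContinuous
    { toFun := fun f => fcalc hM (f.comp (piI hτ)) (evenOp x)
      map_add' := fun f g => by
        rw [show (f + g).comp (piI hτ) = f.comp (piI hτ) + g.comp (piI hτ) from rfl, map_add]; rfl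
      map_smul' := fun c f => by
        rw [show (c • f).comp (piI hτ) = c • f.comp (piI hτ) from rfl, map_smul]; rfl }
    ‖evenOp x‖ fun f => by
      refine ((fcalc hM (f.comp (piI hτ))).le_opNorm _).trans ?_
      rw [mul_comm]
      refine mul_le_mul_of_nonneg_left ((norm_fcalc_le hM _).trans ?_) (norm_nonneg _)
      exact (ContinuousMap.norm_le _ (norm_nonneg _)).2 fun y => f.norm_coe_le_norm _
  let T : C(II, ℂ) →L[ℂ] HalfAxis := LinearMap.mkContinuous
    { toFun := fun f => evenOp (fcalc hA f x)
      map_add' := fun f g => by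
        rw [map_add]; exact map_add evenOp _ _
      map_smul' := fun c f => by
        rw [map_smul]; exact map_smul evenOp c _ }
    (‖evenOp‖ * ‖x‖) fun f => by
      refine (evenOp.le_opNorm _).trans ?_
      rw [mul_assoc, mul_comm ‖x‖]
      refine mul_le_mul_of_nonneg_left (((fcalc hA f).le_opNorm _).trans ?_) (norm_nonneg _)
      exact mul_le_mul_of_nonneg_right (norm_fcalc_le hA _) (norm_nonneg _)
  refine eq_of_pow_Xc (S := S) (T := T) (fun n => ?_) f
  change fcalc hM ((Xc ^ n).comp (piI hτ)) (evenOp x) = evenOp (fcalc hA (Xc ^ n) x)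
  rw [show (Xc ^ n).comp (piI hτ) = (Xc.comp (piI hτ)) ^ n from rfl, map_pow,
    fcalc_renorm_Xc_comp hτ hA, map_pow, fcalc_Xc]
  induction n with
  | zero => rfl
  | succ n ih =>
    rw [pow_succ', pow_succ']
    change diagOp τ A ((diagOp τ A ^ n) (evenOp x)) = evenOp (A ((A ^ n) x))
    rw [ih]
    change (diagOp τ A * evenOp) _ = (evenOp * A) _
    rw [diagOp_mul_even]

theorem vecOf_renorm_comp (hτ : 1 < τ) (hA : Admissible A) (f : C(II, ℂ)) :
    vecOf (admissible_renorm hτ hA) (f.comp (piI hτ)) = evenOp (vecOf hA f) := by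
  rw [vecOf_apply, vecOf_apply, ← fcalc_renorm_comp_even hτ hA, evenOp_ket]

theorem vecOf_renorm_oddC_mul (hτ : 1 < τ) (hA : Admissible A) (f : C(II, ℂ)) :
    vecOf (admissible_renorm hτ hA) (oddC hτ * f.comp (piI hτ)) =
      oddOp (triangularFactor τ A (vecOf hA f)) := by
  rw [vecOf_mul, vecOf_renorm_comp hτ hA, oddC, map_sub, map_smul, fcalc_Xc,
    fcalc_renorm_Xc_comp hτ hA]
  have := congrArg (fun T : Op => T (vecOf hA f)) (two_mul_renorm_sub_mul_even hτ (A := A))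
  exact this

/-- The odd component of a function with respect to the two branches. -/
def oddPart (hτ : 1 < τ) (f : C(II, ℂ)) : C(II, ℂ) :=
  (⟨fun x => (((√((x : ℝ) ^ 2 + 4 * τ * (τ - 1)) : ℝ) : ℂ))⁻¹, by
    refine Continuous.inv₀ (by fun_prop) fun x => ?_
    exact Complex.ofReal_ne_zero.2 (Real.sqrt_pos.2 (disc_pos hτ x)).ne'⟩ : C(II, ℂ)) *
  (1 / 2 : ℝ) • (f.comp (brI τ 1) - f.comp (brI τ (-1)))

/-- Half-sum and half-difference over the two preimages of `π(x)`: the odd factor equals plus or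
minus the square root on the two branches, which restores the sign of the half-difference. -/
theorem eq_even_add_odd (hτ : 1 < τ) (f : C(II, ℂ)) {x : II} (hx : (τ - 1) / τ ≤ |(x : ℝ)|) :
    f x = ruelleC τ f (piI hτ x) + oddC hτ x * oddPart hτ f (piI hτ x) := by
  have hr : ∀ y : II, ((√((y : ℝ) ^ 2 + 4 * τ * (τ - 1)) : ℝ) : ℂ) ≠ 0 := fun y =>
    Complex.ofReal_ne_zero.2 (Real.sqrt_pos.2 (disc_pos hτ y)).ne'
  have key : ∀ σ : ℝ, σ = 1 ∨ σ = -1 → ∀ y : II, f (brI τ σ y) =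
      ruelleC τ f y + oddC hτ (brI τ σ y) * oddPart hτ f y := by
    intro σ hσ y
    have hσ' : σ * σ = 1 := by rcases hσ with rfl | rfl <;> norm_num
    have e : oddPart hτ f y = (((√((y : ℝ) ^ 2 + 4 * τ * (τ - 1)) : ℝ) : ℂ))⁻¹ *
        ((1 / 2 : ℝ) • (f (brI τ 1 y) - f (brI τ (-1) y))) := rfl
    rw [oddC_brI hτ hσ', ruelleC_apply, e]
    have h0 := hr y
    rcases hσ with rfl | rfl
    · rw [one_mul, mul_inv_cancel_left₀ h0, ← smul_add, add_add_sub_cancel, ← two_smul ℝ, smul_smul]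
      norm_num
    · rw [neg_one_mul, Complex.ofReal_neg, neg_mul, mul_inv_cancel_left₀ h0, ← sub_eq_add_neg,
        ← smul_sub, add_sub_sub_cancel, ← two_smul ℝ, smul_smul]
      norm_num
  rcases exists_eq_brI hτ hx with h | h
  · have := key 1 (Or.inl rfl) (piI hτ x)
    rwa [← h] at this
  · have := key (-1) (Or.inr rfl) (piI hτ x)
    rwa [← h] at this

/-- The even part of `f` produces a vector of the even subspace, the odd part one of the odd
subspace, and `|0⟩` sees only the former. -/
theorem stateOf_renorm (hτ : 1 < τ) (hA : Admissible A) (f : C(II, ℂ)) :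
    stateOf (admissible_renorm hτ hA) f = stateOf hA (ruelleC τ f) := by
  have h : fcalc (admissible_renorm hτ hA) f = fcalc (admissible_renorm hτ hA)
      ((ruelleC τ f).comp (piI hτ) + oddC hτ * (oddPart hτ f).comp (piI hτ)) :=
    fcalc_congr _ fun x hx => eq_even_add_odd hτ f (mem_spectrum_renorm_le hτ hA hx)
  have h0 : ket 0 = evenOp (ket 0) := (evenOp_ket 0).symm
  rw [stateOf, stateOf, vecOf_apply, h, ← vecOf_apply, map_add, vecOf_renorm_comp hτ hA,
    vecOf_renorm_oddC_mul hτ hA, inner_add_right, h0, ← inner_star_left, ← inner_star_left]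
  change ⟪(star evenOp * evenOp) (ket 0), _⟫_ℂ + ⟪(star oddOp * evenOp) (ket 0), _⟫_ℂ = _
  rw [star_even_mul_even, star_odd_mul_even, ← h0]
  change _ + ⟪(0 : HalfAxis), _⟫_ℂ = _
  rw [inner_zero_left, add_zero]
  rfl

theorem stateOf_iterate (hτ : 1 < τ) (hA : Admissible A) (n : ℕ) (f : C(II, ℂ)) :
    stateOf (admissible_iterate hτ hA n) f = stateOf hA ((ruelleC τ)^[n] f) := by
  induction n generalizing f with
  | zero => rfl
  | succ n ih =>
    rw [stateOf, ← vecOf_congr_op (admissible_renorm hτ (admissible_iterate hτ hA n)) _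
      (Function.iterate_succ_apply' (renorm τ) n A).symm]
    exact (stateOf_renorm hτ _ f).trans (ih _)

end Step

/-! ### Continuous functions in `L²(μ)` -/

section LTwo

variable {τ : ℝ} (μ : Measure ℝ) [IsProbabilityMeasure μ]

/-- The class in `L²(μ)` of a continuous function on `[-1, 1]`. -/
def toL2 : C(II, ℂ) →L[ℂ] Lp ℂ 2 μ :=
  (BoundedContinuousFunction.toLp 2 μ ℂ).comp
    (LinearMap.mkContinuous
      ({ toFun := fun f => extC f
         map_add' := fun _ _ => rfl
         map_smul' := fun _ _ => rfl } : C(II, ℂ) →ₗ[ℂ] BoundedContinuousFunction ℝ ℂ) 1 fun f => by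
      rw [one_mul]
      exact (BoundedContinuousFunction.norm_le (norm_nonneg _)).2 fun x => f.norm_coe_le_norm _)

theorem coeFn_toL2 (f : C(II, ℂ)) : (toL2 μ f : ℝ → ℂ) =ᵐ[μ] extC f :=
  BoundedContinuousFunction.coeFn_toLp 2 μ ℂ (extC f)

variable {μ}

theorem inner_toL2 (f g : C(II, ℂ)) : ⟪toL2 μ f, toL2 μ g⟫_ℂ = meanC μ (star f * g) := by
  rw [L2.inner_def, meanC]
  refine integral_congr_ae ?_
  filter_upwards [coeFn_toL2 μ f, coeFn_toL2 μ g] with x hf hg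
  rw [hf, hg, RCLike.inner_apply, mul_comm]
  rfl

theorem toL2_congr (hτ : 1 < τ) (h : IsRuelleEigenMeasure τ μ) {f g : C(II, ℂ)}
    (hfg : ∀ x ∈ cantor hτ, f x = g x) : toL2 μ f = toL2 μ g := by
  refine Lp.ext ?_
  filter_upwards [coeFn_toL2 μ f, coeFn_toL2 μ g, ae_cantor hτ h] with x hf hg hx
  obtain ⟨y, hy, rfl⟩ := hx
  rw [hf, hg, extC_coe, extC_coe, hfg y hy]

theorem norm_toL2_mul_le (f g : C(II, ℂ)) : ‖toL2 μ (f * g)‖ ≤ ‖f‖ * ‖toL2 μ g‖ := by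
  refine Lp.norm_le_mul_norm_of_ae_le_mul ?_
  filter_upwards [coeFn_toL2 μ (f * g), coeFn_toL2 μ g] with x hf hg
  rw [hf, hg]
  change ‖f _ * g _‖ ≤ ‖f‖ * ‖g _‖
  rw [norm_mul]
  exact mul_le_mul_of_nonneg_right (f.norm_coe_le_norm _) (norm_nonneg _)

/-- The mean of continuous functions as a linear functional. -/
theorem meanC_eq_inner (f : C(II, ℂ)) : meanC μ f = ⟪toL2 μ 1, toL2 μ f⟫_ℂ := by
  rw [inner_toL2, star_one, one_mul]

theorem toL2_denseRange (h : IsRuelleEigenMeasure τ μ) : DenseRange (toL2 μ) := by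
  refine (BoundedContinuousFunction.toLp_denseRange ℂ μ ℂ (by norm_num : (2 : ENNReal) ≠ ⊤)).mono ?_
  rintro _ ⟨g, rfl⟩
  refine ⟨⟨fun x => g x, g.continuous.comp continuous_subtype_val⟩, Lp.ext ?_⟩
  filter_upwards [coeFn_toL2 μ ⟨fun x => g x, g.continuous.comp continuous_subtype_val⟩,
    BoundedContinuousFunction.coeFn_toLp 2 μ ℂ g, h.ae_mem] with x h1 h2 hx
  rw [h1, h2]
  lift x to II using hx
  rw [extC_coe]; rfl

/-! ### Composition with `π` and the odd factor in `L²(μ)` -/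

section Renorm

variable (hτ : 1 < τ)

theorem ruelleC_comp_piI {E : Type*} [NormedAddCommGroup E] [NormedSpace ℝ E] (u : C(II, E)) :
    ruelleC τ (u.comp (piI hτ)) = u := by
  ext x
  simp only [ruelleC_apply, ContinuousMap.comp_apply,
    piI_brI hτ (show (1 : ℝ) * 1 = 1 by norm_num),
    piI_brI hτ (show (-1 : ℝ) * -1 = 1 by norm_num)]
  rw [← two_smul ℝ, smul_smul]; norm_num

theorem ruelleC_oddC_mul (u : C(II, ℂ)) : ruelleC τ (oddC hτ * u.comp (piI hτ)) = 0 := by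
  ext x
  simp only [ruelleC_apply, ContinuousMap.comp_apply, ContinuousMap.mul_apply,
    piI_brI hτ (show (1 : ℝ) * 1 = 1 by norm_num),
    piI_brI hτ (show (-1 : ℝ) * -1 = 1 by norm_num),
    oddC_brI hτ (show (1 : ℝ) * 1 = 1 by norm_num),
    oddC_brI hτ (show (-1 : ℝ) * -1 = 1 by norm_num), ContinuousMap.zero_apply]
  rw [← add_mul, ← Complex.ofReal_add]
  simp

/-- The function `x² + 4τ(τ-1)`. -/
def sqC (τ : ℝ) : C(II, ℂ) := Xc ^ 2 + ((4 * τ * (τ - 1) : ℝ) : ℂ) • 1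

theorem oddC_mul_self_brI {σ : ℝ} (hσ : σ * σ = 1) (x : II) :
    oddC hτ (brI τ σ x) * oddC hτ (brI τ σ x) = sqC τ x := by
  rw [oddC_brI hτ hσ, ← Complex.ofReal_mul, mul_mul_mul_comm, hσ, one_mul,
    Real.mul_self_sqrt (disc_pos hτ x).le]
  simp only [sqC, ContinuousMap.add_apply, ContinuousMap.pow_apply, Xc_apply,
    ContinuousMap.smul_apply, ContinuousMap.one_apply, smul_eq_mul, mul_one]
  push_cast
  ring

theorem oddC_mul_self {x : II} (hx : (τ - 1) / τ ≤ |(x : ℝ)|) :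
    oddC hτ x * oddC hτ x = sqC τ (piI hτ x) := by
  rcases exists_eq_brI hτ hx with h | h
  · have := oddC_mul_self_brI hτ (show (1 : ℝ) * 1 = 1 by norm_num) (piI hτ x)
    rwa [← h] at this
  · have := oddC_mul_self_brI hτ (show (-1 : ℝ) * -1 = 1 by norm_num) (piI hτ x)
    rwa [← h] at this

theorem ruelleC_oddC_mul_self_mul (u : C(II, ℂ)) :
    ruelleC τ (oddC hτ * oddC hτ * u.comp (piI hτ)) = sqC τ * u := by
  ext x
  simp only [ruelleC_apply, ContinuousMap.comp_apply, ContinuousMap.mul_apply,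
    piI_brI hτ (show (1 : ℝ) * 1 = 1 by norm_num),
    piI_brI hτ (show (-1 : ℝ) * -1 = 1 by norm_num),
    oddC_mul_self_brI hτ (show (1 : ℝ) * 1 = 1 by norm_num),
    oddC_mul_self_brI hτ (show (-1 : ℝ) * -1 = 1 by norm_num)]
  rw [← two_smul ℝ, smul_smul]; norm_num

theorem inner_toL2_comp (h : IsRuelleEigenMeasure τ μ) (f g : C(II, ℂ)) :
    ⟪toL2 μ (f.comp (piI hτ)), toL2 μ (g.comp (piI hτ))⟫_ℂ = ⟪toL2 μ f, toL2 μ g⟫_ℂ := by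
  rw [inner_toL2, inner_toL2, star_comp,
    show (star f).comp (piI hτ) * g.comp (piI hτ) = (star f * g).comp (piI hτ) from rfl,
    ← meanC_ruelleC hτ h, ruelleC_comp_piI]

theorem inner_toL2_comp_odd (h : IsRuelleEigenMeasure τ μ) (f g : C(II, ℂ)) :
    ⟪toL2 μ (f.comp (piI hτ)), toL2 μ (oddC hτ * g.comp (piI hτ))⟫_ℂ = 0 := by
  rw [inner_toL2, star_comp, mul_left_comm,
    show (star f).comp (piI hτ) * g.comp (piI hτ) = (star f * g).comp (piI hτ) from rfl,
    ← meanC_ruelleC hτ h, ruelleC_oddC_mul, meanC_eq_inner, map_zero, inner_zero_right]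

theorem inner_toL2_odd_odd (h : IsRuelleEigenMeasure τ μ) (f g : C(II, ℂ)) :
    ⟪toL2 μ (oddC hτ * f.comp (piI hτ)), toL2 μ (oddC hτ * g.comp (piI hτ))⟫_ℂ =
      ⟪toL2 μ f, toL2 μ (sqC τ * g)⟫_ℂ := by
  rw [inner_toL2, inner_toL2, star_mul', star_comp, star_oddC, mul_mul_mul_comm,
    show (star f).comp (piI hτ) * g.comp (piI hτ) = (star f * g).comp (piI hτ) from rfl,
    ← meanC_ruelleC hτ h, ruelleC_oddC_mul_self_mul, mul_left_comm]

theorem norm_toL2_comp (h : IsRuelleEigenMeasure τ μ) (f : C(II, ℂ)) :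
    ‖toL2 μ (f.comp (piI hτ))‖ = ‖toL2 μ f‖ := by
  rw [@norm_eq_sqrt_re_inner ℂ, @norm_eq_sqrt_re_inner ℂ, inner_toL2_comp hτ h]

/-- For an orthonormal family this exhibits the weighted Gram matrix as a semidefinite matrix plus
`4τ(τ-1)` times the identity. -/
theorem inner_toL2_sqC_mul (f g : C(II, ℂ)) :
    ⟪toL2 μ f, toL2 μ (sqC τ * g)⟫_ℂ =
      ⟪toL2 μ (Xc * f), toL2 μ (Xc * g)⟫_ℂ +
        ((4 * τ * (τ - 1) : ℝ) : ℂ) * ⟪toL2 μ f, toL2 μ g⟫_ℂ := by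
  rw [← inner_smul_right, inner_toL2 (Xc * f), star_mul', star_Xc, ← map_smul, inner_toL2,
    inner_toL2, meanC_eq_inner, meanC_eq_inner, meanC_eq_inner, ← inner_add_right, ← map_add]
  congr 2
  rw [sqC, add_mul, smul_mul_assoc, one_mul, mul_add]
  ring

end Renorm

end LTwo

/-! ### The recursion for the basis functions -/

/-- A recursion in which the `m`-th term depends only on the earlier ones has a solution. -/
theorem exists_fixed_of_causal {α : Type*} (a : α) (F : (ℕ → α) → ℕ → α)
    (hF : ∀ p q m, (∀ j < m, p j = q j) → F p m = F q m) : ∃ p : ℕ → α, F p = p := by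
  set q : ℕ → ℕ → α := fun n => F^[n] fun _ => a with hq
  have hs : ∀ n, q (n + 1) = F (q n) := fun n => Function.iterate_succ_apply' _ _ _
  -- After `m + 1` applications of `F` the value at `m` no longer changes.
  set p : ℕ → α := fun m => q (m + 1) m with hp
  have key : ∀ m n, m < n → q n m = F p m := by
    intro m
    induction m using Nat.strong_induction_on with
    | _ m ih =>
      intro n hn
      obtain ⟨n, rfl⟩ := Nat.exists_eq_succ_of_ne_zero (by omega : n ≠ 0)
      rw [Nat.succ_eq_add_one, hs]
      refine hF _ _ _ fun j hj => ?_
      rw [ih j hj n (by omega), hp]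
      exact (ih j hj (j + 1) (by omega)).symm
  exact ⟨p, funext fun m => (key m (m + 1) (by omega)).symm⟩

section Step

variable {τ : ℝ} (hτ : 1 < τ) (φ : C(II, ℂ) → ℂ)

/-- The Gram matrix of the functions `p` with weight `x² + 4τ(τ-1)`. -/
def gramC (τ : ℝ) (φ : C(II, ℂ) → ℂ) (p : ℕ → C(II, ℂ)) (i j : ℕ) : ℂ :=
  φ (star (p i) * (sqC τ * p j))

/-- The combination of the functions `p j` given by column `k` of the inverse Cholesky factor. -/
def cholSum (τ : ℝ) (φ : C(II, ℂ) → ℂ) (p : ℕ → C(II, ℂ)) (k : ℕ) : C(II, ℂ) :=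
  ∑ j ∈ Finset.range (k + 1), cholCol (gramC τ φ p) k j • p j

/-- One step of the recursion for the basis functions. -/
def stepC (p : ℕ → C(II, ℂ)) (m : ℕ) : C(II, ℂ) :=
  if m = 0 then 1
  else if Even m then (p (m / 2)).comp (piI hτ)
  else oddC hτ * (cholSum τ φ p (m / 2)).comp (piI hτ)

theorem stepC_zero (p : ℕ → C(II, ℂ)) : stepC hτ φ p 0 = 1 := if_pos rfl

/-- The hypothesis on `p 0` serves `k = 0` only, where the step is `1` by definition and not a
composition. -/
theorem stepC_even {p : ℕ → C(II, ℂ)} (hp : p 0 = 1) (k : ℕ) :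
    stepC hτ φ p (2 * k) = (p k).comp (piI hτ) := by
  rcases Nat.eq_zero_or_pos k with rfl | hk
  · rw [hp, mul_zero, stepC_zero]; rfl
  · rw [stepC, if_neg (by omega), if_pos (even_two_mul k), Nat.mul_div_cancel_left _ two_pos]

theorem stepC_odd (p : ℕ → C(II, ℂ)) (k : ℕ) :
    stepC hτ φ p (2 * k + 1) = oddC hτ * (cholSum τ φ p k).comp (piI hτ) := by
  rw [stepC, if_neg (by omega), if_neg (by simp), show (2 * k + 1) / 2 = k by omega]

theorem exists_stepC_fixed : ∃ p, stepC hτ φ p = p := by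
  refine exists_fixed_of_causal 1 _ fun p q m h => ?_
  rcases Nat.eq_zero_or_pos m with rfl | hm
  · rw [stepC_zero, stepC_zero]
  · rw [stepC, stepC]
    split_ifs with h1 h2
    · rfl
    · rw [h _ (by omega)]
    · have hlt : m / 2 < m := by omega
      have : cholSum τ φ p (m / 2) = cholSum τ φ q (m / 2) := by
        refine Finset.sum_congr rfl fun j hj => ?_
        rw [Finset.mem_range] at hj
        rw [h j (by omega), cholCol_congr fun i l hi hl => ?_]
        rw [gramC, gramC, h i (by omega), h l (by omega)]
      rw [this]

end Step

/-! ### Orthonormality and completeness -/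

section Basis

variable {τ : ℝ} {hτ : 1 < τ} {μ : Measure ℝ} [IsProbabilityMeasure μ] {p : ℕ → C(II, ℂ)}

theorem fixed_zero (hp : stepC hτ (meanC μ) p = p) : p 0 = 1 := by
  rw [← hp]
  exact stepC_zero hτ _ p

theorem fixed_even (hp : stepC hτ (meanC μ) p = p) (k : ℕ) : p (2 * k) = (p k).comp (piI hτ) := by
  conv_lhs => rw [← hp]
  exact stepC_even hτ _ (fixed_zero hp) k

theorem fixed_odd (hp : stepC hτ (meanC μ) p = p) (k : ℕ) :
    p (2 * k + 1) = oddC hτ * (cholSum τ (meanC μ) p k).comp (piI hτ) := by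
  conv_lhs => rw [← hp]
  exact stepC_odd hτ _ p k

theorem gramC_eq (p : ℕ → C(II, ℂ)) (i j : ℕ) :
    gramC τ (meanC μ) p i j = ⟪toL2 μ (p i), toL2 μ (sqC τ * p j)⟫_ℂ := (inner_toL2 _ _).symm

theorem posDef_gramC_of (hτ : 1 < τ) {k : ℕ}
    (h : ∀ i j, i ≤ k → j ≤ k → ⟪toL2 μ (p i), toL2 μ (p j)⟫_ℂ = if i = j then 1 else 0) :
    (trunc (gramC τ (meanC μ) p) k).PosDef := by
  refine posDef_trunc (const_pos hτ) (fun i => toL2 μ (Xc * p i)) fun i j hi hj => ?_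
  rw [gramC_eq, inner_toL2_sqC_mul, h i j hi hj]
  simp

theorem inner_toL2_sum (w : ℕ → C(II, ℂ)) (x y : ℕ → ℂ) (l k : ℕ) :
    ⟪toL2 μ (∑ i ∈ Finset.range l, x i • w i),
      toL2 μ (sqC τ * ∑ j ∈ Finset.range k, y j • w j)⟫_ℂ =
    ∑ i ∈ Finset.range l, ∑ j ∈ Finset.range k, conj (x i) * gramC τ (meanC μ) w i j * y j := by
  rw [Finset.mul_sum]
  simp only [map_sum, map_smul, mul_smul_comm, sum_inner, inner_sum, inner_smul_left,
    inner_smul_right, gramC_eq, Finset.mul_sum]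
  rw [Finset.sum_comm]
  refine Finset.sum_congr rfl fun i _ => Finset.sum_congr rfl fun j _ => ?_
  ring

/-- Even pairs reduce to half the indices by the isometry of composition with `π`, mixed pairs
cancel between the branches, and odd pairs become the weighted Gram matrix, which the Cholesky
columns orthonormalise. -/
theorem inner_fixed (h : IsRuelleEigenMeasure τ μ) (hp : stepC hτ (meanC μ) p = p) (l m : ℕ) :
    ⟪toL2 μ (p l), toL2 μ (p m)⟫_ℂ = if l = m then 1 else 0 := by
  have key : ∀ m, ∀ l ≤ m, ⟪toL2 μ (p l), toL2 μ (p m)⟫_ℂ = if l = m then 1 else 0 := by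
    intro m
    induction m using Nat.strong_induction_on with
    | _ m ih =>
      intro l hl
      -- Positive definiteness of a block requires orthonormality of its own indices only, which the
      -- induction already provides.
      have hpd : ∀ k, k < m → (trunc (gramC τ (meanC μ) p) k).PosDef := fun k hk => by
        refine posDef_gramC_of hτ fun i j hi hj => ?_
        rcases le_total i j with hij | hij
        · exact ih j (by omega) i hij
        · rw [← inner_conj_symm, ih i (by omega) j hij]
          by_cases hh : i = j
          · simp [hh]
          · rw [if_neg hh, if_neg (Ne.symm hh), map_zero]
      rcases Nat.even_or_odd' m with ⟨k, rfl | rfl⟩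
      · rcases Nat.even_or_odd' l with ⟨i, rfl | rfl⟩
        · rw [fixed_even hp, fixed_even hp, inner_toL2_comp hτ h]
          rcases Nat.eq_zero_or_pos k with rfl | hk
          · have : i = 0 := by omega
            subst this
            rw [if_pos rfl, fixed_zero hp, inner_toL2, star_one, one_mul]
            exact meanC_const (1 : ℂ)
          · rw [ih k (by omega) i (by omega)]
            simp
        · rw [fixed_even hp, fixed_odd hp, if_neg (by omega), ← inner_conj_symm,
            inner_toL2_comp_odd hτ h, map_zero]
      · rcases Nat.even_or_odd' l with ⟨i, rfl | rfl⟩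
        · rw [fixed_even hp, fixed_odd hp, if_neg (by omega), inner_toL2_comp_odd hτ h]
        · rw [fixed_odd hp, fixed_odd hp, inner_toL2_odd_odd hτ h, cholSum, cholSum,
            inner_toL2_sum, cholCol_orthonormal (hpd k (by omega)) (by omega)]
          simp
  rcases le_total l m with hlm | hlm
  · exact key m l hlm
  · rw [← inner_conj_symm, key l m hlm]
    by_cases hh : l = m
    · simp [hh]
    · rw [if_neg hh, if_neg (Ne.symm hh), map_zero]

theorem posDef_gramC (h : IsRuelleEigenMeasure τ μ) (hp : stepC hτ (meanC μ) p = p) (k : ℕ) :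
    (trunc (gramC τ (meanC μ) p) k).PosDef :=
  posDef_gramC_of hτ fun i j _ _ => inner_fixed h hp i j

theorem comp_mem_span (hp : stepC hτ (meanC μ) p = p) {u : C(II, ℂ)}
    (hu : u ∈ Submodule.span ℂ (range p)) : u.comp (piI hτ) ∈ Submodule.span ℂ (range p) := by
  induction hu using Submodule.span_induction with
  | mem x hx =>
    obtain ⟨k, rfl⟩ := hx
    rw [← fixed_even hp]
    exact Submodule.subset_span ⟨_, rfl⟩
  | zero => exact Submodule.zero_mem _
  | add x y _ _ hx hy => exact Submodule.add_mem _ hx hy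
  | smul c x _ hx => exact Submodule.smul_mem _ c hx

theorem oddC_mul_comp_mem_span (h : IsRuelleEigenMeasure τ μ) (hp : stepC hτ (meanC μ) p = p)
    {u : C(II, ℂ)} (hu : u ∈ Submodule.span ℂ (range p)) :
    oddC hτ * u.comp (piI hτ) ∈ Submodule.span ℂ (range p) := by
  induction hu using Submodule.span_induction with
  | mem x hx =>
    obtain ⟨k, rfl⟩ := hx
    refine mem_span_of_triangular (fun k => (cholCol_self_pos (posDef_gramC h hp k)).ne')
      (fun j => oddC hτ * (p j).comp (piI hτ)) (fun k => ?_) k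
    have : ∑ j ∈ Finset.range (k + 1), cholCol (gramC τ (meanC μ) p) k j •
        (oddC hτ * (p j).comp (piI hτ)) = p (2 * k + 1) := by
      rw [fixed_odd hp, cholSum]
      ext x
      simp only [ContinuousMap.coe_sum, Finset.sum_apply, ContinuousMap.smul_apply,
        ContinuousMap.mul_apply, ContinuousMap.comp_apply, smul_eq_mul, Finset.mul_sum]
      refine Finset.sum_congr rfl fun j _ => ?_
      ring
    rw [this]
    exact Submodule.subset_span ⟨_, rfl⟩
  | zero =>
    rw [show (0 : C(II, ℂ)).comp (piI hτ) = 0 from rfl, mul_zero]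
    exact Submodule.zero_mem _
  | add x y _ _ hx hy =>
    rw [show (x + y).comp (piI hτ) = x.comp (piI hτ) + y.comp (piI hτ) from rfl, mul_add]
    exact Submodule.add_mem _ hx hy
  | smul c x _ hx =>
    rw [show (c • x).comp (piI hτ) = c • x.comp (piI hτ) from rfl, mul_smul_comm]
    exact Submodule.smul_mem _ c hx

/-! ### Completeness by induction on the degree -/

/-- Polynomials of degree less than `m`. -/
def polyLT (m : ℕ) : Submodule ℂ C(II, ℂ) := Submodule.span ℂ ((fun j => Xc ^ j) '' Iio m)

theorem pow_mem_polyLT {j m : ℕ} (h : j < m) : Xc ^ j ∈ polyLT m :=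
  Submodule.subset_span ⟨j, h, rfl⟩

theorem polyLT_mono {m n : ℕ} (h : m ≤ n) : polyLT m ≤ polyLT n :=
  Submodule.span_mono (image_mono (Iio_subset_Iio h))

theorem Xc_mul_mem_polyLT {m : ℕ} {a : C(II, ℂ)} (h : a ∈ polyLT m) : Xc * a ∈ polyLT (m + 1) := by
  induction h using Submodule.span_induction with
  | mem x hx =>
    obtain ⟨j, hj, rfl⟩ := hx
    dsimp only
    rw [← pow_succ']
    exact pow_mem_polyLT (Nat.succ_lt_succ hj)
  | zero => rw [mul_zero]; exact Submodule.zero_mem _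
  | add x y _ _ hx hy => rw [mul_add]; exact Submodule.add_mem _ hx hy
  | smul c x _ hx => rw [mul_smul_comm]; exact Submodule.smul_mem _ c hx

/-- With `t = 1/(2τ)` and `ω` the odd factor, `v = t(ω + π)` and, on the Cantor set, `ω² = π² +
4τ(τ-1)`. Multiplication by `v` sends the leading coefficients `(α, β)` to `(t(α+β), t(α+β))`; as `t
< 1/2`, the bounds persist. -/
theorem exists_pow_decomposition (hτ : 1 < τ) (m : ℕ) : ∃ α β : ℝ, 0 ≤ α ∧ 0 ≤ β ∧ α < 1 ∧
    α + β ≤ 1 ∧ ∃ a ∈ polyLT (m + 1), ∃ b ∈ polyLT m, ∀ x ∈ cantor hτ,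
      (Xc ^ (m + 1)) x = ((α : ℂ) • Xc ^ (m + 1) + a) (piI hτ x) +
        oddC hτ x * ((β : ℂ) • Xc ^ m + b) (piI hτ x) := by
  have hτ0 : (τ : ℂ) ≠ 0 := Complex.ofReal_ne_zero.2 (by linarith)
  set t : ℝ := 1 / (2 * τ) with ht
  have ht0 : 0 < t := by positivity
  have ht1 : t < 1 / 2 := by
    rw [ht, div_lt_div_iff₀ (by linarith) (by norm_num)]; linarith
  have hX : ∀ x, Xc x = (t : ℂ) * (oddC hτ x + Xc (piI hτ x)) := by
    intro x
    simp only [oddC, ContinuousMap.sub_apply, ContinuousMap.smul_apply, ContinuousMap.comp_apply,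
      smul_eq_mul, sub_add_cancel, ht]
    push_cast
    field_simp
  induction m with
  | zero =>
    refine ⟨t, t, ht0.le, ht0.le, by linarith, by linarith, 0, Submodule.zero_mem _, 0,
      Submodule.zero_mem _, fun x _ => ?_⟩
    simp only [zero_add, pow_one, pow_zero, add_zero, ContinuousMap.smul_apply, smul_eq_mul,
      ContinuousMap.one_apply, mul_one]
    rw [hX x]; ring
  | succ m ih =>
    obtain ⟨α, β, hα, hβ, -, hαβ, a, ha, b, hb, hab⟩ := ih
    refine ⟨t * (α + β), t * (α + β), by positivity, by positivity, by nlinarith, by nlinarith,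
      (t : ℂ) • (Xc * a + (((4 * τ * (τ - 1) : ℝ) : ℂ) * β) • Xc ^ m + Xc * (Xc * b) +
        ((4 * τ * (τ - 1) : ℝ) : ℂ) • b), ?_, (t : ℂ) • (a + Xc * b), ?_, fun x hx => ?_⟩
    · refine Submodule.smul_mem _ _ (Submodule.add_mem _ (Submodule.add_mem _ (Submodule.add_mem _
        (Xc_mul_mem_polyLT ha) (Submodule.smul_mem _ _ (pow_mem_polyLT (by omega))))
        (Xc_mul_mem_polyLT (Xc_mul_mem_polyLT hb))) (Submodule.smul_mem _ _ ?_))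
      exact polyLT_mono (by omega) hb
    · exact Submodule.smul_mem _ _ (Submodule.add_mem _ ha (Xc_mul_mem_polyLT hb))
    · have h1 := hab x hx
      have h2 := oddC_mul_self hτ (le_abs_of_mem_cantor hτ hx)
      rw [pow_succ', ContinuousMap.mul_apply, h1, hX x]
      simp only [sqC, ContinuousMap.add_apply, ContinuousMap.smul_apply, ContinuousMap.mul_apply,
        ContinuousMap.pow_apply, smul_eq_mul, ContinuousMap.one_apply] at h2 ⊢
      push_cast at h2 ⊢
      linear_combination (t : ℂ) * (β * Xc (piI hτ x) ^ m + b (piI hτ x)) * h2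

/-- With `Q` the projection onto the orthogonal complement of the closed span, composition with `π`
does not increase `‖Q f‖`. The decomposition of powers then bounds `‖Q v^{m+1}‖` by `α < 1` times
itself, and density of polynomials finishes. -/
theorem span_toL2_fixed (h : IsRuelleEigenMeasure τ μ) (hp : stepC hτ (meanC μ) p = p) :
    ⊤ ≤ (Submodule.span ℂ (range fun k => toL2 μ (p k))).topologicalClosure := by
  set S := (Submodule.span ℂ (range fun k => toL2 μ (p k))).topologicalClosure with hS
  have hScl : IsClosed (S : Set (Lp ℂ 2 μ)) := Submodule.isClosed_topologicalClosure _
  have : CompleteSpace S := hScl.completeSpace_coe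
  have hmem : ∀ w ∈ Submodule.span ℂ (range p), toL2 μ w ∈ S := by
    intro w hw
    have h1 : Submodule.span ℂ (range p) ≤
        (Submodule.span ℂ (range fun k => toL2 μ (p k))).comap (toL2 μ).toLinearMap := by
      rw [Submodule.span_le]
      rintro _ ⟨k, rfl⟩
      exact Submodule.subset_span ⟨k, rfl⟩
    exact Submodule.le_topologicalClosure _ (h1 hw)
  have happ : ∀ s ∈ S, ∀ ε > 0, ∃ w ∈ Submodule.span ℂ (range p), ‖s - toL2 μ w‖ ≤ ε := by
    intro s hs ε hε
    rw [hS, ← SetLike.mem_coe, Submodule.topologicalClosure_coe, Metric.mem_closure_iff] at hs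
    obtain ⟨y, hy, hsy⟩ := hs ε hε
    have h1 : y ∈ (Submodule.span ℂ (range p)).map (toL2 μ).toLinearMap := by
      rw [Submodule.map_span, ← range_comp]
      exact hy
    obtain ⟨w, hw, rfl⟩ := h1
    refine ⟨w, hw, ?_⟩
    rw [← dist_eq_norm]; exact hsy.le
  set Q := Sᗮ.starProjection with hQ
  have hQS : ∀ s ∈ S, Q s = 0 := fun s hs =>
    (Submodule.starProjection_apply_eq_zero_iff _).2 (Submodule.le_orthogonal_orthogonal S hs)
  have hQ1 : ∀ x, ‖Q x‖ ≤ ‖x‖ := fun x => Sᗮ.norm_starProjection_apply_le x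
  have hS0 : ∀ x, Q x = 0 → x ∈ S := by
    intro x hx
    have := (Submodule.starProjection_apply_eq_zero_iff _).1 hx
    rwa [Submodule.orthogonal_orthogonal] at this
  have hQd : ∀ x, x - Q x ∈ S := fun x => hS0 _ (by
    rw [map_sub, sub_eq_zero]
    exact (Submodule.starProjection_eq_self_iff.2 (Submodule.starProjection_apply_mem _ _)).symm)
  -- A map that preserves the span and is bounded by `C` stays bounded by `C` modulo the closed
  -- span: subtract from `f` an element of the span close to `f - Qf`. The denominator `C + 1`
  -- covers `C = 0`.
  have hcontr : ∀ (R : C(II, ℂ) → C(II, ℂ)) (C : ℝ), 0 ≤ C →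
      (∀ f g, R (f - g) = R f - R g) →
      (∀ w ∈ Submodule.span ℂ (range p), R w ∈ Submodule.span ℂ (range p)) →
      (∀ f, ‖toL2 μ (R f)‖ ≤ C * ‖toL2 μ f‖) →
      ∀ f, ‖Q (toL2 μ (R f))‖ ≤ C * ‖Q (toL2 μ f)‖ := by
    intro R C hC hsub hR hn f
    refine le_of_forall_pos_le_add fun ε hε => ?_
    obtain ⟨w, hw, hws⟩ := happ _ (hQd (toL2 μ f)) (ε / (C + 1)) (by positivity)
    have h1 : Q (toL2 μ (R f)) = Q (toL2 μ (R (f - w))) := by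
      rw [hsub, map_sub, map_sub, hQS _ (hmem _ (hR w hw)), sub_zero]
    have h2 : ‖toL2 μ (f - w)‖ ≤ ‖Q (toL2 μ f)‖ + ε / (C + 1) := by
      have : toL2 μ (f - w) = Q (toL2 μ f) + (toL2 μ f - Q (toL2 μ f) - toL2 μ w) := by
        rw [map_sub]; abel
      rw [this]
      exact (norm_add_le _ _).trans (by gcongr)
    rw [h1]
    refine ((hQ1 _).trans (hn _)).trans ((mul_le_mul_of_nonneg_left h2 hC).trans ?_)
    rw [mul_add]
    gcongr
    rw [mul_div_assoc', div_le_iff₀ (by positivity)]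
    nlinarith
  have hcomp : ∀ f : C(II, ℂ), ‖Q (toL2 μ (f.comp (piI hτ)))‖ ≤ ‖Q (toL2 μ f)‖ := by
    intro f
    have := hcontr (fun f => f.comp (piI hτ)) 1 zero_le_one (fun _ _ => rfl)
      (fun w hw => comp_mem_span hp hw) (fun f => by rw [one_mul, norm_toL2_comp hτ h]) f
    rwa [one_mul] at this
  have hodd : ∀ f : C(II, ℂ), toL2 μ f ∈ S → toL2 μ (oddC hτ * f.comp (piI hτ)) ∈ S := by
    intro f hf
    have := hcontr (fun f => oddC hτ * f.comp (piI hτ)) ‖oddC hτ‖ (norm_nonneg _)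
      (fun f g => by
        rw [show (f - g).comp (piI hτ) = f.comp (piI hτ) - g.comp (piI hτ) from rfl, mul_sub])
      (fun w hw => oddC_mul_comp_mem_span h hp hw)
      (fun f => by rw [← norm_toL2_comp hτ h f]; exact norm_toL2_mul_le _ _) f
    rw [hQS _ hf, norm_zero, mul_zero] at this
    exact hS0 _ (norm_le_zero_iff.1 this)
  have hpoly : ∀ m, toL2 μ (Xc ^ m) ∈ S := by
    intro m
    induction m using Nat.strong_induction_on with
    | _ m ih =>
      rcases Nat.eq_zero_or_pos m with rfl | hm
      · rw [pow_zero, ← fixed_zero hp]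
        exact hmem _ (Submodule.subset_span ⟨0, rfl⟩)
      obtain ⟨m, rfl⟩ := Nat.exists_eq_succ_of_ne_zero hm.ne'
      rw [Nat.succ_eq_add_one] at *
      have hlt : ∀ a ∈ polyLT (m + 1), toL2 μ a ∈ S := by
        intro a ha
        have : polyLT (m + 1) ≤ S.comap (toL2 μ).toLinearMap := by
          rw [polyLT, Submodule.span_le]
          rintro _ ⟨j, hj, rfl⟩
          exact ih j hj
        exact this ha
      obtain ⟨α, β, hα, -, hα1, -, a, ha, b, hb, hab⟩ := exists_pow_decomposition hτ m
      have e : toL2 μ (Xc ^ (m + 1)) = (α : ℂ) • toL2 μ ((Xc ^ (m + 1)).comp (piI hτ)) +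
          (toL2 μ (a.comp (piI hτ)) +
            toL2 μ (oddC hτ * ((β : ℂ) • Xc ^ m + b).comp (piI hτ))) := by
        rw [← map_smul, ← map_add, ← map_add]
        refine toL2_congr hτ h fun x hx => ?_
        rw [hab x hx]
        simp only [ContinuousMap.add_apply, ContinuousMap.smul_apply, ContinuousMap.mul_apply,
          ContinuousMap.comp_apply]
        ring
      have h1 : toL2 μ (a.comp (piI hτ)) ∈ S := by
        refine hS0 _ (norm_le_zero_iff.1 ((hcomp a).trans ?_))
        rw [hQS _ (hlt a ha), norm_zero]
      have h2 : toL2 μ (oddC hτ * ((β : ℂ) • Xc ^ m + b).comp (piI hτ)) ∈ S :=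
        hodd _ (hlt _ (Submodule.add_mem _ (Submodule.smul_mem _ _ (pow_mem_polyLT (by omega)))
          (polyLT_mono (by omega) hb)))
      have h3 : ‖Q (toL2 μ (Xc ^ (m + 1)))‖ ≤ α * ‖Q (toL2 μ (Xc ^ (m + 1)))‖ := by
        conv_lhs => rw [e, map_add, hQS _ (S.add_mem h1 h2), add_zero, map_smul, norm_smul,
          Complex.norm_real, Real.norm_of_nonneg hα]
        exact mul_le_mul_of_nonneg_left (hcomp _) hα
      refine hS0 _ (norm_le_zero_iff.1 ?_)
      nlinarith [norm_nonneg (Q (toL2 μ (Xc ^ (m + 1))))]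
  have hall : ∀ f : C(II, ℂ), toL2 μ f ∈ S := by
    have : (⊤ : Submodule ℂ C(II, ℂ)) ≤ S.comap (toL2 μ).toLinearMap := by
      rw [← span_pow_Xc_closure]
      refine Submodule.topologicalClosure_minimal _ (Submodule.span_le.2 ?_) ?_
      · rintro _ ⟨n, rfl⟩; exact hpoly n
      · exact hScl.preimage (toL2 μ).continuous
    exact fun f => this trivial
  intro x _
  have := (toL2_denseRange h).closure_range
  have h2 : x ∈ closure (range (toL2 μ)) := by rw [this]; trivial
  exact closure_minimal (by rintro _ ⟨f, rfl⟩; exact hall f) hScl h2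

end Basis

/-! ### Multiplication operators -/

section Multiplication

variable {τ : ℝ} (μ : Measure ℝ) [IsProbabilityMeasure μ]

/-- Multiplication by a continuous function on `L²(μ)`. -/
def mulL2 (g : C(II, ℂ)) : Lp ℂ 2 μ →L[ℂ] Lp ℂ 2 μ :=
  (ContinuousLinearMap.mul ℂ ℂ).holderL μ ⊤ 2 2
    (BoundedContinuousFunction.toLp (⊤ : ENNReal) μ ℂ (extC g))

variable {μ}

theorem coeFn_mulL2 (g : C(II, ℂ)) (f : Lp ℂ 2 μ) :
    (mulL2 μ g f : ℝ → ℂ) =ᵐ[μ] fun x => extC g x * f x := by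
  have h1 := ContinuousLinearMap.coeFn_holder (r := 2) (ContinuousLinearMap.mul ℂ ℂ)
    (BoundedContinuousFunction.toLp (⊤ : ENNReal) μ ℂ (extC g)) f
  have h2 := BoundedContinuousFunction.coeFn_toLp (⊤ : ENNReal) μ ℂ (extC g)
  filter_upwards [h1, h2] with x h1 h2
  rw [← h2]
  exact h1

theorem mulL2_toL2 (g f : C(II, ℂ)) : mulL2 μ g (toL2 μ f) = toL2 μ (g * f) := by
  refine Lp.ext ?_
  filter_upwards [coeFn_mulL2 g (toL2 μ f), coeFn_toL2 μ f, coeFn_toL2 μ (g * f)] with x h1 h2 h3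
  rw [h1, h2, h3]
  rfl

theorem mulL2_add (f g : C(II, ℂ)) : mulL2 μ (f + g) = mulL2 μ f + mulL2 μ g := by
  ext1 u
  refine Lp.ext ?_
  filter_upwards [coeFn_mulL2 (f + g) u, coeFn_mulL2 f u, coeFn_mulL2 g u,
    Lp.coeFn_add (mulL2 μ f u) (mulL2 μ g u)] with x h1 h2 h3 h4
  change _ = (mulL2 μ f u + mulL2 μ g u : Lp ℂ 2 μ) x
  rw [h4, h1, Pi.add_apply, h2, h3, ← add_mul]
  rfl

theorem mulL2_mul (f g : C(II, ℂ)) (u : Lp ℂ 2 μ) :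
    mulL2 μ (f * g) u = mulL2 μ f (mulL2 μ g u) := by
  refine Lp.ext ?_
  filter_upwards [coeFn_mulL2 (f * g) u, coeFn_mulL2 f (mulL2 μ g u),
    coeFn_mulL2 g u] with x h1 h2 h3
  rw [h1, h2, h3, ← mul_assoc]
  rfl

theorem mulL2_const (c : ℂ) (u : Lp ℂ 2 μ) : mulL2 μ (ContinuousMap.const II c) u = c • u := by
  refine Lp.ext ?_
  filter_upwards [coeFn_mulL2 (ContinuousMap.const II c) u, Lp.coeFn_smul c u] with x h1 h2
  rw [h1, h2]
  rfl

theorem mulL2_congr (hτ : 1 < τ) (h : IsRuelleEigenMeasure τ μ) {f g : C(II, ℂ)}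
    (hfg : ∀ x ∈ cantor hτ, f x = g x) : mulL2 μ f = mulL2 μ g := by
  ext1 u
  refine Lp.ext ?_
  filter_upwards [coeFn_mulL2 f u, coeFn_mulL2 g u, ae_cantor hτ h] with x h1 h2 hx
  obtain ⟨y, hy, rfl⟩ := hx
  rw [h1, h2, extC_coe, extC_coe, hfg y hy]

theorem inner_mulL2 (f : C(II, ℂ)) (u v : Lp ℂ 2 μ) :
    ⟪mulL2 μ f u, v⟫_ℂ = ⟪u, mulL2 μ (star f) v⟫_ℂ := by
  rw [L2.inner_def, L2.inner_def]
  refine integral_congr_ae ?_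
  filter_upwards [coeFn_mulL2 f u, coeFn_mulL2 (star f) v] with x h1 h2
  rw [h1, h2, RCLike.inner_apply, RCLike.inner_apply, map_mul]
  change _ * (conj (extC f x) * _) = conj (extC f x) * _ * _
  ring

variable (b : HilbertBasis ℕ ℂ (Lp ℂ 2 μ))

/-- Multiplication operators in the matrix representation given by a Hilbert basis. -/
def mulOp : C(II, ℂ) →ₐ[ℂ] Op where
  toFun g := b.repr.toContinuousLinearEquiv.toContinuousLinearMap.comp
    ((mulL2 μ g).comp b.repr.symm.toContinuousLinearEquiv.toContinuousLinearMap)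
  map_one' := by
    ext1 x
    have : mulL2 μ 1 (b.repr.symm x) = b.repr.symm x := by
      have := mulL2_const 1 (b.repr.symm x)
      rwa [one_smul] at this
    change b.repr (mulL2 μ 1 (b.repr.symm x)) = x
    rw [this, b.repr.apply_symm_apply]
  map_zero' := by
    ext1 x
    have : mulL2 μ 0 (b.repr.symm x) = 0 := by
      have := mulL2_const 0 (b.repr.symm x)
      rwa [zero_smul] at this
    change b.repr (mulL2 μ 0 (b.repr.symm x)) = 0
    rw [this, map_zero]
  map_add' f g := by
    ext1 x
    change b.repr (mulL2 μ (f + g) (b.repr.symm x)) =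
      b.repr (mulL2 μ f (b.repr.symm x)) + b.repr (mulL2 μ g (b.repr.symm x))
    rw [mulL2_add, ← map_add]; rfl
  map_mul' f g := by
    ext1 x
    change b.repr (mulL2 μ (f * g) (b.repr.symm x)) =
      b.repr (mulL2 μ f (b.repr.symm (b.repr (mulL2 μ g (b.repr.symm x)))))
    rw [mulL2_mul, b.repr.symm_apply_apply]
  commutes' c := by
    ext1 x
    have := mulL2_const c (b.repr.symm x)
    change b.repr (mulL2 μ (algebraMap ℂ C(II, ℂ) c) (b.repr.symm x)) = c • x
    rw [show algebraMap ℂ C(II, ℂ) c = ContinuousMap.const II c from rfl, this, map_smul,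
      b.repr.apply_symm_apply]

theorem mulOp_apply (g : C(II, ℂ)) (x : HalfAxis) :
    mulOp b g x = b.repr (mulL2 μ g (b.repr.symm x)) := rfl

theorem mulOp_congr (hτ : 1 < τ) (h : IsRuelleEigenMeasure τ μ) {f g : C(II, ℂ)}
    (hfg : ∀ x ∈ cantor hτ, f x = g x) : mulOp b f = mulOp b g := by
  ext1 x
  rw [mulOp_apply, mulOp_apply, mulL2_congr hτ h hfg]

theorem repr_symm_ket (k : ℕ) : b.repr.symm (ket k) = b k := b.repr_symm_single k

theorem mulOp_ket {p : ℕ → C(II, ℂ)} (hb : ∀ k, b k = toL2 μ (p k)) (g : C(II, ℂ)) (k : ℕ) :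
    mulOp b g (ket k) = b.repr (toL2 μ (g * p k)) := by
  rw [mulOp_apply, repr_symm_ket, hb, mulL2_toL2]

theorem star_mulOp (g : C(II, ℂ)) : star (mulOp b g) = mulOp b (star g) := by
  refine op_eq_of_entry fun i j => ?_
  rw [entry, entry, inner_star_right, mulOp_apply, mulOp_apply]
  rw [← b.repr.symm.inner_map_map, ← b.repr.symm.inner_map_map (ket i), b.repr.symm_apply_apply,
    b.repr.symm_apply_apply, inner_mulL2]

theorem isUnit_mulOp (hτ : 1 < τ) (h : IsRuelleEigenMeasure τ μ) {d : C(II, ℂ)}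
    (hd : ∀ x ∈ cantor hτ, d x ≠ 0) : IsUnit (mulOp b d) := by
  obtain ⟨δ, hδ, hδd⟩ : ∃ δ > 0, ∀ x ∈ cantor hτ, δ ≤ ‖d x‖ ^ 2 := by
    rcases (cantor hτ).eq_empty_or_nonempty with he | hne
    · exact ⟨1, one_pos, fun x hx => by rw [he] at hx; exact hx.elim⟩
    · obtain ⟨x, hx, hmin⟩ := (isClosed_cantor hτ).isCompact.exists_isMinOn hne
        (f := fun x => ‖d x‖ ^ 2) (by fun_prop)
      exact ⟨‖d x‖ ^ 2, by have := norm_pos_iff.2 (hd x hx); positivity, fun y hy => hmin hy⟩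
  -- A continuous function on the whole interval equal to `1/d` on the Cantor set, even if `d` has
  -- zeros elsewhere.
  let g : C(II, ℂ) := ⟨fun x => conj (d x) / ((max (‖d x‖ ^ 2) δ : ℝ) : ℂ), by
    refine Continuous.div (by fun_prop) (by fun_prop) fun x => ?_
    exact Complex.ofReal_ne_zero.2 (lt_max_of_lt_right hδ).ne'⟩
  have hg : ∀ x ∈ cantor hτ, (d * g) x = (1 : C(II, ℂ)) x := by
    intro x hx
    change d x * (conj (d x) / ((max (‖d x‖ ^ 2) δ : ℝ) : ℂ)) = 1
    rw [max_eq_left (hδd x hx), ← mul_div_assoc, Complex.mul_conj', ← Complex.ofReal_pow,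
      div_self]
    exact Complex.ofReal_ne_zero.2 (hδ.trans_le (hδd x hx)).ne'
  have h1 : mulOp b d * mulOp b g = 1 := by
    rw [← map_mul, mulOp_congr b hτ h hg, map_one]
  have h2 : mulOp b g * mulOp b d = 1 := by
    rw [← map_mul, mul_comm, mulOp_congr b hτ h hg, map_one]
  exact ⟨⟨_, _, h1, h2⟩, rfl⟩

end Multiplication

/-! ### The limit operator -/

section Limit

variable {τ : ℝ} {hτ : 1 < τ} {μ : Measure ℝ} [IsProbabilityMeasure μ] {p : ℕ → C(II, ℂ)}

/-- The Hilbert basis of `L²(μ)` given by the recursion. -/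
theorem exists_hilbertBasis_fixed (h : IsRuelleEigenMeasure τ μ)
    (hp : stepC hτ (meanC μ) p = p) :
    ∃ b : HilbertBasis ℕ ℂ (Lp ℂ 2 μ), ∀ k, b k = toL2 μ (p k) :=
  ⟨HilbertBasis.mk (orthonormal_iff_ite.2 (inner_fixed h hp)) (span_toL2_fixed h hp),
    fun k => congrFun (HilbertBasis.coe_mk _ _) k⟩

variable {b : HilbertBasis ℕ ℂ (Lp ℂ 2 μ)}

theorem inner_ket_repr (hb : ∀ k, b k = toL2 μ (p k)) (k : ℕ) (f : C(II, ℂ)) :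
    ⟪ket k, b.repr (toL2 μ f)⟫_ℂ = meanC μ (star (p k) * f) := by
  rw [← inner_toL2, ← hb, ← b.repr.inner_map_map, b.repr_self]
  rfl

theorem mulOp_ket_zero (h0 : p 0 = 1) (hb : ∀ k, b k = toL2 μ (p k)) (g : C(II, ℂ)) :
    mulOp b g (ket 0) = b.repr (toL2 μ g) := by
  rw [mulOp_ket b hb, h0, mul_one]

theorem entry_mulOp (hb : ∀ k, b k = toL2 μ (p k)) (g : C(II, ℂ)) (i j : ℕ) :
    entry (mulOp b g) i j = meanC μ (star (p i) * (g * p j)) := by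
  rw [entry, mulOp_ket b hb, inner_ket_repr hb]

theorem isSelfAdjoint_mulOp_Xc : IsSelfAdjoint (mulOp b Xc) := by
  rw [IsSelfAdjoint, star_mulOp, star_Xc]

theorem admissible_mulOp (hτ : 1 < τ) (h : IsRuelleEigenMeasure τ μ) (h0 : p 0 = 1)
    (hb : ∀ k, b k = toL2 μ (p k)) : Admissible (mulOp b Xc) where
  selfAdjoint := isSelfAdjoint_mulOp_Xc
  cyclic := by
    set S := (Submodule.span ℂ
      (range fun n : ℕ => ((mulOp b Xc) ^ n) (ket 0))).topologicalClosure with hS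
    have hScl : IsClosed (S : Set HalfAxis) := Submodule.isClosed_topologicalClosure _
    let R : C(II, ℂ) →L[ℂ] HalfAxis :=
      b.repr.toContinuousLinearEquiv.toContinuousLinearMap.comp (toL2 μ)
    have hR : ∀ f, R f ∈ S := by
      have : (⊤ : Submodule ℂ C(II, ℂ)) ≤ S.comap R.toLinearMap := by
        rw [← span_pow_Xc_closure]
        refine Submodule.topologicalClosure_minimal _ (Submodule.span_le.2 ?_) ?_
        · rintro _ ⟨n, rfl⟩
          refine Submodule.le_topologicalClosure _ (Submodule.subset_span ⟨n, ?_⟩)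
          dsimp only
          rw [← map_pow, mulOp_ket_zero h0 hb]
          rfl
        · exact hScl.preimage R.continuous
      exact fun f => this trivial
    have hd : DenseRange R :=
      b.repr.surjective.denseRange.comp (toL2_denseRange h) b.repr.continuous
    refine eq_top_iff.2 fun x _ => ?_
    exact closure_minimal (by rintro _ ⟨f, rfl⟩; exact hR f) hScl (hd x)
  spectrum_subset := by
    intro z hz
    by_contra hn
    refine hz ?_
    change IsUnit (algebraMap ℂ Op z - mulOp b Xc)
    rw [← (mulOp b).commutes, ← map_sub]
    refine isUnit_mulOp b hτ h fun x _ hx => hn ⟨x, x.2, ?_⟩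
    exact (sub_eq_zero.1 hx).symm

theorem shiftSq_mulOp : shiftSq τ (mulOp b Xc) = mulOp b (sqC τ) := by
  rw [shiftSq, sqC, map_add, map_pow, map_smul, map_one]

/-- The weighted Gram matrix of the `p_j` is the matrix of `A² + 4τ(τ-1)` in the basis they form, so
both sides are columns of the same inverse Cholesky factor. -/
theorem entry_inverse_limit (hτ : 1 < τ) (hb : ∀ k, b k = toL2 μ (p k)) (j k : ℕ) :
    entry (Ring.inverse (triangularFactor τ (mulOp b Xc))) j k =
      cholCol (gramC τ (meanC μ) p) k j := by
  rw [entry_inverse_triangularFactor hτ isSelfAdjoint_mulOp_Xc]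
  refine cholCol_congr (fun i l _ _ => ?_) j
  rw [shiftSq_mulOp, entry_mulOp hb]
  rfl

theorem isSpectralMeasure_mulOp (h : IsRuelleEigenMeasure τ μ) (h0 : p 0 = 1)
    (hb : ∀ k, b k = toL2 μ (p k)) : IsSpectralMeasure (mulOp b Xc) μ := by
  refine ⟨inferInstance, fun z hz => ?_⟩
  have hne : ∀ x : II, Xc x - z ≠ 0 := fun x hx => hz (by
    rw [← sub_eq_zero.1 hx]; exact Complex.ofReal_im _)
  let g : C(II, ℂ) := ⟨fun x => (Xc x - z)⁻¹, Continuous.inv₀ (by fun_prop) hne⟩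
  have h1 : (Xc - algebraMap ℂ C(II, ℂ) z) * g = 1 := by
    ext x
    exact mul_inv_cancel₀ (hne x)
  have hu := isUnit_sub_of_im_ne_zero (isSelfAdjoint_mulOp_Xc (b := b)) hz
  have h2 : (mulOp b Xc - algebraMap ℂ Op z) (mulOp b g (ket 0)) = ket 0 := by
    rw [← (mulOp b).commutes, ← map_sub]
    change (mulOp b (Xc - algebraMap ℂ C(II, ℂ) z) * mulOp b g) (ket 0) = ket 0
    rw [← map_mul, h1, map_one]; rfl
  rw [entry, inverse_apply_of_apply_eq hu h2]
  change _ = entry (mulOp b g) 0 0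
  rw [entry_mulOp hb, h0, star_one, one_mul, mul_one]
  refine integral_congr_ae ?_
  filter_upwards [h.ae_mem] with x hx
  lift x to II using hx
  rw [extC_coe]
  rfl

end Limit

/-! ### Convergence of the iterates -/

section Convergence

variable {τ : ℝ} (hτ : 1 < τ) {A : Op} (hA : Admissible A)

/-- The functions that represent the first basis vectors for the iterates of the transform. -/
def iterBasis : ℕ → ℕ → C(II, ℂ)
  | 0 => fun _ => 1
  | n + 1 => stepC hτ (stateOf (admissible_iterate hτ hA n)) (iterBasis n)

theorem iterBasis_zero (n : ℕ) : iterBasis hτ hA n 0 = 1 := by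
  cases n with
  | zero => rfl
  | succ n => exact stepC_zero hτ _ _

theorem fcalc_sqC {B : Op} (hB : Admissible B) : fcalc hB (sqC τ) = shiftSq τ B := by
  rw [sqC, map_add, map_pow, map_smul, map_one, fcalc_Xc, shiftSq]

/-- Both `2k` and `2k+1` go back to indices at most `k` one step earlier, and `k ≤ n` whenever the
index is at most `n + 1`. Even vectors come from composition with `π`; for odd ones the Cholesky
column computes `Φ⁻¹|k⟩`. -/
theorem vecOf_iterBasis (n : ℕ) : ∀ j ≤ n,
    vecOf (admissible_iterate hτ hA n) (iterBasis hτ hA n j) = ket j := by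
  induction n with
  | zero =>
    intro j hj
    obtain rfl : j = 0 := by omega
    exact vecOf_one _
  | succ n ih =>
    intro m hm
    set hB := admissible_iterate hτ hA n with hhB
    set q := iterBasis hτ hA n with hq
    have hstep : iterBasis hτ hA (n + 1) = stepC hτ (stateOf hB) q := rfl
    rw [hstep, ← vecOf_congr_op (admissible_renorm hτ hB) _
      (Function.iterate_succ_apply' (renorm τ) n A).symm]
    rcases Nat.even_or_odd' m with ⟨k, rfl | rfl⟩
    · rw [stepC_even hτ _ (iterBasis_zero hτ hA n), vecOf_renorm_comp hτ hB, ih k (by omega),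
        evenOp_ket]
    · rw [stepC_odd, vecOf_renorm_oddC_mul hτ hB, ← oddOp_ket,
        ← triangularFactor_apply_cholCol hτ hB.selfAdjoint k]
      congr 2
      rw [cholSum, map_sum]
      refine Finset.sum_congr rfl fun j hj => ?_
      rw [Finset.mem_range] at hj
      rw [map_smul, ih j (by omega)]
      congr 1
      refine cholCol_congr (fun i l hi hl => ?_) j
      rw [gramC, ← inner_vecOf, vecOf_mul, ih i (by omega), ih l (by omega), fcalc_sqC]
      rfl

variable {μ : Measure ℝ} [IsProbabilityMeasure μ]

/-- For fixed `g` the `n`-th functional is the initial one applied to `𝓛ⁿ g`, which tends to a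
constant; functionals bounded by the uniform norm tolerate a varying argument. -/
theorem tendsto_stateOf (h : IsRuelleEigenMeasure τ μ) {f : ℕ → C(II, ℂ)} {g : C(II, ℂ)}
    (hf : Tendsto f atTop (𝓝 g)) :
    Tendsto (fun n => stateOf (admissible_iterate hτ hA n) (f n)) atTop (𝓝 (meanC μ g)) := by
  obtain ⟨c, hc⟩ := exists_tendsto_ruelleC hτ g
  rw [meanC_eq_of_tendsto hτ h hc]
  have h1 : Tendsto (fun n => stateOf (admissible_iterate hτ hA n) g) atTop (𝓝 c) := by
    rw [tendsto_iff_norm_sub_tendsto_zero] at hc ⊢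
    refine squeeze_zero (fun _ => norm_nonneg _) (fun n => ?_) hc
    rw [stateOf_iterate hτ hA n g, ← stateOf_const hA c, ← stateOf_sub, stateOf_const]
    exact norm_stateOf_le hA _
  have h2 : Tendsto (fun n => stateOf (admissible_iterate hτ hA n) (f n - g)) atTop (𝓝 0) := by
    have h3 := tendsto_iff_norm_sub_tendsto_zero.1 hf
    exact squeeze_zero_norm (fun n => norm_stateOf_le _ _) h3
  have h4 := h1.add h2
  rw [add_zero] at h4
  refine h4.congr fun n => ?_
  rw [stateOf_sub, add_sub_cancel]

theorem continuous_comp_piI : Continuous fun f : C(II, ℂ) => f.comp (piI hτ) :=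
  ContinuousMap.continuous_precomp _

theorem continuous_star_C : Continuous fun f : C(II, ℂ) => star f := continuous_star

theorem tendsto_iterBasis (h : IsRuelleEigenMeasure τ μ) {p : ℕ → C(II, ℂ)}
    (hp : stepC hτ (meanC μ) p = p) (m : ℕ) :
    Tendsto (fun n => iterBasis hτ hA n m) atTop (𝓝 (p m)) := by
  induction m using Nat.strong_induction_on with
  | _ m ih =>
    rcases Nat.eq_zero_or_pos m with rfl | hm
    · simp only [iterBasis_zero, fixed_zero hp]
      exact tendsto_const_nhds
    refine (tendsto_add_atTop_iff_nat 1).1 ?_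
    simp only [iterBasis]
    rcases Nat.even_or_odd' m with ⟨k, rfl | rfl⟩
    · simp only [stepC_even hτ _ (iterBasis_zero hτ hA _), fixed_even hp]
      exact ((continuous_comp_piI hτ).tendsto _).comp (ih k (by omega))
    · simp only [stepC_odd, fixed_odd hp]
      refine tendsto_const_nhds.mul (((continuous_comp_piI hτ).tendsto _).comp ?_)
      refine tendsto_finsetSum _ fun j hj => ?_
      rw [Finset.mem_range] at hj
      refine Tendsto.smul (tendsto_cholCol (posDef_gramC h hp k) (fun i l hi hl => ?_) j)
        (ih j (by omega))
      exact tendsto_stateOf hτ hA h (((continuous_star_C.tendsto _).comp (ih i (by omega))).mul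
        (tendsto_const_nhds.mul (ih l (by omega))))

theorem tendsto_entry (hA : Admissible A) (h : IsRuelleEigenMeasure τ μ) {p : ℕ → C(II, ℂ)}
    (hp : stepC hτ (meanC μ) p = p) {b : HilbertBasis ℕ ℂ (Lp ℂ 2 μ)}
    (hb : ∀ k, b k = toL2 μ (p k)) (i j : ℕ) :
    Tendsto (fun n => entry ((renorm τ)^[n] A) i j) atTop (𝓝 (entry (mulOp b Xc) i j)) := by
  rw [entry_mulOp hb]
  have h1 := tendsto_stateOf hτ hA h
    (((continuous_star_C.tendsto _).comp (tendsto_iterBasis hτ hA h hp i)).mul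
        (tendsto_const_nhds (x := Xc) |>.mul (tendsto_iterBasis hτ hA h hp j)))
  refine h1.congr' ?_
  -- From here on the functions really represent both `|i⟩` and `|j⟩` for the `n`-th iterate.
  filter_upwards [eventually_ge_atTop (max i j)] with n hn
  dsimp only [Function.comp]
  rw [← inner_vecOf, vecOf_mul, fcalc_Xc, vecOf_iterBasis hτ hA n i (by omega),
    vecOf_iterBasis hτ hA n j (by omega)]
  rfl

theorem tendsto_functional {u : ℕ → HalfAxis →L[ℂ] ℂ} {v : HalfAxis →L[ℂ] ℂ} {C : ℝ}
    (hu : ∀ n, ‖u n‖ ≤ C) (hk : ∀ k, Tendsto (fun n => u n (ket k)) atTop (𝓝 (v (ket k))))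
    (x : HalfAxis) : Tendsto (fun n => u n x) atTop (𝓝 (v x)) := by
  have hspan : ∀ y ∈ Submodule.span ℂ (range ket), Tendsto (fun n => u n y) atTop (𝓝 (v y)) := by
    intro y hy
    induction hy using Submodule.span_induction with
    | mem x hx => obtain ⟨k, rfl⟩ := hx; exact hk k
    | zero => simp only [map_zero]; exact tendsto_const_nhds
    | add x y _ _ hx hy => simp only [map_add]; exact hx.add hy
    | smul c x _ hx => simp only [map_smul]; exact hx.const_smul c
  have hC : 0 ≤ C := (norm_nonneg _).trans (hu 0)
  rw [Metric.tendsto_atTop]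
  intro ε hε
  set D := C + ‖v‖ + 1 with hD
  have hD0 : 0 < D := by positivity
  have hx : x ∈ closure (Submodule.span ℂ (range ket) : Set HalfAxis) := by
    rw [← Submodule.topologicalClosure_coe, span_ket_closure]; trivial
  obtain ⟨y, hy, hxy⟩ := Metric.mem_closure_iff.1 hx (ε / (2 * D)) (by positivity)
  obtain ⟨N, hN⟩ := Metric.tendsto_atTop.1 (hspan y hy) (ε / 2) (by positivity)
  refine ⟨N, fun n hn => ?_⟩
  have h1 := hN n hn
  rw [dist_eq_norm] at h1 hxy ⊢
  have e : u n x - v x = u n (x - y) + (u n y - v y) - v (x - y) := by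
    rw [map_sub, map_sub]; ring
  have h2 : ‖u n (x - y)‖ ≤ C * ‖x - y‖ := (u n).le_of_opNorm_le (hu n) _
  have h3 : ‖v (x - y)‖ ≤ ‖v‖ * ‖x - y‖ := v.le_opNorm _
  have h4 : D * ‖x - y‖ < ε / 2 := by
    rw [lt_div_iff₀ (by positivity)] at hxy
    linarith
  rw [e]
  have h5 := norm_sub_le (u n (x - y) + (u n y - v y)) (v (x - y))
  have h6 := norm_add_le (u n (x - y)) (u n y - v y)
  have h7 := norm_nonneg (x - y)
  rw [hD] at h4
  nlinarith

/-- Convergence of entries plus the uniform bound on norms, extended by density first in the right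
vector and then, after conjugation, in the left one. -/
theorem tendsto_weak (hA : Admissible A) (h : IsRuelleEigenMeasure τ μ) {p : ℕ → C(II, ℂ)}
    (hp : stepC hτ (meanC μ) p = p) {b : HilbertBasis ℕ ℂ (Lp ℂ 2 μ)}
    (hb : ∀ k, b k = toL2 μ (p k)) (x y : HalfAxis) :
    Tendsto (fun n => ⟪x, ((renorm τ)^[n] A) y⟫_ℂ) atTop (𝓝 ⟪x, mulOp b Xc y⟫_ℂ) := by
  have hn : ∀ n, ‖(renorm τ)^[n] A‖ ≤ 1 := fun n => (admissible_iterate hτ hA n).norm_le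
  have hstep : ∀ k, Tendsto (fun n => ⟪ket k, ((renorm τ)^[n] A) y⟫_ℂ) atTop
      (𝓝 ⟪ket k, mulOp b Xc y⟫_ℂ) := by
    intro k
    refine tendsto_functional (u := fun n => (innerSL ℂ (ket k)).comp ((renorm τ)^[n] A))
      (v := (innerSL ℂ (ket k)).comp (mulOp b Xc)) (C := ‖innerSL ℂ (ket k)‖ * 1) (fun n => ?_)
      (fun j => tendsto_entry hτ hA h hp hb k j) y
    exact (ContinuousLinearMap.opNorm_comp_le _ _).trans
      (mul_le_mul_of_nonneg_left (hn n) (norm_nonneg _))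
  have hconj : Tendsto (fun n => ⟪((renorm τ)^[n] A) y, x⟫_ℂ) atTop (𝓝 ⟪mulOp b Xc y, x⟫_ℂ) := by
    refine tendsto_functional (u := fun n => innerSL ℂ (((renorm τ)^[n] A) y))
      (v := innerSL ℂ (mulOp b Xc y)) (C := 1 * ‖y‖) (fun n => ?_) (fun j => ?_) x
    · rw [innerSL_apply_norm]
      exact ContinuousLinearMap.le_of_opNorm_le _ (hn n) y
    · have := (Complex.continuous_conj.tendsto _).comp (hstep j)
      change Tendsto (fun n => ⟪((renorm τ)^[n] A) y, ket j⟫_ℂ) atTop (𝓝 ⟪mulOp b Xc y, ket j⟫_ℂ)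
      simpa only [Function.comp_def, inner_conj_symm] using this
  have := (Complex.continuous_conj.tendsto _).comp hconj
  simpa only [Function.comp_def, inner_conj_symm] using this

end Convergence

/-! ### Values of rational functions -/

/-- The rational function `r` has no pole at `z` and takes the value `w` there. -/
def HasVal (r : RatFunc ℂ) (z w : ℂ) : Prop :=
  r.denom.eval z ≠ 0 ∧ r.eval (RingHom.id ℂ) z = w

section Values

variable {r s : RatFunc ℂ} {z w v : ℂ}

theorem eval_ne_zero_of_dvd {P Q : Polynomial ℂ} (h : P ∣ Q) (hQ : Q.eval z ≠ 0) :
    P.eval z ≠ 0 := by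
  obtain ⟨R, rfl⟩ := h
  rw [Polynomial.eval_mul] at hQ
  exact left_ne_zero_of_mul hQ

theorem HasVal.mul (hr : HasVal r z w) (hs : HasVal s z v) : HasVal (r * s) z (w * v) := by
  refine ⟨eval_ne_zero_of_dvd (RatFunc.denom_mul_dvd r s) ?_, ?_⟩
  · rw [Polynomial.eval_mul]
    exact mul_ne_zero hr.1 hs.1
  · rw [RatFunc.eval_mul _ _ hr.1 hs.1, hr.2, hs.2]

theorem HasVal.add (hr : HasVal r z w) (hs : HasVal s z v) : HasVal (r + s) z (w + v) := by
  refine ⟨eval_ne_zero_of_dvd (RatFunc.denom_add_dvd r s) ?_, ?_⟩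
  · rw [Polynomial.eval_mul]
    exact mul_ne_zero hr.1 hs.1
  · rw [RatFunc.eval_add _ _ hr.1 hs.1, hr.2, hs.2]

theorem hasVal_C (c : ℂ) : HasVal (RatFunc.C c) z c := by
  refine ⟨?_, RatFunc.eval_C _ _⟩
  rw [RatFunc.denom_C, Polynomial.eval_one]
  exact one_ne_zero

theorem hasVal_X : HasVal RatFunc.X z z := by
  refine ⟨?_, RatFunc.eval_X _ _⟩
  rw [RatFunc.denom_X, Polynomial.eval_one]
  exact one_ne_zero

/-- The denominator of `r⁻¹` divides the numerator of `r`, which does not vanish at `z` because `w ≠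
0`. -/
theorem HasVal.inv (hr : HasVal r z w) (hw : w ≠ 0) : HasVal r⁻¹ z w⁻¹ := by
  have hnum : r.num.eval z ≠ 0 := by
    intro h
    refine hw ?_
    rw [← hr.2]
    change r.num.eval z / r.denom.eval z = 0
    rw [h, zero_div]
  have hd : r⁻¹.denom.eval z ≠ 0 := by
    refine eval_ne_zero_of_dvd ?_ hnum
    conv_lhs => rw [← RatFunc.num_div_denom r, inv_div]
    exact RatFunc.denom_div_dvd _ _
  have h0 : r ≠ 0 := by
    rintro rfl
    rw [RatFunc.num_zero, Polynomial.eval_zero] at hnum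
    exact hnum rfl
  refine ⟨hd, eq_inv_of_mul_eq_one_left ?_⟩
  rw [← hr.2, ← RatFunc.eval_mul _ _ hd hr.1, inv_mul_cancel₀ h0, RatFunc.eval_one]

theorem HasVal.div (hr : HasVal r z w) (hs : HasVal s z v) (hv : v ≠ 0) :
    HasVal (r / s) z (w / v) := by
  rw [div_eq_mul_inv, div_eq_mul_inv]
  exact hr.mul (hs.inv hv)

theorem hasVal_sum {f : ℕ → RatFunc ℂ} {g : ℕ → ℂ} {n : ℕ} (h : ∀ j < n, HasVal (f j) z (g j)) :
    HasVal (∑ j ∈ Finset.range n, f j) z (∑ j ∈ Finset.range n, g j) := by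
  induction n with
  | zero => simpa using hasVal_C (z := z) 0
  | succ n ih =>
    rw [Finset.sum_range_succ, Finset.sum_range_succ]
    exact (ih fun j hj => h j (by omega)).add (h n (by omega))

theorem HasVal.eval₂ (hs : HasVal s z v) (P : Polynomial ℂ) :
    HasVal (P.eval₂ RatFunc.C s) z (P.eval v) := by
  induction P using Polynomial.induction_on' with
  | add P Q hP hQ => rw [Polynomial.eval₂_add, Polynomial.eval_add]; exact hP.add hQ
  | monomial n a =>
    rw [Polynomial.eval₂_monomial, Polynomial.eval_monomial]
    refine (hasVal_C a).mul ?_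
    induction n with
    | zero => simpa using hasVal_C (z := z) 1
    | succ n ih => rw [pow_succ, pow_succ]; exact ih.mul hs

theorem HasVal.ratComp (hs : HasVal s z v) (hr : HasVal r v w) : HasVal (ratComp r s) z w := by
  rw [← hr.2]
  exact (hs.eval₂ _).div (hs.eval₂ _) hr.1

theorem hasVal_piRat {τ x : ℝ} (hx : x ≠ 0) : HasVal (piRat τ) x (piR τ x) := by
  have hx' : (x : ℂ) ≠ 0 := Complex.ofReal_ne_zero.2 hx
  have h := ((hasVal_C (τ : ℂ)).mul hasVal_X).add
    ((hasVal_C (-1)).mul ((hasVal_C ((τ - 1 : ℝ) : ℂ)).div hasVal_X hx'))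
  convert! h using 1
  · rw [piRat, map_neg, map_one, neg_one_mul, ← sub_eq_add_neg]
  · rw [piR]; push_cast; ring

theorem hasVal_oddRat {τ x : ℝ} (hx : x ≠ 0) :
    HasVal (oddRat τ) x ((2 * τ * x - piR τ x : ℝ) : ℂ) := by
  have hx' : (x : ℂ) ≠ 0 := Complex.ofReal_ne_zero.2 hx
  have h := ((hasVal_C (τ : ℂ)).mul hasVal_X).add
    ((hasVal_C ((τ - 1 : ℝ) : ℂ)).div hasVal_X hx')
  convert! h using 1
  rw [piR]; push_cast; ring

theorem ratComp_one (s : RatFunc ℂ) : ratComp 1 s = 1 := RatFunc.eval_one _ _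

end Values

/-! ### The system of rational functions -/

section System

variable {τ : ℝ} (hτ : 1 < τ)

theorem hasVal_piRat_of_mem_cantor {x : II} (hx : x ∈ cantor hτ) :
    HasVal (piRat τ) ((x : ℝ) : ℂ) ((piI hτ x : ℝ) : ℂ) := by
  have h := le_abs_of_mem_cantor hτ hx
  rw [coe_piI hτ h]
  exact hasVal_piRat (abs_pos.1 ((ratio_pos hτ).trans_le h))

theorem hasVal_oddRat_of_mem_cantor {x : II} (hx : x ∈ cantor hτ) :
    HasVal (oddRat τ) ((x : ℝ) : ℂ) (oddC hτ x) := by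
  have h := le_abs_of_mem_cantor hτ hx
  have e : oddC hτ x = ((2 * τ * (x : ℝ) - piR τ x : ℝ) : ℂ) := by
    rw [← coe_piI hτ h]
    simp only [oddC, ContinuousMap.sub_apply, ContinuousMap.smul_apply, ContinuousMap.comp_apply,
      smul_eq_mul, Xc_apply]
    push_cast
    rfl
  rw [e]
  exact hasVal_oddRat (abs_pos.1 ((ratio_pos hτ).trans_le h))

/-- The rational function `r` coincides with `f` on the invariant Cantor set. -/
def Represents (r : RatFunc ℂ) (f : C(II, ℂ)) : Prop :=
  ∀ x ∈ cantor hτ, HasVal r ((x : ℝ) : ℂ) (f x)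

variable {hτ}

theorem Represents.comp {r : RatFunc ℂ} {f : C(II, ℂ)} (h : Represents hτ r f) :
    Represents hτ (ratComp r (piRat τ)) (f.comp (piI hτ)) := fun _ hx =>
  (hasVal_piRat_of_mem_cantor hτ hx).ratComp (h _ (piI_mem_cantor hτ hx))

theorem represents_one : Represents hτ 1 1 := fun _ _ => by
  rw [← map_one RatFunc.C]
  exact hasVal_C 1

theorem represents_odd {e : ℕ → RatFunc ℂ} {p : ℕ → C(II, ℂ)} {k : ℕ}
    (h : ∀ j ≤ k, Represents hτ (e j) (p j)) (c : ℕ → ℂ) :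
    Represents hτ
      (oddRat τ * ∑ j ∈ Finset.range (k + 1), RatFunc.C (c j) * ratComp (e j) (piRat τ))
      (oddC hτ * (∑ j ∈ Finset.range (k + 1), c j • p j).comp (piI hτ)) := by
  intro x hx
  refine (hasVal_oddRat_of_mem_cantor hτ hx).mul ?_
  rw [ContinuousMap.comp_apply, ContinuousMap.coe_sum, Finset.sum_apply]
  exact hasVal_sum fun j hj => (hasVal_C (c j)).mul ((h j (by omega)).comp x hx)

variable {μ : Measure ℝ} [IsProbabilityMeasure μ]

theorem Represents.ae (hr : IsRuelleEigenMeasure τ μ) {r : RatFunc ℂ} {f : C(II, ℂ)}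
    (h : Represents hτ r f) : ratVal r =ᵐ[μ] extC f := by
  filter_upwards [ae_cantor hτ hr] with x hx
  obtain ⟨y, hy, rfl⟩ := hx
  rw [extC_coe]
  exact (h y hy).2

theorem Represents.ae_denom (hr : IsRuelleEigenMeasure τ μ) {r : RatFunc ℂ} {f : C(II, ℂ)}
    (h : Represents hτ r f) : ∀ᵐ x : ℝ ∂μ, r.denom.eval (x : ℂ) ≠ 0 := by
  filter_upwards [ae_cantor hτ hr] with x hx
  obtain ⟨y, hy, rfl⟩ := hx
  exact (h y hy).1

theorem Represents.integral (hr : IsRuelleEigenMeasure τ μ) {r s : RatFunc ℂ} {f g : C(II, ℂ)}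
    (hf : Represents hτ r f) (hg : Represents hτ s g) :
    ∫ x, conj (ratVal r x) * ratVal s x ∂μ = ⟪toL2 μ f, toL2 μ g⟫_ℂ := by
  rw [inner_toL2, meanC]
  refine integral_congr_ae ?_
  filter_upwards [hf.ae hr, hg.ae hr] with x h1 h2
  rw [h1, h2]
  rfl

/-- One step of the recursion for the rational functions. -/
def stepE (τ : ℝ) (c : ℕ → ℕ → ℂ) (e : ℕ → RatFunc ℂ) (m : ℕ) : RatFunc ℂ :=
  if m = 0 then 1
  else if Even m then ratComp (e (m / 2)) (piRat τ)
  else oddRat τ * ∑ j ∈ Finset.range (m / 2 + 1), RatFunc.C (c (m / 2) j) * ratComp (e j) (piRat τ)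

theorem exists_ratFunc_system (τ : ℝ) (c : ℕ → ℕ → ℂ) : ∃ e : ℕ → RatFunc ℂ, e 0 = 1 ∧
    (∀ k, e (2 * k) = ratComp (e k) (piRat τ)) ∧
    ∀ k, e (2 * k + 1) =
      oddRat τ * ∑ j ∈ Finset.range (k + 1), RatFunc.C (c k j) * ratComp (e j) (piRat τ) := by
  obtain ⟨e, he⟩ := exists_fixed_of_causal 1 (stepE τ c) fun p q m h => by
    rcases Nat.eq_zero_or_pos m with rfl | hm
    · rfl
    · have hlt : m / 2 < m := by omega
      rw [stepE, stepE, h _ hlt, Finset.sum_congr rfl fun j hj => ?_]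
      rw [Finset.mem_range] at hj
      rw [h j (by omega)]
  have h0 : e 0 = 1 := by rw [← he]; exact if_pos rfl
  refine ⟨e, h0, fun k => ?_, fun k => ?_⟩
  · rcases Nat.eq_zero_or_pos k with rfl | hk
    · rw [mul_zero, h0, ratComp_one]
    · conv_lhs => rw [← he, stepE, if_neg (by omega), if_pos (even_two_mul k),
        Nat.mul_div_cancel_left _ two_pos]
  · conv_lhs => rw [← he, stepE, if_neg (by omega), if_neg (by simp),
      show (2 * k + 1) / 2 = k by omega]

variable {p : ℕ → C(II, ℂ)}

theorem represents_fixed (hp : stepC hτ (meanC μ) p = p) {e : ℕ → RatFunc ℂ} (h0 : e 0 = 1)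
    (h2 : ∀ k, e (2 * k) = ratComp (e k) (piRat τ))
    (h1 : ∀ k, e (2 * k + 1) = oddRat τ * ∑ j ∈ Finset.range (k + 1),
      RatFunc.C (cholCol (gramC τ (meanC μ) p) k j) * ratComp (e j) (piRat τ)) (m : ℕ) :
    Represents hτ (e m) (p m) := by
  induction m using Nat.strong_induction_on with
  | _ m ih =>
    rcases Nat.eq_zero_or_pos m with rfl | hm
    · rw [h0, fixed_zero hp]
      exact represents_one
    rcases Nat.even_or_odd' m with ⟨k, rfl | rfl⟩
    · rw [h2, fixed_even hp]
      exact (ih k (by omega)).comp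
    · rw [h1, fixed_odd hp]
      exact represents_odd (fun j hj => ih j (by omega)) _

theorem isRenormSystem_cholCol (h : IsRuelleEigenMeasure τ μ) (hp : stepC hτ (meanC μ) p = p)
    {e : ℕ → RatFunc ℂ} (h0 : e 0 = 1) (h2 : ∀ k, e (2 * k) = ratComp (e k) (piRat τ))
    (h1 : ∀ k, e (2 * k + 1) = oddRat τ * ∑ j ∈ Finset.range (k + 1),
      RatFunc.C (cholCol (gramC τ (meanC μ) p) k j) * ratComp (e j) (piRat τ)) :
    IsRenormSystem τ μ e fun k j => cholCol (gramC τ (meanC μ) p) k j where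
  zero := h0
  even := h2
  odd := h1
  upper _ _ := cholCol_of_lt
  diag_pos k := cholCol_self_pos (posDef_gramC h hp k)
  orthonormal k l _ := by
    rw [(represents_fixed hp h0 h2 h1 l).integral h (represents_fixed hp h0 h2 h1 _),
      inner_fixed h hp]

/-- If a vector is orthogonal to triangular combinations with non-zero diagonal coefficients, then
it is orthogonal to the vectors that are combined. -/
theorem eq_zero_of_triangular {y : ℕ → ℂ} {x : ℕ → ℕ → ℂ} (hx : ∀ i, x i i ≠ 0) {k : ℕ}
    (h : ∀ i < k, ∑ j ∈ Finset.range (i + 1), x i j * y j = 0) : ∀ i < k, y i = 0 := by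
  intro i
  induction i using Nat.strong_induction_on with
  | _ i ih =>
    intro hi
    have h1 := h i hi
    rw [Finset.sum_range_succ, Finset.sum_eq_zero, zero_add] at h1
    · exact (mul_eq_zero.1 h1).resolve_left (hx i)
    · intro j hj
      rw [Finset.mem_range] at hj
      rw [ih j hj (by omega), mul_zero]

/-- Orthogonality to `e_{2i+1}` for `i < k` gives the Gram rows weighted by Cholesky columns; back
substitution frees the rows, and the characterisation of the column applies. Only indices up to `2k`
are assumed known, so that the induction for uniqueness can call this before `e_{2k+1}` is
identified. -/
theorem IsRenormSystem.eq_cholCol (h : IsRuelleEigenMeasure τ μ)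
    (hp : stepC hτ (meanC μ) p = p) {e : ℕ → RatFunc ℂ} {c : ℕ → ℕ → ℂ}
    (hs : IsRenormSystem τ μ e c) {k : ℕ} (hr : ∀ m ≤ 2 * k, Represents hτ (e m) (p m)) (j : ℕ) :
    c k j = cholCol (gramC τ (meanC μ) p) k j := by
  rcases lt_or_ge k j with hj | hj
  · rw [hs.upper k j hj, cholCol_of_lt hj]
  set G := gramC τ (meanC μ) p with hG
  have hrep : Represents hτ (e (2 * k + 1))
      (oddC hτ * (∑ j ∈ Finset.range (k + 1), c k j • p j).comp (piI hτ)) := by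
    rw [hs.odd]
    exact represents_odd (fun j hj => hr j (by omega)) _
  refine RationalRenorm.eq_cholCol (posDef_gramC h hp k) (hs.diag_pos k) ?_ ?_ hj
  · refine eq_zero_of_triangular (x := fun i l => conj (cholCol G i l)) (fun i => ?_) fun i hi => ?_
    · exact (map_ne_zero _).2 (cholCol_self_pos (posDef_gramC h hp i)).ne'
    · have h1 := hs.orthonormal k (2 * i + 1) (by omega)
      rw [if_neg (by omega), (hr (2 * i + 1) (by omega)).integral h hrep, fixed_odd hp, cholSum,
        inner_toL2_odd_odd hτ h, inner_toL2_sum] at h1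
      rw [← h1]
      simp only [Finset.mul_sum, mul_assoc]
      rfl
  · have h1 := hs.orthonormal k (2 * k + 1) le_rfl
    rwa [if_pos rfl, hrep.integral h hrep, inner_toL2_odd_odd hτ h, inner_toL2_sum] at h1

theorem IsRenormSystem.unique (h : IsRuelleEigenMeasure τ μ) (hp : stepC hτ (meanC μ) p = p)
    {e e' : ℕ → RatFunc ℂ} {c' : ℕ → ℕ → ℂ} (hr : ∀ m, Represents hτ (e m) (p m))
    (hs : IsRenormSystem τ μ e fun k j => cholCol (gramC τ (meanC μ) p) k j)
    (hs' : IsRenormSystem τ μ e' c') :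
    e' = e ∧ c' = fun k j => cholCol (gramC τ (meanC μ) p) k j := by
  have key : ∀ m, e' m = e m := by
    intro m
    induction m using Nat.strong_induction_on with
    | _ m ih =>
      rcases Nat.eq_zero_or_pos m with rfl | hm
      · rw [hs.zero, hs'.zero]
      rcases Nat.even_or_odd' m with ⟨k, rfl | rfl⟩
      · rw [hs.even, hs'.even, ih k (by omega)]
      · rw [hs.odd, hs'.odd]
        congr 1
        refine Finset.sum_congr rfl fun j hj => ?_
        rw [Finset.mem_range] at hj
        rw [ih j (by omega),
          hs'.eq_cholCol h hp (fun m hm => by rw [ih m (by omega)]; exact hr m) j]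
  refine ⟨funext key, funext fun k => funext fun j => ?_⟩
  exact hs'.eq_cholCol h hp (fun m _ => by rw [key]; exact hr m) j

/-! ### Rational functions of the limit operator -/

theorem aeval_Xc_apply (P : Polynomial ℂ) (x : II) :
    Polynomial.aeval Xc P x = P.eval ((x : ℝ) : ℂ) := by
  induction P using Polynomial.induction_on' with
  | add P Q hP hQ => rw [map_add, ContinuousMap.add_apply, hP, hQ, Polynomial.eval_add]
  | monomial n a =>
    rw [Polynomial.aeval_monomial, Polynomial.eval_monomial]
    rfl

variable {b : HilbertBasis ℕ ℂ (Lp ℂ 2 μ)} {r : RatFunc ℂ} {f : C(II, ℂ)}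

theorem Represents.isUnit_aeval_denom (h : IsRuelleEigenMeasure τ μ) (hr : Represents hτ r f) :
    IsUnit (Polynomial.aeval (mulOp b Xc) r.denom) := by
  rw [Polynomial.aeval_algHom_apply]
  refine isUnit_mulOp b hτ h fun x hx => ?_
  rw [aeval_Xc_apply]
  exact (hr x hx).1

/-- On the Cantor set the numerator is `f` times the denominator, and multiplication operators
depend only on values there. -/
theorem Represents.ratOp_mulOp (h : IsRuelleEigenMeasure τ μ) (hr : Represents hτ r f) :
    ratOp r (mulOp b Xc) = mulOp b f := by
  have hu := hr.isUnit_aeval_denom (b := b) h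
  rw [ratOp]
  have e : Polynomial.aeval (mulOp b Xc) r.num =
      mulOp b f * Polynomial.aeval (mulOp b Xc) r.denom := by
    rw [Polynomial.aeval_algHom_apply, Polynomial.aeval_algHom_apply, ← map_mul]
    refine mulOp_congr b hτ h fun x hx => ?_
    rw [ContinuousMap.mul_apply, aeval_Xc_apply, aeval_Xc_apply, ← (hr x hx).2]
    exact (div_mul_cancel₀ _ (hr x hx).1).symm
  rw [e, mul_assoc, Ring.mul_inverse_cancel _ hu, mul_one]

theorem coeFn_mulOp_Xc (h : IsRuelleEigenMeasure τ μ) (u : Lp ℂ 2 μ) :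
    (b.repr.symm (mulOp b Xc (b.repr u)) : ℝ → ℂ) =ᵐ[μ] fun x => (x : ℂ) * u x := by
  rw [mulOp_apply, b.repr.symm_apply_apply, b.repr.symm_apply_apply]
  filter_upwards [coeFn_mulL2 Xc u, h.ae_mem] with x h1 hx
  lift x to II using hx
  rw [h1, extC_coe]
  rfl

end System

/-! ### The Julia set -/

section Julia

variable {τ : ℝ} (hτ : 1 < τ)

/-- A real number as a point of the Riemann sphere. -/
def toSphere (x : ℝ) : OnePoint ℂ := ((x : ℂ) : OnePoint ℂ)

theorem continuous_toSphere : Continuous toSphere :=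
  OnePoint.continuous_coe.comp Complex.continuous_ofReal

theorem injective_toSphere : Function.Injective toSphere :=
  OnePoint.coe_injective.comp Complex.ofReal_injective

theorem sphereMap_toSphere {x : ℝ} (hx : x ≠ 0) :
    sphereMap τ (toSphere x) = toSphere (piR τ x) := by
  have h : sphereMap τ (toSphere x) = ((τ * (x : ℂ) - (τ - 1) / (x : ℂ) : ℂ) : OnePoint ℂ) :=
    if_neg (Complex.ofReal_ne_zero.2 hx)
  rw [h, toSphere, piR]
  push_cast
  rfl

theorem sphereMap_brI (hτ : 1 < τ) {σ : ℝ} (hσ : σ * σ = 1) (x : II) :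
    sphereMap τ (toSphere (brI τ σ x)) = toSphere x := by
  have h := le_abs_brI hτ hσ x
  rw [sphereMap_toSphere (abs_pos.1 ((ratio_pos hτ).trans_le h)), ← coe_piI hτ h, piI_brI hτ hσ]

/-- The points near a point of the Cantor set that are obtained by pulling back a given point along
the inverse branches of its orbit. -/
theorem exists_sphereMap_iterate_eq (t : II) (n : ℕ) : ∀ x ∈ cantor hτ, ∃ w : II,
    |(w : ℝ) - x| ≤ |(t : ℝ) - (piI hτ)^[n] x| / τ ^ n ∧
      (sphereMap τ)^[n] (toSphere w) = toSphere t := by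
  induction n with
  | zero => exact fun x _ => ⟨t, by simp, rfl⟩
  | succ n ih =>
    intro x hx
    obtain ⟨w, hw, hwt⟩ := ih _ (piI_mem_cantor hτ hx)
    obtain ⟨σ, hσ, hxσ⟩ : ∃ σ : ℝ, σ * σ = 1 ∧ x = brI τ σ (piI hτ x) := by
      rcases exists_eq_brI hτ (le_abs_of_mem_cantor hτ hx) with h | h
      · exact ⟨1, by norm_num, h⟩
      · exact ⟨-1, by norm_num, h⟩
    refine ⟨brI τ σ w, ?_, ?_⟩
    · have h1 : |(brI τ σ w : ℝ) - x| ≤ |(w : ℝ) - piI hτ x| / τ := by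
        conv_lhs => rw [hxσ, coe_brI hτ hσ, coe_brI hτ hσ]
        exact abs_br_sub_le hτ hσ _ _
      refine h1.trans ?_
      rw [pow_succ, ← div_div]
      exact div_le_div_of_nonneg_right hw (by linarith)
    · rw [Function.iterate_succ_apply, sphereMap_brI hτ hσ, hwt]

/-- Pulling the `n`-th iterate of `x` back along its own orbit returns `x`. -/
theorem sphereMap_iterate_of_mem_cantor {x : II} (hx : x ∈ cantor hτ) (n : ℕ) :
    (sphereMap τ)^[n] (toSphere x) = toSphere ((piI hτ)^[n] x) := by
  obtain ⟨w, hw, h⟩ := exists_sphereMap_iterate_eq hτ ((piI hτ)^[n] x) n x hx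
  rw [sub_self, abs_zero, zero_div] at hw
  rwa [Subtype.ext (sub_eq_zero.1 (abs_nonpos_iff.1 hw))] at h

/-- A point of the interval at distance at least `1` from the `n`-th iterate of `x`, pulled back
along the orbit, lands within `2/τⁿ` of `x`. Arbitrarily close points are thus separated by a fixed
amount. -/
theorem toSphere_mem_juliaSet {x : II} (hx : x ∈ cantor hτ) :
    toSphere x ∈ juliaSet (sphereMap τ) := by
  let _ : UniformSpace (OnePoint ℂ) := uniformSpaceOfCompactR1
  rintro ⟨U, hU, hE⟩
  have hE := hE _ (mem_of_mem_nhds hU)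
  rw [EquicontinuousWithinAt, nhdsWithin_eq_nhds.2 hU] at hE
  set K : Set (OnePoint ℂ × OnePoint ℂ) :=
    (fun q : II × II => (toSphere q.1, toSphere q.2)) '' {q | 1 ≤ |(q.2 : ℝ) - q.1|} with hK
  have hKc : IsClosed K := by
    refine (IsCompact.image (IsClosed.isCompact ?_) ?_).isClosed
    · exact isClosed_le continuous_const (by fun_prop)
    · exact ((continuous_toSphere.comp continuous_subtype_val).comp continuous_fst).prodMk
        ((continuous_toSphere.comp continuous_subtype_val).comp continuous_snd)
  -- In a compact Hausdorff space the entourages are the neighbourhoods of the diagonal, so no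
  -- metric on the sphere is needed.
  have hV : Kᶜ ∈ uniformity (OnePoint ℂ) := by
    refine hKc.isOpen_compl.mem_nhdsSet.2 ?_
    rintro ⟨u, v⟩ huv ⟨q, hq, hqe⟩
    have huv : u = v := huv
    subst huv
    obtain ⟨h1, h2⟩ := Prod.mk.inj hqe
    change 1 ≤ |(q.2 : ℝ) - q.1| at hq
    rw [injective_toSphere (h1.trans h2.symm), sub_self, abs_zero] at hq
    linarith
  have h1 := continuous_toSphere.continuousAt.eventually (hE _ hV)
  obtain ⟨δ, hδ, hball⟩ := Metric.eventually_nhds_iff.1 h1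
  obtain ⟨n, hn⟩ := pow_unbounded_of_one_lt (2 / δ) hτ
  set s : II := (piI hτ)^[n] x with hs
  obtain ⟨t, ht⟩ : ∃ t : II, 1 ≤ |(t : ℝ) - s| := by
    rcases le_total (s : ℝ) 0 with h | h
    · refine ⟨⟨1, by norm_num⟩, ?_⟩
      rw [le_abs]; left; dsimp only; linarith
    · refine ⟨⟨-1, by norm_num⟩, ?_⟩
      rw [le_abs]; right; dsimp only; linarith
  obtain ⟨w, hw, hwt⟩ := exists_sphereMap_iterate_eq hτ t n x hx
  have hpow : 0 < τ ^ n := pow_pos (by linarith) n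
  have hlt : dist (w : ℝ) x < δ := by
    rw [Real.dist_eq]
    refine hw.trans_lt ?_
    have h2 : |(t : ℝ) - s| ≤ 2 := by
      have := abs_sub (t : ℝ) s
      linarith [abs_coe_le t, abs_coe_le s]
    rw [div_lt_iff₀ hδ] at hn
    rw [div_lt_iff₀ hpow]
    linarith
  refine hball hlt n ⟨(s, t), ht, ?_⟩
  dsimp only
  rw [hwt, sphereMap_iterate_of_mem_cantor hτ hx]

end Julia

end RationalRenorm

end

theorem mainTheorem12 (τ : ℝ) (hτ : 1 < τ) :
    -- the transform is well defined on admissible operators and can be iterated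
    (∀ A : RationalRenorm.Op, RationalRenorm.Admissible A →
      (∃! Φ : RationalRenorm.Op, RationalRenorm.IsTriangularFactor τ A Φ) ∧
      IsUnit (RationalRenorm.triangularFactor τ A) ∧
      RationalRenorm.Admissible (RationalRenorm.renorm τ A)) ∧
    ∃ (μ : Measure ℝ) (A : RationalRenorm.Op) (e : ℕ → RatFunc ℂ) (c : ℕ → ℕ → ℂ),
      -- the eigen-measure: existence, uniqueness, support
      RationalRenorm.IsRuelleEigenMeasure τ μ ∧
      (∀ μ' : Measure ℝ, RationalRenorm.IsRuelleEigenMeasure τ μ' → μ' = μ) ∧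
      (∀ᵐ x : ℝ ∂μ, (((x : ℂ) : OnePoint ℂ)) ∈
        RationalRenorm.juliaSet (RationalRenorm.sphereMap τ)) ∧
      (∀ x : ℝ, μ {x} = 0) ∧ μ ⟂ₘ volume ∧
      -- weak convergence of the iterations, from any admissible operator, to `A`
      RationalRenorm.Admissible A ∧
      (∀ A₀ : RationalRenorm.Op, RationalRenorm.Admissible A₀ →
        ∀ x y : RationalRenorm.HalfAxis,
          Tendsto (fun n : ℕ => ⟪x, ((RationalRenorm.renorm τ)^[n] A₀) y⟫_ℂ) atTop
            (𝓝 ⟪x, A y⟫_ℂ)) ∧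
      RationalRenorm.IsSpectralMeasure A μ ∧
      -- the system of rational functions and its uniqueness
      RationalRenorm.IsRenormSystem τ μ e c ∧
      (∀ (e' : ℕ → RatFunc ℂ) (c' : ℕ → ℕ → ℂ),
        RationalRenorm.IsRenormSystem τ μ e' c' → e' = e ∧ c' = c) ∧
      (∀ k, ∀ᵐ x : ℝ ∂μ, (e k).denom.eval (x : ℂ) ≠ 0) ∧
      -- it is an orthonormal basis in which `A` is multiplication by the independent variable
      (∃ b : HilbertBasis ℕ ℂ (Lp ℂ 2 μ),
        (∀ k, (b k : ℝ → ℂ) =ᵐ[μ] RationalRenorm.ratVal (e k)) ∧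
        ∀ f : Lp ℂ 2 μ, (b.repr.symm (A (b.repr f)) : ℝ → ℂ) =ᵐ[μ] fun x => (x : ℂ) * f x) ∧
      -- `e_k(A)|0⟩ = |k⟩`
      (∀ k, IsUnit (Polynomial.aeval A (e k).denom) ∧
        RationalRenorm.ratOp (e k) A (RationalRenorm.ket 0) = RationalRenorm.ket k) ∧
      -- the coefficient matrix is the inverse of the triangular factor of `A`
      (∀ j k, c k j =
        RationalRenorm.entry (Ring.inverse (RationalRenorm.triangularFactor τ A)) j k) := by

  refine ⟨fun A hA => ⟨RationalRenorm.existsUnique_triangularFactor hτ hA.selfAdjoint,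
    RationalRenorm.isUnit_triangularFactor hτ hA.selfAdjoint,
    RationalRenorm.admissible_renorm hτ hA⟩, ?_⟩
  obtain ⟨μ, h⟩ := RationalRenorm.exists_isRuelleEigenMeasure hτ
  have := h.prob
  obtain ⟨p, hp⟩ := RationalRenorm.exists_stepC_fixed hτ (RationalRenorm.meanC μ)
  obtain ⟨b, hb⟩ := RationalRenorm.exists_hilbertBasis_fixed h hp
  have hp0 := RationalRenorm.fixed_zero hp
  obtain ⟨e, h0, h2, h1⟩ := RationalRenorm.exists_ratFunc_system τ
    (RationalRenorm.cholCol (RationalRenorm.gramC τ (RationalRenorm.meanC μ) p))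
  have hr := RationalRenorm.represents_fixed hp h0 h2 h1
  have hs := RationalRenorm.isRenormSystem_cholCol h hp h0 h2 h1
  refine ⟨μ, RationalRenorm.mulOp b RationalRenorm.Xc, e, _, h, fun μ' h' => h.unique hτ h', ?_,
    RationalRenorm.measure_singleton_eq_zero hτ h, RationalRenorm.mutuallySingular_volume hτ h,
    RationalRenorm.admissible_mulOp hτ h hp0 hb,
    fun A₀ hA₀ x y => RationalRenorm.tendsto_weak hτ hA₀ h hp hb x y,
    RationalRenorm.isSpectralMeasure_mulOp h hp0 hb, hs,
    fun e' c' hs' => hs.unique h hp hr hs', fun k => (hr k).ae_denom h, ⟨b, fun k => ?_,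
      RationalRenorm.coeFn_mulOp_Xc h⟩, fun k => ⟨(hr k).isUnit_aeval_denom h, ?_⟩, fun j k =>
      (RationalRenorm.entry_inverse_limit hτ hb j k).symm⟩
  · filter_upwards [RationalRenorm.ae_cantor hτ h] with x hx
    obtain ⟨y, hy, rfl⟩ := hx
    exact RationalRenorm.toSphere_mem_juliaSet hτ hy
  · rw [hb k]
    exact (RationalRenorm.coeFn_toL2 μ (p k)).trans ((hr k).ae h).symm
  · rw [(hr k).ratOp_mulOp h, RationalRenorm.mulOp_ket_zero hp0 hb, ← hb k, b.repr_self]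
    rfl
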